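/- Let $C$ be a smooth projective geometrically irreducible curve over the finite field $\mathbb F_q$ with function field $Q$, let $\infty\in C(\mathbb F_q)$, $A=\Gamma(C\setminus\{\infty\},\mathcal O_C)$, let $L=\mathbb F_s$ be a finite extension of $\mathbb F_q$ with $s=q^e$, and fix an $\mathbb F_q$-morphism $c:\operatorname{Spec}L\to C$ with image the closed point $\varepsilon$. Put $C_L=C\times_{\mathbb F_q}\operatorname{Spec}L$, let $\sigma=\mathrm{id}_C\times\operatorname{Spec}(\mathrm{Frob}_q)$, and let $\mathcal I$ be the ideal sheaf of the graph of $c$ on $C_L$. An *abelian $\tau$-sheaf* $\underline{\mathcal F}=(\mathcal F_i,\Pi_i,\tau_i)_{i\in\mathbb Z}$ of rank $r$, dimension $d$ and characteristic $c$ over $L$ consists of locally free sheaves $\mathcal F_i$ of rank $r$ on $C_L$ and injective $\mathcal O_{C_L}$-homomorphisms $\Pi_i:\mathcal F_i\to\mathcal F_{i+1}$, $\tau_i:\sigma^*\mathcal F_i\to\mathcal F_{i+1}$ with $\Pi_{i+1}\tau_i=\tau_{i+1}\,\sigma^*\Pi_i$ such that: there are integers $k,l>0$ with $ld=kr$ such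 that $\Pi_{i+l-1}\circ\dots\circ\Pi_i$ identifies $\mathcal F_i$ with $\mathcal F_{i+l}(-k\cdot\infty)\subset\mathcal F_{i+l}$ for all $i$; $\dim_L\operatorname{coker}\Pi_i=d$ for all $i$; and $\dim_L\operatorname{coker}\tau_i=d$ and $\mathcal I^d\operatorname{coker}\tau_i=0$ for all $i$. Its *weight* is $d/r$ (and $0$ if $r=0$). A *morphism* $\underline{\mathcal F}\to\underline{\mathcal F}'$ is a family of $\mathcal O_{C_L}$-homomorphisms $f_i:\mathcal F_i\to\mathcal F_i'$ commuting with the $\Pi$'s and the $\tau$'s. The $Q$-vector space $\operatorname{QHom}(\underline{\mathcal F},\underline{\mathcal F}')$ of quasi-morphisms is the union (direct limit along the natural inclusions) of the $\operatorname{Hom}(\underline{\mathcal F},\underline{\mathcal F}'(D))$ over all effective divisors $D$ on $C$. Let $v\neq\infty,\varepsilon$ be a closed point of $C$, $A_v$ the completion of $A$ at $v$ and $Q_v=\operatorname{Frac}A_v$. Put $M=\Gamma(C_L\setminus\{\infty\},\mathcal F_0)$ and $\tau=\Pi_0^{-1}\circ\tau_0:\sigma^*M\to M$. The rational $v$-adic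 Tate module of $\underline{\mathcal F}$ is $$V_v\underline{\mathcal F}=\Bigl(\varprojlim_n\bigl((M/v^nM)\otimes_LL^{\rm sep}\bigr)^{\tau}\Bigr)\otimes_{A_v}Q_v ,$$ where $\tau$ acts on $L^{\rm sep}$ as the $q$-Frobenius and the superscript denotes invariants. The $s$-Frobenius $\pi=\tau^e:M\to M$ is $A\otimes_{\mathbb F_q}L$-linear and induces a $Q_v$-linear endomorphism $\pi_v$ of $V_v\underline{\mathcal F}$; let $\chi_v\in Q_v[x]$ be its characteristic polynomial. For nonzero polynomials $f,g$ over a field $K$ put $$r_K(f,g)=\sum_{\mu}m(\mu)\,n(\mu)\,\deg\mu ,$$ the sum over all monic irreducible $\mu\in K[x]$, where $m(\mu)$ and $n(\mu)$ are the multiplicities of $\mu$ in $f$ and in $g$. **Theorem.** Let $\underline{\mathcal F}$ and $\underline{\mathcal F}'$ be abelian $\tau$-sheaves of the same characteristic $c$ and of the same weight over $\mathbb F_s$, and let $v\neq\varepsilon,\infty$ be a place of $Q$ such that the endomorphisms $\pi_v$ of $V_v\underline{\mathcal F}$ and $\pi_v'$ of $V_v\underline{\mathcal F}'$ are semisimple.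 Let $\chi_v$ and $\chi'_v$ be their characteristic polynomials. Then $$\dim_Q\operatorname{QHom}(\underline{\mathcal F},\underline{\mathcal F}')=r_{Q_v}(\chi_v,\chi_v') .$$ -/

import Mathlib

open scoped TensorProduct

namespace TauSheaf

universe w

/-! ## The curve -/

/-- A pair `(C, ∞)` consisting of a smooth projective geometrically irreducible curve `C` over
`Fq` with function field `Q` and an `Fq`-rational point `∞` of `C`, given by the two rings
`A = Γ(C ∖ {∞}, 𝒪_C)` and `O = 𝒪_{C,∞}` inside `Q`.  Thus `Spec A` is a smooth affine curve, and
the closed points of `C` (the places of `Q`, i.e. the nontrivial valuation rings of `Q` over `Fq`)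
are the closed points of `Spec A` together with the single further point `∞`. -/
structure PointedCurve (Fq Q : Type*) [Field Fq] [Field Q] [Algebra Fq Q] where
  /-- the ring of functions regular outside `∞` -/
  A : Subalgebra Fq Q
  /-- the local ring at `∞` -/
  O : Subalgebra Fq Q
  isDedekindDomain : IsDedekindDomain A
  finiteType : Algebra.FiniteType Fq A
  isFractionRing : IsFractionRing A Q
  /-- `Fq` is algebraically closed in `Q` (geometric irreducibility) -/
  isAlgClosedIn : ∀ x : Q, IsAlgebraic Fq x → x ∈ Set.range (algebraMap Fq Q)
  isDVR : IsDiscreteValuationRing O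
  isFractionRing_O : IsFractionRing O Q
  /-- the residue field at `∞` is `Fq` -/
  rational : ∀ x : O, ∃ a : Fq, ¬ IsUnit (x - algebraMap Fq O a)
  /-- `∞` is the one and only place of `Q` that is not centred on `Spec A` -/
  places : ∀ R : ValuationSubring Q, (∀ a : Fq, algebraMap Fq Q a ∈ R) → R ≠ ⊤ →
    ((A : Set Q) ⊆ R ↔ (R : Set Q) ≠ O)

attribute [instance] PointedCurve.isDedekindDomain PointedCurve.finiteType
  PointedCurve.isFractionRing PointedCurve.isDVR PointedCurve.isFractionRing_O

section Base

variable {Fq Q : Type*} [Field Fq] [Field Q] [Algebra Fq Q] (C : PointedCurve Fq Q)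
variable (L : Type*) [Field L] [Algebra Fq L]

/-- For a subring `R` of `Q` the ring `R_L = R ⊗ L`, as a subring of `Q_L = Q ⊗ L`
(we write the factor `L` on the left). -/
noncomputable def ext (R : Subalgebra Fq Q) : Subalgebra L (L ⊗[Fq] Q) :=
  (Algebra.TensorProduct.map (AlgHom.id L L) R.val).range

theorem one_tmul_mem_ext (R : Subalgebra Fq Q) (a : R) :
    (1 : L) ⊗ₜ[Fq] (a : Q) ∈ ext L R :=
  ⟨(1 : L) ⊗ₜ[Fq] a, by simp⟩

noncomputable instance (R : Subalgebra Fq Q) : CommRing (ext L R) :=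
  Subalgebra.toCommRing (ext L R)

/-- The inclusion `R → R_L`, `a ↦ a ⊗ 1`. -/
noncomputable def toExt (R : Subalgebra Fq Q) : R →+* ext L R where
  toFun a := ⟨(1 : L) ⊗ₜ[Fq] (a : Q), one_tmul_mem_ext L R a⟩
  map_one' := rfl
  map_zero' := by ext; simp
  map_mul' a b := by ext; simp
  map_add' a b := by ext; simp [TensorProduct.tmul_add]

noncomputable instance (R : Subalgebra Fq Q) : Algebra R (ext L R) := (toExt L R).toAlgebra

/-- `A_L = A ⊗ L` -/
noncomputable abbrev PointedCurve.AL : Subalgebra L (L ⊗[Fq] Q) := ext L C.A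

/-- `O_L = 𝒪_{C,∞} ⊗ L` -/
noncomputable abbrev PointedCurve.OL : Subalgebra L (L ⊗[Fq] Q) := ext L C.O

/-- The ideal of the closed subscheme `∞ × Spec L` in `O_L`. -/
noncomputable def PointedCurve.idealInf : Ideal (C.OL L) :=
  (IsLocalRing.maximalIdeal C.O).map (toExt L C.O)

/-! ## Locally free sheaves on `C_L` -/

/-- A sheaf on `C_L = C × Spec L` embedded in its generic fibre, given by gluing: the generic
fibre `V` (a `Q_L`-module), the `A_L`-module `aff ⊆ V` of sections over
`C_L ∖ {∞} = Spec A_L`, and the `O_L`-module `inf ⊆ V` of germs along `∞ × Spec L`. -/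
structure LatticeSheaf where
  V : Type w
  [addCommGroup : AddCommGroup V]
  [module : Module (L ⊗[Fq] Q) V]
  aff : Submodule (C.AL L) V
  inf : Submodule (C.OL L) V

attribute [instance] LatticeSheaf.addCommGroup LatticeSheaf.module

end Base

theorem exists_pole {Fq Q : Type*} [Field Fq] [Field Q] [Algebra Fq Q]
    (C : PointedCurve Fq Q) (a : Q) :
    (∃ b : C.A, b ≠ 0 ∧ (b : Q) * a ∈ C.A) ∧
    ∃ n : ℕ, ∀ b ∈ IsLocalRing.maximalIdeal C.O ^ n, (b : Q) * a ∈ C.O := by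
  constructor
  · obtain ⟨x, y, hy, rfl⟩ := IsFractionRing.div_surjective (A := C.A) a
    refine ⟨y, nonZeroDivisors.ne_zero hy, ?_⟩
    have : (y : Q) ≠ 0 := by
      simpa using nonZeroDivisors.ne_zero hy
    change (y : Q) * ((x : Q) / (y : Q)) ∈ _
    rw [mul_div_cancel₀ _ this]
    exact x.2
  · obtain ⟨x, y, hy, rfl⟩ := IsFractionRing.div_surjective (A := C.O) a
    have hy0 : y ≠ 0 := nonZeroDivisors.ne_zero hy
    obtain ⟨ϖ, hϖ⟩ := IsDiscreteValuationRing.exists_irreducible C.O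
    obtain ⟨n, u, hu⟩ := IsDiscreteValuationRing.eq_unit_mul_pow_irreducible hy0 hϖ
    refine ⟨n, fun b hb => ?_⟩
    rw [hϖ.maximalIdeal_eq, Ideal.span_singleton_pow, Ideal.mem_span_singleton] at hb
    have hyb : y ∣ b := by
      rw [hu]
      exact (Units.mul_left_dvd).2 hb
    obtain ⟨z, rfl⟩ := hyb
    have : (y : Q) ≠ 0 := by simpa using hy0
    change ((y * z : C.O) : Q) * ((x : Q) / (y : Q)) ∈ _
    have e : ((y * z : C.O) : Q) * ((x : Q) / (y : Q)) = ((z * x : C.O) : Q) := by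
      push_cast
      field_simp
    rw [e]
    exact (z * x).2

section Sheaves

variable {Fq Q : Type*} [Field Fq] [Field Q] [Algebra Fq Q] {C : PointedCurve Fq Q}
variable {L : Type*} [Field L] [Algebra Fq L]

/-- The `L`-vector space structure induced by `L → Q_L`. -/
noncomputable instance (F : LatticeSheaf.{w} C L) : Module L F.V :=
  Module.compHom F.V (algebraMap L (L ⊗[Fq] Q))

/-- The `Q`-vector space structure induced by `Q → Q_L`. -/
noncomputable instance (F : LatticeSheaf.{w} C L) : Module Q F.V :=
  Module.compHom F.V
    ((Algebra.TensorProduct.includeRight : Q →ₐ[Fq] L ⊗[Fq] Q) : Q →+* L ⊗[Fq] Q)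

theorem smul_Q_def (F : LatticeSheaf.{w} C L) (a : Q) (x : F.V) :
    a • x = ((1 : L) ⊗ₜ[Fq] a) • x := rfl

instance (F : LatticeSheaf.{w} C L) : IsScalarTower L (L ⊗[Fq] Q) F.V :=
  ⟨fun a b x => by
    rw [Algebra.smul_def, mul_smul]; rfl⟩

instance (F : LatticeSheaf.{w} C L) : SMulCommClass (L ⊗[Fq] Q) Q F.V :=
  ⟨fun a b x => by rw [smul_Q_def, smul_Q_def, smul_smul, smul_smul, mul_comm]⟩

instance (F : LatticeSheaf.{w} C L) : SMulCommClass L Q F.V :=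
  ⟨fun a b x => by
    rw [← algebraMap_smul (L ⊗[Fq] Q) a (b • x), ← algebraMap_smul (L ⊗[Fq] Q) a x, smul_comm]⟩

instance (F : LatticeSheaf.{w} C L) : IsScalarTower C.A (C.AL L) F.V :=
  ⟨fun a b x => by
    rw [Algebra.smul_def, mul_smul]; rfl⟩

noncomputable instance (F : LatticeSheaf.{w} C L) : AddCommGroup F.aff :=
  Submodule.addCommGroup F.aff

noncomputable instance (F : LatticeSheaf.{w} C L) : Module L F.aff := Submodule.module' F.aff

noncomputable instance (F : LatticeSheaf.{w} C L) : Module C.A F.aff := Submodule.module' F.aff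

instance (F : LatticeSheaf.{w} C L) : SMulCommClass L C.A F.aff :=
  ⟨fun a b x => Subtype.ext (smul_comm a (b : Q) (x : F.V))⟩

theorem toExt_smul_smul (F : LatticeSheaf.{w} C L) (R : Subalgebra Fq Q) (a : Q) (u t : R)
    (h : (u : Q) * a ∈ R) (x : F.V) :
    toExt L R (u * t) • (a • x) = toExt L R ⟨u * a, h⟩ • (toExt L R t • x) := by
  change ((1 : L) ⊗ₜ[Fq] ((u : Q) * (t : Q))) • (((1 : L) ⊗ₜ[Fq] a) • x) =
    ((1 : L) ⊗ₜ[Fq] ((u : Q) * a)) • (((1 : L) ⊗ₜ[Fq] (t : Q)) • x)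
  rw [smul_smul, smul_smul, Algebra.TensorProduct.tmul_mul_tmul,
    Algebra.TensorProduct.tmul_mul_tmul, mul_right_comm]

/-- `F` is a locally free sheaf of rank `r` on `C_L`. -/
structure LatticeSheaf.IsLocallyFree (F : LatticeSheaf.{w} C L) (r : ℕ) : Prop where
  free : Module.Free (L ⊗[Fq] Q) F.V
  finite : Module.Finite (L ⊗[Fq] Q) F.V
  rank : Module.finrank (L ⊗[Fq] Q) F.V = r
  finite_aff : Module.Finite (C.AL L) F.aff
  projective_aff : Module.Projective (C.AL L) F.aff
  span_aff : Submodule.span (L ⊗[Fq] Q) (F.aff : Set F.V) = ⊤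
  finite_inf : Module.Finite (C.OL L) F.inf
  projective_inf : Module.Projective (C.OL L) F.inf
  span_inf : Submodule.span (L ⊗[Fq] Q) (F.inf : Set F.V) = ⊤

/-- A map on generic fibres that maps sections to sections. -/
def MapsSections (F F' : LatticeSheaf.{w} C L) (f : F.V → F'.V) : Prop :=
  Set.MapsTo f F.aff F'.aff ∧ Set.MapsTo f F.inf F'.inf

variable (C) in
/-- An effective divisor `D` on `C`: its part on `Spec A` is given by the corresponding nonzero
ideal of `A` and its multiplicity at `∞` by a natural number. -/
structure EffectiveDivisor where
  ideal : Ideal C.A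
  ideal_ne_bot : ideal ≠ ⊥
  mult : ℕ

/-- The sheaf `F(D) = F ⊗ 𝒪(D)` for an effective divisor `D` on `C`; it has the same generic
fibre as `F`. -/
noncomputable def LatticeSheaf.twist (F : LatticeSheaf.{w} C L) (D : EffectiveDivisor C) :
    LatticeSheaf.{w} C L where
  V := F.V
  aff :=
    { carrier := {x | ∀ a ∈ D.ideal, toExt L C.A a • x ∈ F.aff}
      add_mem' := fun hx hy a ha => by
        rw [smul_add]; exact F.aff.add_mem (hx a ha) (hy a ha)
      zero_mem' := fun a _ => by rw [smul_zero]; exact F.aff.zero_mem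
      smul_mem' := fun b x hx a ha => by
        rw [smul_comm]; exact F.aff.smul_mem b (hx a ha) }
  inf :=
    { carrier := {x | ∀ a ∈ IsLocalRing.maximalIdeal C.O ^ D.mult, toExt L C.O a • x ∈ F.inf}
      add_mem' := fun hx hy a ha => by
        rw [smul_add]; exact F.inf.add_mem (hx a ha) (hy a ha)
      zero_mem' := fun a _ => by rw [smul_zero]; exact F.inf.zero_mem
      smul_mem' := fun b x hx a ha => by
        rw [smul_comm]; exact F.inf.smul_mem b (hx a ha) }

/-- `dim_L` of (the global sections of) the quotient of the sheaf with sections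
`Γ(C_L ∖ ∞, F)` and germs `F_∞` by the subsheaf with sections `P` and germs `N`. -/
noncomputable def cokerRank (F : LatticeSheaf.{w} C L) (P : Submodule (C.AL L) F.V)
    (N : Submodule (C.OL L) F.V) : Cardinal.{w} :=
  Module.rank L (F.aff ⧸ P.submoduleOf F.aff) + Module.rank L (F.inf ⧸ N.submoduleOf F.inf)

/-! ## Abelian `τ`-sheaves -/

/-- The characteristic: a morphism `c : Spec L → C` over `Fq`, where `L` is finite over `Fq`.
It either factors through `Spec A`, and is then given by an `Fq`-homomorphism `c^* : A → L`, or its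
image is `∞`, and then it is the unique such morphism as `∞` has residue field `Fq`. -/
inductive Characteristic (C : PointedCurve Fq Q) (L : Type*) [Field L] [Algebra Fq L]
  | affine (cstar : C.A →ₐ[Fq] L)
  | infinity

/-- The sections over `Spec A_L` of the ideal sheaf of the graph of `c`. -/
noncomputable def Characteristic.graphAff : Characteristic C L → Ideal (C.AL L)
  | .affine cstar =>
      Ideal.span (Set.range fun a : C.A => toExt L C.A a - algebraMap L (C.AL L) (cstar a))
  | .infinity => ⊤

/-- The germs along `∞ × Spec L` of the ideal sheaf of the graph of `c` (`L` finite). If the image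
of `c` is `∞` then the graph is `∞ × Spec L`. -/
noncomputable def Characteristic.graphInf : Characteristic C L → Ideal (C.OL L)
  | .affine _ => ⊤
  | .infinity => C.idealInf L

/-- The closed point `v ≠ ∞` of `C` is the image `ε` of `c`. -/
def Characteristic.IsPoint (c : Characteristic C L)
    (v : IsDedekindDomain.HeightOneSpectrum C.A) : Prop :=
  match c with
  | .affine cstar => v.asIdeal = RingHom.ker cstar
  | .infinity => False

/-- The linear identification `V_i = V_j` for equal indices `i = j`. -/
def castLin (F : ℤ → LatticeSheaf.{w} C L) {i j : ℤ} (h : i = j) :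
    (F i).V →ₗ[L ⊗[Fq] Q] (F j).V :=
  h ▸ LinearMap.id

/-- The composite `Π_{i+n-1} ∘ ⋯ ∘ Π_i : F_i → F_{i+n}`. -/
def iterPi (F : ℤ → LatticeSheaf.{w} C L) (P : ∀ i, (F i).V →ₗ[L ⊗[Fq] Q] (F (i + 1)).V)
    (i : ℤ) : (n : ℕ) → (F i).V →ₗ[L ⊗[Fq] Q] (F (i + n)).V
  | 0 => castLin F (by simp)
  | n + 1 => castLin F (by push_cast; ring) ∘ₗ P (i + n) ∘ₗ iterPi F P i n

theorem castLin_injective (F : ℤ → LatticeSheaf.{w} C L) {i j : ℤ} (h : i = j) :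
    Function.Injective (castLin F h) := by
  subst h; exact fun _ _ h => h

theorem castLin_mapsSections (F : ℤ → LatticeSheaf.{w} C L) {i j : ℤ} (h : i = j) :
    MapsSections (F i) (F j) (castLin F h) := by
  subst h; exact ⟨fun _ h => h, fun _ h => h⟩

theorem iterPi_mapsSections (F : ℤ → LatticeSheaf.{w} C L)
    (P : ∀ i, (F i).V →ₗ[L ⊗[Fq] Q] (F (i + 1)).V)
    (hP : ∀ i, MapsSections (F i) (F (i + 1)) (P i)) (i : ℤ) :
    ∀ n : ℕ, MapsSections (F i) (F (i + n)) (iterPi F P i n)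
  | 0 => castLin_mapsSections F _
  | n + 1 =>
    have ih := iterPi_mapsSections F P hP i n
    have hc := castLin_mapsSections F
      (show i + (n : ℤ) + 1 = i + ((n + 1 : ℕ) : ℤ) by push_cast; ring)
    ⟨hc.1.comp ((hP _).1.comp ih.1), hc.2.comp ((hP _).2.comp ih.2)⟩

end Sheaves

section Frobenius

variable {Fq Q : Type*} [Field Fq] [Fintype Fq] [Field Q] [Algebra Fq Q] {C : PointedCurve Fq Q}
variable {L : Type*} [Field L] [Algebra Fq L]

variable (Fq L) in
/-- The `q`-Frobenius `x ↦ x ^ q` on `L`. -/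
noncomputable abbrev frobL : L →+* L := (FiniteField.frobeniusAlgHom Fq L : L →+* L)

variable (Fq Q L) in
/-- The endomorphism `σ^*` of `Q_L`: the identity on `Q` and the `q`-Frobenius on `L`. -/
noncomputable def sigma : L ⊗[Fq] Q →+* L ⊗[Fq] Q :=
  (Algebra.TensorProduct.map (FiniteField.frobeniusAlgHom Fq L) (AlgHom.id Fq Q) :
    L ⊗[Fq] Q →ₐ[Fq] L ⊗[Fq] Q)

@[simp] theorem sigma_tmul (b : L) (a : Q) :
    sigma Fq Q L (b ⊗ₜ a) = frobL Fq L b ⊗ₜ a := by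
  simp [sigma]

/-- An abelian `τ`-sheaf of characteristic `c` over the finite field `L`.  An `𝒪`-linear map
`τ_i : σ^*F_i → F_{i+1}` is the same as a `σ^*`-semilinear map on generic fibres which maps the
sections of `F_i` to sections of `F_{i+1}`; as `σ^*` is bijective on `Q_L` (`L` being perfect), the
former is injective if and only if the latter is.  The image of `σ^*F_i` is spanned by the images
of the sections of `F_i`. -/
structure AbelianTauSheaf (C : PointedCurve Fq Q) [Finite L] (c : Characteristic C L) where
  /-- the rank -/
  r : ℕ
  /-- the dimension -/
  d : ℕ
  F : ℤ → LatticeSheaf.{w} C L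
  Pi : ∀ i, (F i).V →ₗ[L ⊗[Fq] Q] (F (i + 1)).V
  tau : ∀ i, (F i).V →ₛₗ[sigma Fq Q L] (F (i + 1)).V
  isLocallyFree : ∀ i, (F i).IsLocallyFree r
  mapsSections_Pi : ∀ i, MapsSections (F i) (F (i + 1)) (Pi i)
  mapsSections_tau : ∀ i, MapsSections (F i) (F (i + 1)) (tau i)
  injective_Pi : ∀ i, Function.Injective (Pi i)
  injective_tau : ∀ i, Function.Injective (tau i)
  comm : ∀ i x, Pi (i + 1) (tau i x) = tau (i + 1) (Pi i x)
  /-- the composite `Π_{i+l-1} ∘ ⋯ ∘ Π_i` identifies `F_i` with `F_{i+l}(-k·∞)` -/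
  periodic : ∃ k l : ℕ, 0 < k ∧ 0 < l ∧ l * d = k * r ∧ ∀ i : ℤ,
    (F i).aff.map ((iterPi F Pi i l).restrictScalars (C.AL L)) = (F (i + l)).aff ∧
    (F i).inf.map ((iterPi F Pi i l).restrictScalars (C.OL L)) =
      (C.idealInf L) ^ k • (F (i + l)).inf
  coker_Pi : ∀ i, cokerRank (F (i + 1))
    ((F i).aff.map ((Pi i).restrictScalars (C.AL L)))
    ((F i).inf.map ((Pi i).restrictScalars (C.OL L))) = d
  coker_tau : ∀ i, cokerRank (F (i + 1))
    (Submodule.span (C.AL L) (tau i '' (F i).aff))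
    (Submodule.span (C.OL L) (tau i '' (F i).inf)) = d
  /-- the cokernel of `τ_i` is annihilated by the `d`-th power of the ideal of the graph -/
  annihilates_aff : ∀ i, c.graphAff ^ d • (F (i + 1)).aff ≤
    Submodule.span (C.AL L) (tau i '' (F i).aff)
  annihilates_inf : ∀ i, c.graphInf ^ d • (F (i + 1)).inf ≤
    Submodule.span (C.OL L) (tau i '' (F i).inf)

namespace AbelianTauSheaf

variable [Finite L] {c : Characteristic C L}

/-- The weight `d / r` (and `0` for the zero sheaf, where `r = 0`). -/
def weight (F : AbelianTauSheaf.{w} C c) : ℚ := if F.r = 0 then 0 else (F.d : ℚ) / F.r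

/-! ## Quasi-morphisms -/

/-- A family of maps on generic fibres is a morphism of abelian `τ`-sheaves `F → F'(D)`. -/
def IsHomTwist (F F' : AbelianTauSheaf.{w} C c) (D : EffectiveDivisor C)
    (f : ∀ i, (F.F i).V →ₗ[L ⊗[Fq] Q] (F'.F i).V) : Prop :=
  (∀ i, MapsSections (F.F i) ((F'.F i).twist D) (f i)) ∧
  (∀ i x, f (i + 1) (F.Pi i x) = F'.Pi i (f i x)) ∧
  (∀ i x, f (i + 1) (F.tau i x) = F'.tau i (f i x))

theorem IsHomTwist.zero (F F' : AbelianTauSheaf.{w} C c) (D : EffectiveDivisor C) :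
    IsHomTwist F F' D 0 :=
  ⟨fun i => ⟨fun _ _ => ((F'.F i).twist D).aff.zero_mem,
    fun _ _ => ((F'.F i).twist D).inf.zero_mem⟩,
    fun i _ => (map_zero (F'.Pi i)).symm, fun i _ => (map_zero (F'.tau i)).symm⟩

theorem IsHomTwist.add {F F' : AbelianTauSheaf.{w} C c} {D E : EffectiveDivisor C}
    {f g : ∀ i, (F.F i).V →ₗ[L ⊗[Fq] Q] (F'.F i).V}
    (hf : IsHomTwist F F' D f) (hg : IsHomTwist F F' E g) :
    IsHomTwist F F' ⟨D.ideal * E.ideal, mul_ne_zero D.ideal_ne_bot E.ideal_ne_bot,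
      D.mult + E.mult⟩ (f + g) := by
  obtain ⟨hf, hf1, hf2⟩ := hf
  obtain ⟨hg, hg1, hg2⟩ := hg
  refine ⟨fun i => ⟨fun x hx a ha => ?_, fun x hx a ha => ?_⟩, fun i x => ?_, fun i x => ?_⟩
  · change _ • (f i x + g i x) ∈ _
    rw [smul_add]
    have ha' : a ∈ D.ideal * E.ideal := ha
    have h1 : a ∈ D.ideal := Ideal.mul_le_left ha'
    have h2 : a ∈ E.ideal := Ideal.mul_le_right ha'
    exact (F'.F i).aff.add_mem ((hf i).1 hx a h1) ((hg i).1 hx a h2)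
  · change _ • (f i x + g i x) ∈ _
    rw [smul_add]
    have ha' : a ∈ IsLocalRing.maximalIdeal C.O ^ (D.mult + E.mult) := ha
    have h1 := Ideal.pow_le_pow_right (Nat.le_add_right D.mult E.mult) ha'
    have h2 := Ideal.pow_le_pow_right (Nat.le_add_left E.mult D.mult) ha'
    exact (F'.F i).inf.add_mem ((hf i).2 hx a h1) ((hg i).2 hx a h2)
  · change f (i + 1) (F.Pi i x) + g (i + 1) (F.Pi i x) = F'.Pi i (f i x + g i x)
    rw [hf1, hg1, map_add]
  · change f (i + 1) (F.tau i x) + g (i + 1) (F.tau i x) = F'.tau i (f i x + g i x)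
    rw [hf2, hg2, map_add]

theorem IsHomTwist.smul {F F' : AbelianTauSheaf.{w} C c} {D : EffectiveDivisor C}
    {f : ∀ i, (F.F i).V →ₗ[L ⊗[Fq] Q] (F'.F i).V} (hf : IsHomTwist F F' D f) (a : Q) :
    ∃ E, IsHomTwist F F' E (a • f) := by
  obtain ⟨hf, hf1, hf2⟩ := hf
  obtain ⟨⟨b, hb0, hb⟩, n, hn⟩ := exists_pole C a
  have hb1 : Ideal.span {b} ≠ ⊥ := fun h => hb0 (Ideal.span_singleton_eq_bot.1 h)
  refine ⟨⟨D.ideal * Ideal.span {b}, mul_ne_zero D.ideal_ne_bot hb1, n + D.mult⟩,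
    fun i => ⟨fun x hx y hy => ?_, fun x hx y hy => ?_⟩, fun i x => ?_, fun i x => ?_⟩
  · obtain ⟨z, hz, rfl⟩ := Ideal.mem_mul_span_singleton.1 hy
    change toExt L C.A (z * b) • (a • f i x) ∈ (F'.F i).aff
    rw [mul_comm z b, toExt_smul_smul _ _ _ _ _ hb]
    exact (F'.F i).aff.smul_mem _ ((hf i).1 hx z hz)
  · change toExt L C.O y • (a • f i x) ∈ (F'.F i).inf
    have hy' : y ∈ IsLocalRing.maximalIdeal C.O ^ n * IsLocalRing.maximalIdeal C.O ^ D.mult := by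
      rw [← pow_add]; exact hy
    refine Submodule.mul_induction_on hy' (fun u hu t ht => ?_) (fun u t hu ht => ?_)
    · rw [toExt_smul_smul _ _ _ _ _ (hn u hu)]
      exact (F'.F i).inf.smul_mem _ ((hf i).2 hx t ht)
    · rw [map_add, add_smul]
      exact (F'.F i).inf.add_mem hu ht
  · change a • f (i + 1) (F.Pi i x) = F'.Pi i (a • f i x)
    rw [hf1, smul_Q_def, smul_Q_def, map_smul]
  · change a • f (i + 1) (F.tau i x) = F'.tau i (a • f i x)
    rw [hf2, smul_Q_def, smul_Q_def, LinearMap.map_smulₛₗ, sigma_tmul, map_one]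

/-- The `Q`-vector space `QHom(F, F')` of quasi-morphisms, i.e. the union of the
`Hom(F, F'(D))` over all effective divisors `D` on `C`.  Two morphisms into `F'(D₁)` and `F'(D₂)`
agree in `F'(D₁ + D₂)` if and only if they agree on the generic fibres, so equivalence classes of
quasi-morphisms are such families of maps on the generic fibres. -/
def QHom (F F' : AbelianTauSheaf.{w} C c) :
    Submodule Q (∀ i, (F.F i).V →ₗ[L ⊗[Fq] Q] (F'.F i).V) where
  carrier := {f | ∃ D, IsHomTwist F F' D f}
  zero_mem' := ⟨⟨⊤, top_ne_bot, 0⟩, IsHomTwist.zero F F' _⟩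
  add_mem' := fun ⟨_, hf⟩ ⟨_, hg⟩ => ⟨_, hf.add hg⟩
  smul_mem' := fun a _ ⟨_, hf⟩ => hf.smul a

/-! ## The associated `τ`-module `M = Γ(C_L ∖ {∞}, F_0)`, `τ = Π_0⁻¹ ∘ τ_0` -/

/-- Each `Π_j` is an isomorphism outside `∞`. -/
theorem surjOn_Pi (F : AbelianTauSheaf.{w} C c) (j : ℤ) :
    Set.SurjOn (F.Pi j) (F.F j).aff (F.F (j + 1)).aff := by
  obtain ⟨k, l, -, hl, -, h⟩ := F.periodic
  obtain ⟨n, rfl⟩ : ∃ n, l = n + 1 := ⟨l - 1, by omega⟩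
  obtain ⟨i, rfl⟩ : ∃ i : ℤ, j = i + n := ⟨j - n, by ring⟩
  intro y hy
  have e : i + (n : ℤ) + 1 = i + ((n + 1 : ℕ) : ℤ) := by push_cast; ring
  have hy' := (castLin_mapsSections F.F e).1 hy
  rw [SetLike.mem_coe, ← (h i).1] at hy'
  obtain ⟨x, hx, hxy⟩ := hy'
  exact ⟨iterPi F.F F.Pi i n x, (iterPi_mapsSections F.F F.Pi F.mapsSections_Pi i n).1 hx,
    castLin_injective F.F e hxy⟩

/-- The `A_L`-module `M = Γ(C_L ∖ {∞}, F_0)`. -/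
abbrev M (F : AbelianTauSheaf.{w} C c) : Type w := (F.F 0).aff

/-- `Π_0` on sections over `C_L ∖ {∞}`. -/
noncomputable def affPi (F : AbelianTauSheaf.{w} C c) :
    (F.F 0).aff →ₗ[C.AL L] (F.F (0 + 1)).aff :=
  ((F.Pi 0).restrictScalars (C.AL L)).restrict (F.mapsSections_Pi 0).1

theorem affPi_bijective (F : AbelianTauSheaf.{w} C c) : Function.Bijective F.affPi := by
  constructor
  · intro x y h
    exact Subtype.ext (F.injective_Pi 0 (congrArg Subtype.val h))
  · intro y
    obtain ⟨x, hx, hxy⟩ := F.surjOn_Pi 0 y.2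
    exact ⟨⟨x, hx⟩, Subtype.ext hxy⟩

/-- `τ_0` on sections over `C_L ∖ {∞}`. -/
noncomputable def affTau (F : AbelianTauSheaf.{w} C c) :
    (F.F 0).aff →ₗ[C.A] (F.F (0 + 1)).aff where
  toFun x := ⟨F.tau 0 x, (F.mapsSections_tau 0).1 x.2⟩
  map_add' x y := Subtype.ext (map_add (F.tau 0) (x : (F.F 0).V) y)
  map_smul' a x := Subtype.ext <| by
    change F.tau 0 (((1 : L) ⊗ₜ[Fq] (a : Q)) • (x : (F.F 0).V)) =
      ((1 : L) ⊗ₜ[Fq] (a : Q)) • F.tau 0 x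
    rw [LinearMap.map_smulₛₗ, sigma_tmul, map_one]

theorem affTau_smul (F : AbelianTauSheaf.{w} C c) (b : L) (x : (F.F 0).aff) :
    F.affTau (b • x) = frobL Fq L b • F.affTau x := Subtype.ext <| by
  change F.tau 0 ((b ⊗ₜ[Fq] (1 : Q)) • (x : (F.F 0).V)) =
    (frobL Fq L b ⊗ₜ[Fq] (1 : Q)) • F.tau 0 x
  rw [LinearMap.map_smulₛₗ, sigma_tmul]

/-- The map `τ = Π_0⁻¹ ∘ τ_0 : M → M`; it is `A`-linear and `q`-Frobenius-semilinear over `L`. -/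
noncomputable def tauM (F : AbelianTauSheaf.{w} C c) : F.M →ₗ[C.A] F.M :=
  ((LinearEquiv.ofBijective F.affPi F.affPi_bijective).restrictScalars C.A).symm.toLinearMap ∘ₗ
    F.affTau

theorem tauM_smul (F : AbelianTauSheaf.{w} C c) (b : L) (x : F.M) :
    F.tauM (b • x) = frobL Fq L b • F.tauM x := by
  apply F.affPi_bijective.1
  have h1 : ∀ y, F.affPi (F.tauM y) = F.affTau y := fun y =>
    (LinearEquiv.ofBijective F.affPi F.affPi_bijective).apply_symm_apply _
  have h2 : F.affPi (frobL Fq L b • F.tauM x) = frobL Fq L b • F.affPi (F.tauM x) :=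
    Subtype.ext ((F.Pi 0).map_smul ((frobL Fq L b) ⊗ₜ[Fq] (1 : Q)) (F.tauM x : (F.F 0).V))
  rw [h2, h1, h1, affTau_smul]

/-- The `s`-Frobenius `π = τ^e : M → M` for `#L = s = q^e`. -/
noncomputable def frobM (F : AbelianTauSheaf.{w} C c) : F.M →ₗ[C.A] F.M :=
  F.tauM ^ Module.finrank Fq L

theorem frobL_pow_finrank (b : L) : (frobL Fq L)^[Module.finrank Fq L] b = b := by
  have := Fintype.ofFinite L
  have h := congrArg (fun f : L →ₐ[Fq] L => f b)
    (pow_orderOf_eq_one (FiniteField.frobeniusAlgHom Fq L))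
  rw [FiniteField.orderOf_frobeniusAlgHom] at h
  simpa [AlgHom.coe_pow] using h

theorem tauM_pow_smul (F : AbelianTauSheaf.{w} C c) (n : ℕ) (b : L) (x : F.M) :
    (F.tauM ^ n) (b • x) = (frobL Fq L)^[n] b • (F.tauM ^ n) x := by
  induction n generalizing b x with
  | zero => rfl
  | succ n ih => rw [pow_succ, Module.End.mul_apply, Module.End.mul_apply, tauM_smul, ih,
      Function.iterate_succ_apply]

/-- `π : M → M` is `L`-linear (hence `A_L`-linear). -/
theorem frobM_smul (F : AbelianTauSheaf.{w} C c) (b : L) (x : F.M) :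
    F.frobM (b • x) = b • F.frobM x := by
  rw [frobM, tauM_pow_smul, frobL_pow_finrank]

/-! ## The Tate module -/

/-- The `A`-module `M ⊗_L L^sep`. -/
def Msep (F : AbelianTauSheaf.{w} C c) := F.M ⊗[L] SeparableClosure L

noncomputable instance (F : AbelianTauSheaf.{w} C c) : AddCommGroup F.Msep :=
  inferInstanceAs (AddCommGroup (F.M ⊗[L] SeparableClosure L))

noncomputable instance (F : AbelianTauSheaf.{w} C c) : Module C.A F.Msep :=
  inferInstanceAs (Module C.A (F.M ⊗[L] SeparableClosure L))

/-- The element `m ⊗ b` of `M ⊗_L L^sep`. -/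
noncomputable def tmulSep (F : AbelianTauSheaf.{w} C c) (m : F.M) (b : SeparableClosure L) : F.Msep :=
  m ⊗ₜ[L] b

theorem Msep.induction (F : AbelianTauSheaf.{w} C c) {p : F.Msep → Prop} (x : F.Msep)
    (zero : p 0) (tmul : ∀ m b, p (F.tmulSep m b)) (add : ∀ x y, p x → p y → p (x + y)) : p x :=
  TensorProduct.induction_on (motive := p) x zero tmul add

theorem smul_tmulSep (F : AbelianTauSheaf.{w} C c) (a : C.A) (m : F.M)
    (b : SeparableClosure L) : a • F.tmulSep m b = F.tmulSep (a • m) b :=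
  TensorProduct.smul_tmul' a m b

/-- The additive endomorphism `f ⊗ g` of `M ⊗_L L^sep`, for maps `f` and `g` that are both linear
or both `q`-Frobenius-semilinear over `L`; it is `A`-linear if `f` is so. -/
noncomputable def mapSep (F : AbelianTauSheaf.{w} C c) {φ : L →+* L} (f : F.M →ₗ[C.A] F.M)
    (hf : ∀ (b : L) x, f (b • x) = φ b • f x) (g : SeparableClosure L →ₛₗ[φ] SeparableClosure L) :
    F.Msep →ₗ[C.A] F.Msep :=
  let f' : F.M →ₛₗ[φ] F.M := { toFun := f, map_add' := map_add f, map_smul' := hf }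
  let h : F.Msep →+ F.Msep := (TensorProduct.map f' g).toAddMonoidHom
  { h with
    map_smul' := fun a x => by
      change h (a • x) = a • h x
      induction x using Msep.induction with
      | zero => rw [smul_zero, map_zero, smul_zero]
      | add x y hx hy => rw [smul_add, map_add, hx, hy, map_add, smul_add]
      | tmul m b =>
        rw [smul_tmulSep]
        change F.tmulSep (f (a • m)) (g b) = a • F.tmulSep (f m) (g b)
        rw [smul_tmulSep, f.map_smul] }

theorem mapSep_tmulSep (F : AbelianTauSheaf.{w} C c) {φ : L →+* L} (f : F.M →ₗ[C.A] F.M)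
    (hf : ∀ (b : L) x, f (b • x) = φ b • f x) (g : SeparableClosure L →ₛₗ[φ] SeparableClosure L)
    (m : F.M) (b : SeparableClosure L) :
    F.mapSep f hf g (F.tmulSep m b) = F.tmulSep (f m) (g b) := rfl

variable (Fq L) in
/-- The `q`-Frobenius `b ↦ b ^ q` on `L^sep`. -/
noncomputable def frobLsep : SeparableClosure L →ₛₗ[frobL Fq L] SeparableClosure L where
  toFun b := FiniteField.frobeniusAlgHom Fq (SeparableClosure L) b
  map_add' := map_add _
  map_smul' a b := by simp [Algebra.smul_def, mul_pow]

/-- The action of `τ` on `M ⊗_L L^sep`, `x ⊗ b ↦ τ(x) ⊗ b^q`. -/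
noncomputable def tauSep (F : AbelianTauSheaf.{w} C c) : F.Msep →ₗ[C.A] F.Msep :=
  F.mapSep F.tauM F.tauM_smul (frobLsep Fq L)

/-- The action of `π` on `M ⊗_L L^sep`, `x ⊗ b ↦ π(x) ⊗ b`. -/
noncomputable def frobSep (F : AbelianTauSheaf.{w} C c) : F.Msep →ₗ[C.A] F.Msep :=
  F.mapSep (φ := RingHom.id L) F.frobM F.frobM_smul LinearMap.id

theorem tauSep_comp_frobSep (F : AbelianTauSheaf.{w} C c) :
    F.tauSep ∘ₗ F.frobSep = F.frobSep ∘ₗ F.tauSep := by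
  refine LinearMap.ext fun x => ?_
  rw [LinearMap.comp_apply, LinearMap.comp_apply]
  induction x using Msep.induction with
  | zero => rw [map_zero, map_zero, map_zero]
  | add x y hx hy => rw [map_add, map_add, hx, hy, map_add, map_add]
  | tmul m b =>
    have h : F.tauM (F.frobM m) = F.frobM (F.tauM m) := by
      rw [frobM, ← Module.End.mul_apply, ← Module.End.mul_apply, ← pow_succ', ← pow_succ]
    rw [tauSep, frobSep, mapSep_tmulSep, mapSep_tmulSep, mapSep_tmulSep, mapSep_tmulSep, h]
    rfl

end AbelianTauSheaf

end Frobenius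

section Tate

open IsDedekindDomain

variable {Fq Q : Type*} [Field Fq] [Field Q] [Algebra Fq Q] {C : PointedCurve Fq Q}

/-- `A_v`, the completion of `A` at a closed point `v` of `Spec A`. -/
abbrev Av (v : HeightOneSpectrum C.A) : Type _ := AdicCompletion v.asIdeal C.A

theorem mul_not_mem_pow {R : Type*} [CommRing R] [IsDedekindDomain R] (v : HeightOneSpectrum R)
    {a b : R} {n m : ℕ} (ha : a ∉ v.asIdeal ^ n) (hb : b ∉ v.asIdeal ^ m) :
    a * b ∉ v.asIdeal ^ (n + m) := by
  rw [← Ideal.span_singleton_le_iff_mem, ← Ideal.dvd_iff_le] at ha hb ⊢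
  rw [← Ideal.span_singleton_mul_span_singleton, pow_dvd_iff_le_emultiplicity,
    emultiplicity_mul v.prime]
  rw [pow_dvd_iff_le_emultiplicity] at ha hb
  push Not at ha hb ⊢
  rw [Nat.cast_add]
  exact ENat.add_lt_add ha hb

theorem isDomain_adicCompletion {R : Type*} [CommRing R] [IsDedekindDomain R]
    (v : HeightOneSpectrum R) : IsDomain (AdicCompletion v.asIdeal R) := by
  have key : ∀ x : AdicCompletion v.asIdeal R, x ≠ 0 →
      ∃ (a : AdicCompletion.AdicCauchySequence v.asIdeal R) (n : ℕ),
        AdicCompletion.mk v.asIdeal R a = x ∧ ∀ N, n ≤ N → a.val N ∉ v.asIdeal ^ n := by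
    intro x hx
    obtain ⟨a, rfl⟩ := AdicCompletion.mk_surjective v.asIdeal R x
    by_contra! hcon
    refine hx (AdicCompletion.ext_evalₐ fun n => ?_)
    obtain ⟨N, hN, h⟩ := hcon a n rfl
    rw [AdicCompletion.evalₐ_mk, map_zero, ← AdicCompletion.Ideal.mk_eq_mk v.asIdeal hN a]
    exact Ideal.Quotient.eq_zero_iff_mem.2 h
  have : Nontrivial (AdicCompletion v.asIdeal R) := by
    refine ⟨1, 0, fun h => ?_⟩
    have h1 := congrArg (AdicCompletion.evalₐ v.asIdeal 1) h
    rw [map_one, map_zero, ← map_one (Ideal.Quotient.mk _), Ideal.Quotient.eq_zero_iff_mem,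
      pow_one] at h1
    exact v.isPrime.ne_top ((Ideal.eq_top_iff_one _).2 h1)
  have : NoZeroDivisors (AdicCompletion v.asIdeal R) := by
    refine ⟨fun {x y} hxy => ?_⟩
    by_contra! hcon
    obtain ⟨a, n, rfl, ha⟩ := key x hcon.1
    obtain ⟨b, m, rfl, hb⟩ := key y hcon.2
    have h1 := congrArg (AdicCompletion.evalₐ v.asIdeal (n + m)) hxy
    rw [map_mul, AdicCompletion.evalₐ_mk, AdicCompletion.evalₐ_mk, map_zero, ← map_mul,
      Ideal.Quotient.eq_zero_iff_mem] at h1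
    exact mul_not_mem_pow v (ha _ (Nat.le_add_right n m)) (hb _ (Nat.le_add_left m n)) h1
  exact NoZeroDivisors.to_isDomain _

instance (v : HeightOneSpectrum C.A) : IsDomain (Av v) := isDomain_adicCompletion v

/-- `Q_v`, the field of fractions of `A_v`, i.e. the completion of `Q` at `v`. -/
abbrev Qv (v : HeightOneSpectrum C.A) : Type _ := FractionRing (Av v)

variable [Fintype Fq] {L : Type*} [Field L] [Algebra Fq L] [Finite L] {c : Characteristic C L}

namespace AbelianTauSheaf

/-- The `v`-adic Tate module `T_v F = lim_n ((M / v^n M) ⊗_L L^sep)^τ`, the `τ`-invariants in the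
`v`-adic completion `lim_n (M ⊗_L L^sep) / v^n` of `M ⊗_L L^sep`. -/
noncomputable def tateModule (F : AbelianTauSheaf.{w} C c) (v : HeightOneSpectrum C.A) :
    Submodule (Av v) (AdicCompletion v.asIdeal F.Msep) :=
  LinearMap.eqLocus (AdicCompletion.map v.asIdeal F.tauSep) LinearMap.id

/-- `T_v π : T_v F → T_v F`. -/
noncomputable def tateFrob (F : AbelianTauSheaf.{w} C c) (v : HeightOneSpectrum C.A) :
    F.tateModule v →ₗ[Av v] F.tateModule v :=
  (AdicCompletion.map v.asIdeal F.frobSep).restrict fun x hx => by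
    have hx' : AdicCompletion.map v.asIdeal F.tauSep x = x := hx
    change AdicCompletion.map v.asIdeal F.tauSep (AdicCompletion.map v.asIdeal F.frobSep x) =
      AdicCompletion.map v.asIdeal F.frobSep x
    rw [AdicCompletion.map_comp_apply, tauSep_comp_frobSep, ← AdicCompletion.map_comp_apply, hx']

/-- The rational Tate module `V_v F = Q_v ⊗ T_v F`. -/
def rationalTateModule (F : AbelianTauSheaf.{w} C c) (v : HeightOneSpectrum C.A) :=
  Qv v ⊗[Av v] F.tateModule v

noncomputable instance (F : AbelianTauSheaf.{w} C c) (v : HeightOneSpectrum C.A) :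
    AddCommGroup (F.rationalTateModule v) :=
  inferInstanceAs (AddCommGroup (Qv v ⊗[Av v] F.tateModule v))

noncomputable instance (F : AbelianTauSheaf.{w} C c) (v : HeightOneSpectrum C.A) :
    Module (Qv v) (F.rationalTateModule v) :=
  inferInstanceAs (Module (Qv v) (Qv v ⊗[Av v] F.tateModule v))

/-- The endomorphism `π_v = V_v π` of the `Q_v`-vector space `V_v F`. -/
noncomputable def piv (F : AbelianTauSheaf.{w} C c) (v : HeightOneSpectrum C.A) :
    Module.End (Qv v) (F.rationalTateModule v) :=
  (F.tateFrob v).baseChange (Qv v)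

end AbelianTauSheaf

end Tate

/-! ## Polynomials -/

open Classical in
/-- The characteristic polynomial of an endomorphism of a finite-dimensional vector space. -/
noncomputable def charPoly {K V : Type*} [Field K] [AddCommGroup V] [Module K V]
    (f : Module.End K V) : Polynomial K :=
  if _h : Module.Finite K V then LinearMap.charpoly f else 0

open Classical in
/-- `r_K(f, g) = ∑_μ m(μ) n(μ) deg μ`, where `μ` runs through the monic irreducible polynomials and
`m(μ)`, `n(μ)` are the multiplicities of `μ` in `f` and in `g`. -/
noncomputable def rPairing {K : Type*} [Field K] (f g : Polynomial K) : ℕ :=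
  ∑ μ ∈ (UniqueFactorizationMonoid.normalizedFactors f).toFinset,
    (UniqueFactorizationMonoid.normalizedFactors f).count μ *
      (UniqueFactorizationMonoid.normalizedFactors g).count μ * μ.natDegree

end TauSheaf

/-!
Sending a quasi-morphism to its generic fibre identifies `QHom F F'` with the space of `Q_L`-linear
maps `V → V'` between the generic fibres of `F_0` and `F'_0` that commute with `φ = Π⁻¹ τ`: such a
map has bounded poles outside `∞`, and equality of the weights bounds its poles at `∞`.

Put `e = [L : F_q]`. Splitting the `Q`-linear maps that commute with `φ` into their
`q^j`-semilinear parts, and applying Galois descent to `g ↦ φ' g φ⁻¹` on the `Q`-linear maps that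
commute with `φ ^ e`, one sees that these `φ ^ e`-equivariant maps form a space of dimension `e ^ 2`
times that of the `Q_L`-linear `φ`-equivariant maps.

On the other side, Lang's theorem for `τ` over `L^sep` and descent along the `s`-Frobenius of
`L^sep` relate `M / v^n M`, with `π` on it, to `e` copies of the `n`-th level of the Tate module:
two finite modules with equally many homomorphisms from every finite module are isomorphic. By
compactness the isomorphisms can be chosen compatibly in `n`, so `Q_v ⊗ V ≅ (V_v F)^e` with
`φ ^ e` corresponding to `π_v`. The factor `e ^ 2` cancels, and the dimension sought is that of the
space of `Q_v`-linear maps that intertwine `π_v` and `π'_v`, which for semisimple endomorphisms is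
read off from the characteristic polynomials.
-/

namespace TauSheaf

universe w

/-! ## Frobenius-semilinear maps -/

section Descent

open Module

variable {F : Type*} [Field F] [Fintype F] {k : Type*} [Field k] [Algebra F k]

theorem frobL_iterate (n : ℕ) (a : k) : (frobL F k)^[n] a = a ^ Fintype.card F ^ n := by
  induction n with
  | zero => simp
  | succ n ih =>
    rw [Function.iterate_succ_apply', ih, pow_succ, pow_mul]
    rfl

theorem algebraMap_trace_eq_sum_frobL {K : Type*} [Field K] [Algebra F K] [FiniteDimensional F K]
    (a : K) : algebraMap F K (Algebra.trace F K a) =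
      ∑ j ∈ Finset.range (finrank F K), (frobL F K)^[j] a := by
  have := finite_of_finite F (M := K)
  simp only [FiniteField.algebraMap_trace_eq_sum_pow, frobL_iterate, Fintype.card_eq_nat_card]

theorem sum_frobL_mul_traceDual {K : Type*} [Field K] [Algebra F K] [FiniteDimensional F K]
    (b : Basis (Fin (finrank F K)) F K) (i j : Fin (finrank F K)) :
    ∑ m, (frobL F K)^[i] (b m) * (frobL F K)^[j] (b.traceDual m) = if i = j then 1 else 0 := by
  let B : Matrix (Fin (finrank F K)) (Fin (finrank F K)) K := .of fun i m ↦ (frobL F K)^[i] (b m)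
  let B' : Matrix (Fin (finrank F K)) (Fin (finrank F K)) K :=
    .of fun m j ↦ (frobL F K)^[j] (b.traceDual m)
  have orthogonality : B' * B = 1 := by
    ext m m'
    have h := algebraMap_trace_eq_sum_frobL (F := F) (b.traceDual m * b m')
    rw [b.trace_traceDual_mul, Finset.sum_range] at h
    simp only [iterate_map_mul] at h
    simpa [Matrix.mul_apply, Matrix.one_apply, B, B', eq_comm] using h.symm
  have h : B * B' = 1 := mul_eq_one_comm.1 orthogonality
  exact (congrFun₂ h i j).trans Matrix.one_apply

variable {P : Type*} [AddCommGroup P] [Module k P] (φ : P →ₛₗ[frobL F k] P)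

theorem iterate_smul (n : ℕ) (a : k) (x : P) :
    φ^[n] (a • x) = (frobL F k)^[n] a • φ^[n] x := by
  induction n with
  | zero => rfl
  | succ n ih => rw [Function.iterate_succ_apply', ih, map_smulₛₗ, Function.iterate_succ_apply',
      Function.iterate_succ_apply']

/-- The sum `x + φ x + ⋯ + φⁿ⁻¹ x`, the trace of `x` for the action of `φ` when `φⁿ x = x`. -/
noncomputable def orbitSum (n : ℕ) (x : P) : P := ∑ j ∈ Finset.range n, φ^[j] x

variable {φ}

theorem orbitSum_zero (n : ℕ) : orbitSum φ n 0 = 0 :=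
  Finset.sum_eq_zero fun j _ ↦ iterate_map_zero φ j

theorem orbitSum_sum {ι : Type*} (s : Finset ι) (x : ι → P) (n : ℕ) :
    orbitSum φ n (∑ i ∈ s, x i) = ∑ i ∈ s, orbitSum φ n (x i) := by
  classical
  induction s using Finset.induction_on with
  | empty => exact orbitSum_zero n
  | insert i s hi ih =>
    rw [Finset.sum_insert hi, Finset.sum_insert hi, ← ih]
    simp only [orbitSum, iterate_map_add, Finset.sum_add_distrib]

theorem map_orbitSum {n : ℕ} {x : P} (hx : φ^[n] x = x) : φ (orbitSum φ n x) = orbitSum φ n x := by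
  simp only [orbitSum, map_sum, ← Function.iterate_succ_apply' φ]
  have h := Finset.sum_range_succ' (fun j ↦ φ^[j] x) n
  rw [Finset.sum_range_succ, hx] at h
  exact (add_right_cancel h).symm

section Subfield

variable {K : Type*} [Field K] [Algebra F K] (ι : K →ₐ[F] k)

theorem map_frobL_iterate (n : ℕ) (a : K) : ι ((frobL F K)^[n] a) = (frobL F k)^[n] (ι a) := by
  simp only [frobL_iterate, map_pow]

variable [FiniteDimensional F K]

theorem orbitSum_smul_of_map_eq {x : P} (hx : φ x = x) (a : K) :
    orbitSum φ (finrank F K) (ι a • x) = algebraMap F k (Algebra.trace F K a) • x := by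
  simp only [orbitSum, iterate_smul, Function.iterate_fixed hx, ← Finset.sum_smul,
    ← map_frobL_iterate, ← map_sum, ← algebraMap_trace_eq_sum_frobL, AlgHom.commutes]

theorem iterate_finrank_smul (a : K) (x : P) :
    φ^[finrank F K] (ι a • x) = ι a • φ^[finrank F K] x := by
  have := finite_of_finite F (M := K)
  rw [iterate_smul, ← map_frobL_iterate, AbelianTauSheaf.frobL_pow_finrank]

theorem sum_smul_orbitSum_traceDual (b : Basis (Fin (finrank F K)) F K) (x : P) :
    ∑ m, ι (b m) • orbitSum φ (finrank F K) (ι (b.traceDual m) • x) = x := by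
  have h (j : Fin (finrank F K)) :
      ∑ m, ι (b m) * (frobL F k)^[j] (ι (b.traceDual m)) = if (j : ℕ) = 0 then 1 else 0 := by
    have := congrArg ι (sum_frobL_mul_traceDual b ⟨0, finrank_pos⟩ j)
    simpa only [map_sum, map_mul, map_frobL_iterate, apply_ite ι, map_one, map_zero,
      Fin.ext_iff, eq_comm, Function.iterate_zero, id] using this
  simp only [orbitSum, iterate_smul, Finset.smul_sum, smul_smul]
  rw [Finset.sum_comm, Finset.sum_range]
  simp only [← Finset.sum_smul, h, ite_smul, one_smul, zero_smul]
  rw [Finset.sum_eq_single ⟨0, finrank_pos⟩ (fun j _ hj ↦ if_neg (by simpa [Fin.ext_iff] using hj))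
    (by simp)]
  rfl

theorem map_orbitSum_smul {x : P} (hx : φ^[finrank F K] x = x) (a : K) :
    φ (orbitSum φ (finrank F K) (ι a • x)) = orbitSum φ (finrank F K) (ι a • x) :=
  map_orbitSum (by rw [iterate_finrank_smul, hx])

end Subfield

theorem exists_intermediateField_finrank_eq (F k : Type*) [Field F] [Finite F] [Field k]
    [Algebra F k] [IsSepClosed k] (n : ℕ) [NeZero n] :
    ∃ K : IntermediateField F k, FiniteDimensional F K ∧ finrank F K = n := by
  obtain ⟨p, _⟩ := CharP.exists F
  have : Fact p.Prime := ⟨CharP.char_is_prime F p⟩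
  let ι : FiniteField.Extension F p n →ₐ[F] k := IsSepClosed.lift
  let e := (AlgEquiv.ofInjectiveField ι).toLinearEquiv
  exact ⟨ι.fieldRange, Module.Finite.equiv e, e.finrank_eq.symm.trans
    (FiniteField.finrank_extension F p n)⟩

theorem mem_periodicPts_of_injective [Algebra.IsAlgebraic F k] [FiniteDimensional k P]
    (hφ : Function.Injective φ) (x : P) : x ∈ Function.periodicPts φ := by
  let b := finBasis k P
  let S : Set k := Set.range (b.repr x) ∪ Set.range fun ij : _ × _ ↦ b.repr (φ (b ij.1)) ij.2
  let K := IntermediateField.adjoin F S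
  have : Finite S := (Set.finite_range _).union (Set.finite_range _)
  have : FiniteDimensional F K := IntermediateField.finiteDimensional_adjoin
    (S := S) fun a _ ↦ Algebra.IsIntegral.isIntegral a
  have : Finite K := finite_of_finite F
  have hS_mem {a : k} (ha : a ∈ S) : a ∈ Set.range (algebraMap K k) :=
    ⟨⟨a, IntermediateField.subset_adjoin F S ha⟩, rfl⟩
  let T := Submodule.span K (Set.range b)
  have : Module.Finite K T := .span_of_finite K (Set.finite_range b)
  have : Finite T := finite_of_finite K
  have hT : Set.MapsTo φ T T := fun y hy ↦ by
    induction hy using Submodule.span_induction with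
    | mem y hy =>
      obtain ⟨i, rfl⟩ := hy
      exact (b.mem_span_iff_repr_mem K _).2 fun j ↦ hS_mem (.inr ⟨(i, j), rfl⟩)
    | zero => simp
    | add y z _ _ hy hz => simpa using T.add_mem hy hz
    | smul a y _ hy =>
      rw [← algebraMap_smul k, map_smulₛₗ]
      exact T.smul_mem (frobL F K a) hy
  have hx : x ∈ T := (b.mem_span_iff_repr_mem K _).2 fun i ↦ hS_mem (.inl ⟨i, rfl⟩)
  obtain ⟨n, hn, h⟩ := Function.Injective.mem_periodicPts
    (f := hT.restrict φ T T) (hT.restrict_inj.2 hφ.injOn) ⟨x, hx⟩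
  refine ⟨n, hn, ?_⟩
  have := congrArg Subtype.val h
  rw [hT.iterate_restrict] at this
  exact this

theorem mem_span_setOf_map_eq [IsSepClosed k] {x : P} (hx : x ∈ Function.periodicPts φ) :
    x ∈ Submodule.span k {y : P | φ y = y} := by
  obtain ⟨n, hn, hx⟩ := hx
  have : NeZero n := ⟨hn.ne'⟩
  obtain ⟨K, _, rfl⟩ := exists_intermediateField_finrank_eq F k n
  rw [← sum_smul_orbitSum_traceDual K.val (finBasis F K) x]
  exact Submodule.sum_mem _ fun m _ ↦
    Submodule.smul_mem _ _ (Submodule.subset_span (map_orbitSum_smul K.val hx _))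

/-- Apply `φ`-orbit sums to the multiples of a linear relation: the coefficients become traces. -/
theorem linearIndependent_of_map_eq [Algebra.IsAlgebraic F k] [Module F P] [IsScalarTower F k P]
    {ι : Type*} {u : ι → P} (hu : ∀ i, φ (u i) = u i) (hF : LinearIndependent F u) :
    LinearIndependent k u := by
  classical
  rw [linearIndependent_iff'] at hF ⊢
  intro s c hc i hi
  let K := IntermediateField.adjoin F (c '' s)
  have : FiniteDimensional F K := IntermediateField.finiteDimensional_adjoin
    (S := c '' s) fun a _ ↦ Algebra.IsIntegral.isIntegral a
  have hc_mem (j : ι) (hj : j ∈ s) : c j ∈ K := IntermediateField.subset_adjoin F _ ⟨j, hj, rfl⟩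
  let c' (j : ι) : K := if hj : j ∈ s then ⟨c j, hc_mem j hj⟩ else 0
  have hc' {j : ι} (hj : j ∈ s) : (c' j : k) = c j := by simp only [c', dif_pos hj]
  have trace_eq_zero (a : K) : Algebra.trace F K (a * c' i) = 0 := by
    refine hF s (fun j ↦ Algebra.trace F K (a * c' j)) ?_ i hi
    calc ∑ j ∈ s, Algebra.trace F K (a * c' j) • u j
        = ∑ j ∈ s, orbitSum φ (finrank F K) (((a * c' j : K) : k) • u j) := by
          refine Finset.sum_congr rfl fun j _ ↦ ?_
          rw [← algebraMap_smul k, ← orbitSum_smul_of_map_eq K.val (hu j)]; rfl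
      _ = orbitSum φ (finrank F K) ((a : k) • ∑ j ∈ s, c j • u j) := by
          simp only [Finset.smul_sum, smul_smul, orbitSum_sum]
          exact Finset.sum_congr rfl fun j hj ↦ by rw [MulMemClass.coe_mul, hc' hj]
      _ = 0 := by rw [hc, smul_zero, orbitSum_zero]
  have hc'_eq_zero : c' i = 0 := (traceForm_nondegenerate F K).2 _ trace_eq_zero
  rw [← hc' hi, hc'_eq_zero, ZeroMemClass.coe_zero]

theorem natCard_setOf_map_eq [IsSepClosed k] [Algebra.IsAlgebraic F k] [FiniteDimensional k P]
    (hφ : Function.Injective φ) : Nat.card {x : P // φ x = x} = Fintype.card F ^ finrank k P := by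
  let _ : Module F P := Module.compHom P (algebraMap F k)
  have : IsScalarTower F k P := ⟨fun a b x ↦ by rw [Algebra.smul_def, mul_smul]; rfl⟩
  let E : Submodule F P :=
    { carrier := {x | φ x = x}
      add_mem' hx hy := by simpa using congrArg₂ (· + ·) hx hy
      zero_mem' := map_zero φ
      smul_mem' a x hx := by
        change φ (algebraMap F k a • x) = algebraMap F k a • x
        rw [map_smulₛₗ, AlgHom.coe_toRingHom, AlgHom.commutes, hx] }
  let b := Basis.ofVectorSpace F E
  have h_indep : LinearIndependent k fun i ↦ (b i : P) := linearIndependent_of_map_eq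
    (fun i ↦ (b i).2) (b.linearIndependent.map' E.subtype E.ker_subtype)
  have h_span : ⊤ ≤ Submodule.span k (Set.range fun i ↦ (b i : P)) := by
    have hE : (E : Set P) ⊆ Submodule.span k (Set.range fun i ↦ (b i : P)) := fun x hx ↦ by
      refine Submodule.span_le_restrictScalars F k _ ?_
      have := Submodule.mem_map_of_mem (f := E.subtype) (b.mem_span ⟨x, hx⟩)
      rwa [Submodule.map_span, ← Set.range_comp] at this
    exact fun x _ ↦ Submodule.span_le.2 hE
      (mem_span_setOf_map_eq (mem_periodicPts_of_injective hφ x))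
  have := h_indep.finite
  have : Module.Finite F E := .of_basis b
  rw [finrank_eq_nat_card_basis (Basis.mk h_indep h_span), ← finrank_eq_nat_card_basis b,
    Fintype.card_eq_nat_card]
  exact natCard_eq_pow_finrank (K := F) (V := E)

theorem exists_map_eq_of_surjective [IsSepClosed k] {P' : Type*} [AddCommGroup P'] [Module k P']
    {φ' : P' →ₛₗ[frobL F k] P'} (hφ : ∀ x, x ∈ Function.periodicPts φ)
    {f : P →ₗ[k] P'} (hf : Function.Surjective f) (hfφ : ∀ x, f (φ x) = φ' (f x))
    {y : P'} (hy : φ' y = y) : ∃ x, φ x = x ∧ f x = y := by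
  obtain ⟨x, rfl⟩ := hf y
  obtain ⟨n, hn, hx⟩ := hφ x
  have : NeZero n := ⟨hn.ne'⟩
  obtain ⟨K, _, rfl⟩ := exists_intermediateField_finrank_eq F k n
  obtain ⟨a, ha⟩ := Algebra.trace_surjective F K 1
  refine ⟨orbitSum φ (finrank F K) ((K.val a) • x), map_orbitSum_smul K.val hx _, ?_⟩
  have hf_orbitSum (z : P) : f (orbitSum φ (finrank F K) z) = orbitSum φ' (finrank F K) (f z) := by
    have hf_iterate (j : ℕ) (z : P) : f (φ^[j] z) = φ'^[j] (f z) :=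
      (Function.Semiconj.iterate_right hfφ j) z
    simp only [orbitSum, map_sum, hf_iterate]
  rw [hf_orbitSum, map_smul, orbitSum_smul_of_map_eq K.val hy, ha, map_one, one_smul]

end Descent

section Lovasz

variable {R W X : Type*} [Ring R] [AddCommGroup W] [Module R W] [AddCommGroup X] [Module R X]

theorem natCard_hom_quotient_eq_sum [Finite W] [Finite X] (K : Submodule R W)
    [Fintype (Submodule R W)] [DecidableLE (Submodule R W)] :
    Nat.card ((W ⧸ K) →ₗ[R] X) =
      ∑ K' : Submodule R W with K ≤ K', Nat.card {f : W →ₗ[R] X // LinearMap.ker f = K'} := by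
  have : Finite (W →ₗ[R] X) := DFunLike.finite _
  rw [Finset.sum_subtype (p := fun K' ↦ K ≤ K') _ (by simp), ← Nat.card_sigma]
  refine (Nat.card_congr ?_).symm
  exact ⟨fun f ↦ K.liftQ f.2.1 (f.1.2.trans f.2.2.ge),
    fun f ↦ ⟨⟨LinearMap.ker (f ∘ₗ K.mkQ), fun x hx ↦ by simp [(K.mkQ_apply x).symm ▸
      (Submodule.Quotient.mk_eq_zero K).2 hx]⟩, f ∘ₗ K.mkQ, rfl⟩,
    fun ⟨⟨K', hK'⟩, f, hf⟩ ↦ Sigma.subtype_ext (Subtype.ext hf) rfl,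
    fun f ↦ Submodule.linearMap_qext _ rfl⟩

/-- Lovász's argument: Möbius inversion over the submodules of `W` turns the hypothesis into an
equality between the numbers of injective homomorphisms, and `W → W` has one. -/
theorem exists_injective_of_natCard_hom_quotient_eq [Finite W] [Finite X]
    (h : ∀ K : Submodule R W, Nat.card ((W ⧸ K) →ₗ[R] X) = Nat.card ((W ⧸ K) →ₗ[R] W)) :
    ∃ f : W →ₗ[R] X, Function.Injective f := by
  classical
  have : Finite (Submodule R W) := .of_injective _ SetLike.coe_injective
  let _ : Fintype (Submodule R W) := .ofFinite _
  have card_ker_eq (K : Submodule R W) : Nat.card {f : W →ₗ[R] X // LinearMap.ker f = K} =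
      Nat.card {f : W →ₗ[R] W // LinearMap.ker f = K} := by
    induction K using WellFoundedGT.induction with
    | ind K ih =>
      have hK : K ∈ Finset.univ.filter (K ≤ ·) := by simp
      have hsum := h K
      rw [natCard_hom_quotient_eq_sum, natCard_hom_quotient_eq_sum,
        ← Finset.add_sum_erase _ _ hK, ← Finset.add_sum_erase _ _ hK,
        Finset.sum_congr rfl fun K' hK' ↦ ih K' ?_] at hsum
      · exact Nat.add_right_cancel hsum
      · rw [Finset.mem_erase, Finset.mem_filter] at hK'
        exact lt_of_le_of_ne hK'.2.2 hK'.1.symm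
  have : Finite (W →ₗ[R] W) := DFunLike.finite _
  have : Nonempty {f : W →ₗ[R] W // LinearMap.ker f = ⊥} := ⟨⟨LinearMap.id, LinearMap.ker_id⟩⟩
  have hpos : 0 < Nat.card {f : W →ₗ[R] X // LinearMap.ker f = ⊥} := by
    rw [card_ker_eq]
    exact Nat.card_pos
  obtain ⟨⟨f, hf⟩⟩ := (Nat.card_pos_iff.1 hpos).1
  exact ⟨f, LinearMap.ker_eq_bot.1 hf⟩

theorem natCard_linearMap_pi {ι : Type*} [Fintype ι] :
    Nat.card (W →ₗ[R] (ι → X)) = Nat.card (W →ₗ[R] X) ^ Fintype.card ι := by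
  rw [Fintype.card_eq_nat_card, ← Nat.card_fun]
  exact Nat.card_congr ⟨fun f i ↦ LinearMap.proj i ∘ₗ f, LinearMap.pi, fun _ ↦ rfl, fun _ ↦ rfl⟩

end Lovasz

section FixedSubmodule

open Module

variable {R F k P : Type*} [Ring R] [Field F] [Fintype F] [Field k] [Algebra F k]
  [AddCommGroup P] [Module R P] [Module k P]

variable (R) in
/-- The fixed points of a Frobenius-semilinear map `φ` commuting with the action of a ring `R`,
as an `R`-module. -/
def fixedSubmodule (φ : P →ₛₗ[frobL F k] P) (hφ : ∀ (r : R) x, φ (r • x) = r • φ x) :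
    Submodule R P where
  carrier := {x | φ x = x}
  add_mem' hx hy := by simpa using congrArg₂ (· + ·) hx hy
  zero_mem' := map_zero φ
  smul_mem' r x hx := (hφ r x).trans (congrArg (r • ·) hx)

/-- The ring of `k`-linear endomorphisms of `P` that commute with `φ` and `ψ`. -/
def commutant {L : Type*} [Field L] [Fintype L] [Algebra L k] (φ : P →ₛₗ[frobL F k] P)
    (ψ : P →ₛₗ[frobL L k] P) : Subring (Module.End k P) where
  carrier := {g | (∀ x, φ (g x) = g (φ x)) ∧ ∀ x, ψ (g x) = g (ψ x)}
  mul_mem' hg hg' := ⟨fun x ↦ by simp [hg.1, hg'.1], fun x ↦ by simp [hg.2, hg'.2]⟩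
  one_mem' := ⟨fun _ ↦ rfl, fun _ ↦ rfl⟩
  add_mem' hg hg' := ⟨fun x ↦ by simp [hg.1, hg'.1], fun x ↦ by simp [hg.2, hg'.2]⟩
  zero_mem' := ⟨fun _ ↦ map_zero φ, fun _ ↦ map_zero ψ⟩
  neg_mem' hg := ⟨fun x ↦ by simp [hg.1], fun x ↦ by simp [hg.2]⟩

variable [SMulCommClass R k P]

theorem finite_linearMap_of_finite {W : Type*} [AddCommGroup W] [Module R W] [Finite W]
    [FiniteDimensional k P] : FiniteDimensional k (W →ₗ[R] P) := by
  let ev : (W →ₗ[R] P) →ₗ[k] (W → P) :=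
    { toFun := fun f ↦ f
      map_add' := fun _ _ ↦ rfl
      map_smul' := fun _ _ ↦ rfl }
  exact .of_injective ev DFunLike.coe_injective

variable [IsSepClosed k] [Algebra.IsAlgebraic F k] [FiniteDimensional k P]

/-- A homomorphism to the fixed points of `φ` is a fixed point of the semilinear map
`f ↦ φ ∘ f`. -/
theorem natCard_hom_fixedSubmodule {φ : P →ₛₗ[frobL F k] P}
    (hφ : ∀ (r : R) x, φ (r • x) = r • φ x) (hφ_inj : Function.Injective φ)
    (W : Type*) [AddCommGroup W] [Module R W] [Finite W] :
    Nat.card (W →ₗ[R] fixedSubmodule R φ hφ) = Fintype.card F ^ finrank k (W →ₗ[R] P) := by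
  have : FiniteDimensional k (W →ₗ[R] P) := finite_linearMap_of_finite
  let φR : P →ₗ[R] P := { toFun := φ, map_add' := map_add φ, map_smul' := hφ }
  let Φ : (W →ₗ[R] P) →ₛₗ[frobL F k] (W →ₗ[R] P) :=
    { toFun := fun f ↦ φR ∘ₗ f
      map_add' := fun f g ↦ LinearMap.comp_add f g φR
      map_smul' := fun c f ↦ LinearMap.ext fun x ↦ map_smulₛₗ φ c (f x) }
  have hΦ : Function.Injective Φ := fun f g hfg ↦
    LinearMap.ext fun x ↦ hφ_inj (DFunLike.congr_fun hfg x)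
  rw [← natCard_setOf_map_eq hΦ]
  exact Nat.card_congr
    ⟨fun f ↦ ⟨(fixedSubmodule R φ hφ).subtype ∘ₗ f, LinearMap.ext fun x ↦ (f x).2⟩,
      fun f ↦ f.1.codRestrict _ fun x ↦ DFunLike.congr_fun f.2 x, fun _ ↦ rfl, fun _ ↦ rfl⟩

variable {L : Type*} [Field L] [Fintype L] [Algebra F L] [Algebra L k] [Algebra.IsAlgebraic L k]

theorem nonempty_fixedSubmodule_equiv_pi {φ : P →ₛₗ[frobL F k] P} {ψ : P →ₛₗ[frobL L k] P}
    (hφ : ∀ (r : R) x, φ (r • x) = r • φ x) (hψ : ∀ (r : R) x, ψ (r • x) = r • ψ x)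
    (hφ_inj : Function.Injective φ) (hψ_inj : Function.Injective ψ) :
    Nonempty (fixedSubmodule R ψ hψ ≃ₗ[R] (Fin (finrank F L) → fixedSubmodule R φ hφ)) := by
  have card_φ := natCard_setOf_map_eq hφ_inj
  have card_ψ := natCard_setOf_map_eq hψ_inj
  have : Finite (fixedSubmodule R φ hφ) := Nat.finite_of_card_ne_zero (card_φ.trans_ne (by simp))
  have : Finite (fixedSubmodule R ψ hψ) := Nat.finite_of_card_ne_zero (card_ψ.trans_ne (by simp))
  have card_L : Fintype.card L = Fintype.card F ^ finrank F L := card_eq_pow_finrank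
  obtain ⟨f, hf⟩ := exists_injective_of_natCard_hom_quotient_eq (R := R)
    (W := fixedSubmodule R ψ hψ) (X := Fin (finrank F L) → fixedSubmodule R φ hφ) fun K ↦ by
      have : Finite (fixedSubmodule R ψ hψ ⧸ K) := Quotient.finite _
      rw [natCard_linearMap_pi, Fintype.card_fin,
        natCard_hom_fixedSubmodule hφ hφ_inj, natCard_hom_fixedSubmodule hψ hψ_inj, card_L,
        ← pow_mul, ← pow_mul, mul_comm]
  refine ⟨.ofBijective f ((Nat.bijective_iff_injective_and_card f).2 ⟨hf, ?_⟩)⟩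
  rw [Nat.card_pi, Finset.prod_const, Finset.card_fin]
  refine card_ψ.trans ?_
  rw [card_L, ← pow_mul, mul_comm, pow_mul, ← card_φ]
  rfl

/-- Apply `nonempty_fixedSubmodule_equiv_pi` to the ring `commutant φ ψ` instead of `R`. -/
theorem exists_fixedSubmodule_equiv_pi {φ : P →ₛₗ[frobL F k] P} {ψ : P →ₛₗ[frobL L k] P}
    (hφ : ∀ (r : R) x, φ (r • x) = r • φ x) (hψ : ∀ (r : R) x, ψ (r • x) = r • ψ x)
    (hφ_inj : Function.Injective φ) (hψ_inj : Function.Injective ψ) :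
    ∃ f : fixedSubmodule R ψ hψ ≃ₗ[R] (Fin (finrank F L) → fixedSubmodule R φ hφ),
      ∀ g : P →ₗ[k] P, (∀ x, φ (g x) = g (φ x)) → (∀ x, ψ (g x) = g (ψ x)) →
        ∀ x y : fixedSubmodule R ψ hψ, (y : P) = g x → ∀ i, (f y i : P) = g (f x i) := by
  obtain ⟨f⟩ := nonempty_fixedSubmodule_equiv_pi (R := commutant φ ψ) (φ := φ) (ψ := ψ)
    (fun g ↦ g.2.1) (fun g ↦ g.2.2) hφ_inj hψ_inj
  have hf (g : commutant φ ψ) (x y : fixedSubmodule (commutant φ ψ) ψ fun g ↦ g.2.2)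
      (hxy : (y : P) = g.1 x) (i : Fin (finrank F L)) :
      (f y i : P) = g.1 (f x i) := by
    rw [show y = g • x from Subtype.ext hxy, map_smul]
    rfl
  let smulEnd (r : R) : commutant φ ψ :=
    ⟨DistribSMul.toLinearMap k P r, fun x ↦ hφ r x, fun x ↦ hψ r x⟩
  exact ⟨{ f.toAddEquiv with
    map_smul' := fun r x ↦ funext fun i ↦ Subtype.ext (hf (smulEnd r) x _ rfl i) },
    fun g hφg hψg x y hxy i ↦ hf ⟨g, hφg, hψg⟩ x y hxy i⟩

end FixedSubmodule

/-! ## Spaces of intertwining maps -/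

section Intertwiners

variable {K V V' V₁ V₁' : Type*} [CommRing K] [AddCommGroup V] [Module K V] [AddCommGroup V']
  [Module K V'] [AddCommGroup V₁] [Module K V₁] [AddCommGroup V₁'] [Module K V₁']

/-- The map `g ↦ g ∘ f - f' ∘ g`, which measures how far `g` is from intertwining `f` and `f'`. -/
def commutatorMap (f : Module.End K V) (f' : Module.End K V') :
    (V →ₗ[K] V') →ₗ[K] (V →ₗ[K] V') :=
  LinearMap.lcomp K V' f - LinearMap.compRight K f'

theorem commutatorMap_apply (f : Module.End K V) (f' : Module.End K V') (g : V →ₗ[K] V') (x : V) :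
    commutatorMap f f' g x = g (f x) - f' (g x) := rfl

/-- The space of intertwining maps from `f` to `f'`, that is of the linear maps `g` with
`g ∘ f = f' ∘ g`. -/
def intertwiners (f : Module.End K V) (f' : Module.End K V') : Submodule K (V →ₗ[K] V') :=
  LinearMap.ker (commutatorMap f f')

theorem mem_intertwiners {f : Module.End K V} {f' : Module.End K V'} {g : V →ₗ[K] V'} :
    g ∈ intertwiners f f' ↔ ∀ x, g (f x) = f' (g x) := by
  simp only [intertwiners, LinearMap.mem_ker, LinearMap.ext_iff, commutatorMap_apply,
    LinearMap.zero_apply, sub_eq_zero]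

/-- Conjugate pairs of endomorphisms have isomorphic spaces of intertwining maps. -/
def intertwinersCongr {f : Module.End K V} {f' : Module.End K V'} {f₁ : Module.End K V₁}
    {f₁' : Module.End K V₁'} (e : V ≃ₗ[K] V₁) (e' : V' ≃ₗ[K] V₁') (h : ∀ x, e (f x) = f₁ (e x))
    (h' : ∀ x, e' (f' x) = f₁' (e' x)) : intertwiners f f' ≃ₗ[K] intertwiners f₁ f₁' :=
  LinearEquiv.ofSubmodules (e.arrowCongr e') _ _ <| by
    ext g
    have hg (x : V) : (e.arrowCongr e').symm g x = e'.symm (g (e x)) := rfl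
    have hf₁' (y : V₁') : f' (e'.symm y) = e'.symm (f₁' y) := by
      rw [LinearEquiv.eq_symm_apply, h', LinearEquiv.apply_symm_apply]
    simp_rw [Submodule.mem_map_equiv, mem_intertwiners, hg, h, hf₁', e'.symm.injective.eq_iff]
    exact (e.surjective.forall (p := fun x ↦ g (f₁ x) = f₁' (g x))).symm

/-- The endomorphism of `V ^ n` which is `f` on every coordinate. -/
def piEnd (n : ℕ) (f : Module.End K V) : Module.End K (Fin n → V) :=
  LinearMap.pi fun i ↦ f ∘ₗ LinearMap.proj i

theorem piEnd_apply (n : ℕ) (f : Module.End K V) (x : Fin n → V) (i : Fin n) :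
    piEnd n f x i = f (x i) := rfl

theorem piEnd_single {n : ℕ} (f : Module.End K V) (j : Fin n) (x : V) :
    piEnd n f (Pi.single j x) = Pi.single j (f x) := by
  ext i
  obtain rfl | hij := eq_or_ne i j
  · simp [piEnd_apply]
  · simp [piEnd_apply, hij]

/-- An intertwining map from `f ^ n` to `f' ^ n` is a matrix of intertwining maps. -/
def intertwinersPi (n : ℕ) (f : Module.End K V) (f' : Module.End K V') :
    intertwiners (piEnd n f) (piEnd n f') ≃ₗ[K] (Fin n → Fin n → intertwiners f f') where
  toFun g i j := ⟨LinearMap.proj i ∘ₗ g.1 ∘ₗ LinearMap.single K (fun _ ↦ V) j,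
    mem_intertwiners.2 fun x ↦ by
      have hg := congrFun (mem_intertwiners.1 g.2 (Pi.single j x)) i
      rwa [piEnd_single, piEnd_apply] at hg⟩
  map_add' _ _ := rfl
  map_smul' _ _ := rfl
  invFun h := ⟨LinearMap.pi fun i ↦ ∑ j, (h i j).1 ∘ₗ LinearMap.proj j,
    mem_intertwiners.2 fun x ↦ by
      ext i
      simp only [LinearMap.pi_apply, LinearMap.sum_apply, LinearMap.comp_apply,
        LinearMap.proj_apply, piEnd_apply, map_sum]
      exact Finset.sum_congr rfl fun j _ ↦ mem_intertwiners.1 (h i j).2 (x j)⟩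
  left_inv g := by
    ext1
    refine LinearMap.ext fun x ↦ funext fun i ↦ ?_
    simp only [LinearMap.pi_apply, LinearMap.sum_apply, LinearMap.comp_apply,
      LinearMap.proj_apply]
    rw [← Finset.sum_apply, ← map_sum]
    exact congrFun (congrArg g.1 (LinearMap.sum_single_apply (fun _ ↦ V) x)) i
  right_inv h := by
    ext i j x
    simp only [LinearMap.pi_apply, LinearMap.sum_apply, LinearMap.comp_apply,
      LinearMap.proj_apply, LinearMap.single_apply]
    rw [Finset.sum_eq_single j (fun b _ hb ↦ by simp [hb]) (by simp), Pi.single_eq_same]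

/-- An intertwining map out of `f × f₁` is a pair of intertwining maps. -/
def intertwinersProdLeft (f : Module.End K V) (f₁ : Module.End K V₁) (f' : Module.End K V') :
    intertwiners (f.prodMap f₁) f' ≃ₗ[K] intertwiners f f' × intertwiners f₁ f' where
  toFun g := ⟨⟨g.1 ∘ₗ LinearMap.inl K V V₁, mem_intertwiners.2 fun x ↦ by
      simpa using mem_intertwiners.1 g.2 (x, 0)⟩,
    ⟨g.1 ∘ₗ LinearMap.inr K V V₁, mem_intertwiners.2 fun x ↦ by
      simpa using mem_intertwiners.1 g.2 (0, x)⟩⟩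
  map_add' _ _ := rfl
  map_smul' _ _ := rfl
  invFun h := ⟨h.1.1.coprod h.2.1, mem_intertwiners.2 fun x ↦ by
    simp [mem_intertwiners.1 h.1.2, mem_intertwiners.1 h.2.2]⟩
  left_inv g := Subtype.ext <| LinearMap.ext fun x ↦ by simp
  right_inv h := by ext <;> simp

end Intertwiners

section IntertwinersField

variable {K V V' : Type*} [Field K] [AddCommGroup V] [Module K V] [AddCommGroup V'] [Module K V']

theorem finrank_intertwiners_piEnd [Module.Finite K V] [Module.Finite K V'] (n : ℕ)
    (f : Module.End K V) (f' : Module.End K V') :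
    Module.finrank K (intertwiners (piEnd n f) (piEnd n f')) =
      n * (n * Module.finrank K (intertwiners f f')) := by
  rw [(intertwinersPi n f f').finrank_eq, Module.finrank_pi_fintype]
  simp [Module.finrank_pi_fintype]

variable (E : Type*) [Field E] [Algebra K E]

theorem baseChangeHom_commutatorMap (f : Module.End K V) (f' : Module.End K V')
    (g : V →ₗ[K] V') :
    (commutatorMap f f' g).baseChange E =
      commutatorMap (f.baseChange E) (f'.baseChange E) (g.baseChange E) := by
  ext x
  simp [commutatorMap_apply, TensorProduct.tmul_sub]

theorem isBaseChange_baseChangeHom [Module.Finite K V] :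
    IsBaseChange E (LinearMap.baseChangeHom K E V V') :=
  have := Module.finitePresentation_of_finite K V
  Module.FinitePresentation.isBaseChange_map K V V' E

theorem finrank_intertwiners_baseChange [Module.Finite K V] (f : Module.End K V)
    (f' : Module.End K V') :
    Module.finrank E (intertwiners (f.baseChange E) (f'.baseChange E)) =
      Module.finrank K (intertwiners f f') := by
  let θ := commutatorMap f f'
  let β := (isBaseChange_baseChangeHom (K := K) (V := V) (V' := V') E).equiv
  have hβ : ∀ g, commutatorMap (f.baseChange E) (f'.baseChange E) (β g) =
      β (TensorProduct.AlgebraTensorModule.lTensor E E θ g) := by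
    refine LinearMap.congr_fun (f := commutatorMap (f.baseChange E) (f'.baseChange E) ∘ₗ
      β.toLinearMap) (g := β.toLinearMap ∘ₗ TensorProduct.AlgebraTensorModule.lTensor E E θ) ?_
    ext g : 3
    simp [β, θ, IsBaseChange.equiv_tmul, baseChangeHom_commutatorMap]
  have hker : (LinearMap.ker (TensorProduct.AlgebraTensorModule.lTensor E E θ)).map
      (β : E ⊗[K] (V →ₗ[K] V') →ₗ[E] (E ⊗[K] V →ₗ[E] E ⊗[K] V')) =
      intertwiners (f.baseChange E) (f'.baseChange E) := by
    ext g
    rw [Submodule.mem_map_equiv, intertwiners, LinearMap.mem_ker, LinearMap.mem_ker,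
      ← β.map_eq_zero_iff, ← hβ, β.apply_symm_apply]
  rw [← hker, LinearEquiv.finrank_map_eq, ← (LinearMap.tensorKerEquiv E E θ).finrank_eq,
    Module.finrank_baseChange, intertwiners]

end IntertwinersField

section SimpleEnd

open Polynomial

variable {K V V' : Type*} [Field K] [AddCommGroup V] [Module K V] [AddCommGroup V'] [Module K V']

theorem aeval_apply_of_mem_intertwiners {f : Module.End K V} {f' : Module.End K V'}
    {g : V →ₗ[K] V'} (hg : g ∈ intertwiners f f') (p : K[X]) (x : V) :
    g (aeval f p x) = aeval f' p (g x) := by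
  have hpow (n : ℕ) : g ((f ^ n) x) = (f' ^ n) (g x) := by
    rw [Module.End.pow_apply, Module.End.pow_apply]
    exact Function.Semiconj.iterate_right (mem_intertwiners.1 hg) n x
  induction p using Polynomial.induction_on' with
  | add p q hp hq => simp [hp, hq]
  | monomial n a => simp [aeval_monomial, hpow]

theorem ker_aeval_mem_invtSubmodule (f : Module.End K V) (p : K[X]) :
    LinearMap.ker (aeval f p) ∈ f.invtSubmodule := fun x hx ↦ by
  have hf : f ∈ intertwiners f f := mem_intertwiners.2 fun _ ↦ rfl
  rw [Submodule.mem_comap, LinearMap.mem_ker, ← aeval_apply_of_mem_intertwiners hf,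
    LinearMap.mem_ker.1 hx, map_zero]

/-- The map `p ↦ p(f) v` from polynomials to vectors; its image is the cyclic subspace generated
by `v`. -/
noncomputable def aevalAt (f : Module.End K V) (v : V) : K[X] →ₗ[K] V :=
  LinearMap.applyₗ v ∘ₗ (aeval f).toLinearMap

theorem aevalAt_apply (f : Module.End K V) (v : V) (p : K[X]) : aevalAt f v p = aeval f p v := rfl

theorem aevalAt_X_mul (f : Module.End K V) (v : V) (p : K[X]) :
    aevalAt f v (X * p) = f (aevalAt f v p) := by
  rw [aevalAt_apply, aevalAt_apply, map_mul, aeval_X, Module.End.mul_apply]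

theorem exists_mem_intertwiners_of_ker_aevalAt_le {f : Module.End K V} {f' : Module.End K V'}
    {v : V} {w : V'} (hv : Function.Surjective (aevalAt f v))
    (hvw : LinearMap.ker (aevalAt f v) ≤ LinearMap.ker (aevalAt f' w)) :
    ∃ g ∈ intertwiners f f', g v = w := by
  let e := (aevalAt f v).quotKerEquivOfSurjective hv
  let g : V →ₗ[K] V' := (LinearMap.ker (aevalAt f v)).liftQ _ hvw ∘ₗ e.symm.toLinearMap
  have hg (p : K[X]) : g (aevalAt f v p) = aevalAt f' w p := by
    have he : e.symm (aevalAt f v p) = (LinearMap.ker (aevalAt f v)).mkQ p :=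
      e.symm_apply_eq.2 rfl
    rw [LinearMap.comp_apply, LinearEquiv.coe_coe, he]
    rfl
  refine ⟨g, mem_intertwiners.2 fun x ↦ ?_, by simpa [aevalAt_apply] using hg 1⟩
  obtain ⟨p, rfl⟩ := hv x
  rw [← aevalAt_X_mul, hg, hg, aevalAt_X_mul]

/-- An endomorphism of a nonzero space without nontrivial invariant subspaces. -/
def IsSimpleEnd (f : Module.End K V) : Prop :=
  Nontrivial V ∧ ∀ p ∈ f.invtSubmodule, p = ⊥ ∨ p = ⊤

namespace IsSimpleEnd

variable {f : Module.End K V} (hf : IsSimpleEnd f)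
include hf

theorem aeval_eq_zero {p : K[X]} {v : V} (hv : v ≠ 0) (h : aeval f p v = 0) : aeval f p = 0 := by
  obtain hker | hker := hf.2 _ (ker_aeval_mem_invtSubmodule f p)
  · exact (hv ((Submodule.eq_bot_iff _).1 hker v h)).elim
  · exact LinearMap.ker_eq_top.1 hker

theorem aevalAt_surjective {v : V} (hv : v ≠ 0) : Function.Surjective (aevalAt f v) := by
  have hinvt : LinearMap.range (aevalAt f v) ∈ f.invtSubmodule := by
    rintro _ ⟨p, rfl⟩
    exact ⟨X * p, aevalAt_X_mul f v p⟩
  refine LinearMap.range_eq_top.1 ((hf.2 _ hinvt).resolve_left fun hbot ↦ hv ?_)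
  rw [← Submodule.mem_bot K, ← hbot]
  exact ⟨1, by simp [aevalAt_apply]⟩

variable [Module.Finite K V]

theorem charpoly_eq_minpoly : f.charpoly = minpoly K f := by
  have := hf.1
  obtain ⟨v, hv⟩ := exists_ne (0 : V)
  have hmonic := minpoly.monic (LinearMap.isIntegral f)
  refine eq_of_monic_of_dvd_of_natDegree_le hmonic f.charpoly_monic
    (LinearMap.minpoly_dvd_charpoly f) ?_
  have hsurj : Function.Surjective
      (aevalAt f v ∘ₗ (degreeLT K (minpoly K f).natDegree).subtype) := by
    intro x
    obtain ⟨p, rfl⟩ := hf.aevalAt_surjective hv x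
    refine ⟨⟨p %ₘ minpoly K f, mem_degreeLT.2 ?_⟩, ?_⟩
    · rw [← degree_eq_natDegree hmonic.ne_zero]
      exact degree_modByMonic_lt p hmonic
    · exact congrArg (· v) (aeval_modByMonic_eq_self_of_root (minpoly.aeval K f))
  have hle := LinearMap.finrank_le_finrank_of_surjective hsurj
  rwa [(degreeLTEquiv K _).finrank_eq, Module.finrank_fin_fun, ← LinearMap.charpoly_natDegree f]
    at hle

theorem irreducible_charpoly : Irreducible f.charpoly := by
  have := hf.1
  rw [hf.charpoly_eq_minpoly, irreducible_iff_prime]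
  refine ⟨minpoly.ne_zero (LinearMap.isIntegral f), minpoly.not_isUnit K f, fun a b hab ↦ ?_⟩
  rw [minpoly.dvd_iff, minpoly.dvd_iff, or_iff_not_imp_right]
  intro hb
  obtain ⟨x, hx⟩ : ∃ x, aeval f b x ≠ 0 := not_forall.1 fun h ↦ hb (LinearMap.ext h)
  refine hf.aeval_eq_zero hx ?_
  rw [← Module.End.mul_apply, ← map_mul, minpoly.dvd_iff.1 hab, LinearMap.zero_apply]

theorem aeval_eq_zero_iff {p : K[X]} : aeval f p = 0 ↔ f.charpoly ∣ p := by
  rw [hf.charpoly_eq_minpoly, minpoly.dvd_iff]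

theorem exists_mem_intertwiners_apply_eq {f' : Module.End K V'} {v : V} {w : V'} (hv : v ≠ 0)
    (hw : aeval f' f.charpoly w = 0) : ∃ g ∈ intertwiners f f', g v = w := by
  refine exists_mem_intertwiners_of_ker_aevalAt_le (hf.aevalAt_surjective hv) fun p hp ↦ ?_
  obtain ⟨r, rfl⟩ := hf.aeval_eq_zero_iff.1 (hf.aeval_eq_zero hv hp)
  rw [LinearMap.mem_ker, aevalAt_apply, mul_comm, map_mul, Module.End.mul_apply, hw, map_zero]

/-- Evaluation at a nonzero vector `v` is an isomorphism, because `v` is a cyclic vector whose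
annihilator is generated by the characteristic polynomial of `f`. -/
theorem finrank_intertwiners (f' : Module.End K V') :
    Module.finrank K (intertwiners f f') =
      Module.finrank K (LinearMap.ker (aeval f' f.charpoly)) := by
  have := hf.1
  obtain ⟨v, hv⟩ := exists_ne (0 : V)
  let ev : intertwiners f f' →ₗ[K] LinearMap.ker (aeval f' f.charpoly) :=
    (LinearMap.applyₗ v ∘ₗ (intertwiners f f').subtype).codRestrict _ fun g ↦ by
      change aeval f' f.charpoly (g.1 v) = 0
      rw [← aeval_apply_of_mem_intertwiners g.2, LinearMap.aeval_self_charpoly,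
        LinearMap.zero_apply, map_zero]
  refine (LinearEquiv.ofBijective ev ⟨(injective_iff_map_eq_zero ev).2 fun g hg ↦ ?_,
    fun w ↦ ?_⟩).finrank_eq
  · refine Subtype.ext (LinearMap.ext fun x ↦ ?_)
    obtain ⟨p, rfl⟩ := hf.aevalAt_surjective hv x
    have hgv : g.1 v = 0 := congrArg Subtype.val hg
    rw [aevalAt_apply, aeval_apply_of_mem_intertwiners g.2, hgv, map_zero]
    rfl
  · obtain ⟨g, hg, hgv⟩ := hf.exists_mem_intertwiners_apply_eq hv (LinearMap.mem_ker.1 w.2)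
    exact ⟨⟨g, hg⟩, Subtype.ext hgv⟩

theorem finrank_ker_aeval {μ : K[X]} (hμ : Irreducible μ) (hμ' : μ.Monic) :
    Module.finrank K (LinearMap.ker (aeval f μ)) =
      open Classical in if μ = f.charpoly then μ.natDegree else 0 := by
  split_ifs with h
  · rw [h, LinearMap.aeval_self_charpoly, LinearMap.ker_zero, finrank_top,
      LinearMap.charpoly_natDegree]
  · obtain hbot | htop := hf.2 _ (ker_aeval_mem_invtSubmodule f μ)
    · rw [hbot, finrank_bot]
    · have hdvd := hf.aeval_eq_zero_iff.1 (LinearMap.ker_eq_top.1 htop)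
      exact (h (eq_of_monic_of_associated f.charpoly_monic hμ'
        (hf.irreducible_charpoly.associated_of_dvd hμ hdvd)).symm).elim

end IsSimpleEnd

theorem exists_isSimpleEnd_restrict [Module.Finite K V] [Nontrivial V] (f : Module.End K V) :
    ∃ (S : Submodule K V) (hS : S ∈ f.invtSubmodule), IsSimpleEnd (f.restrict hS) := by
  obtain ⟨S, ⟨hS, hS0⟩, hmin⟩ := WellFounded.has_min (wellFounded_lt (α := Submodule K V))
    {p | p ∈ f.invtSubmodule ∧ p ≠ ⊥} ⟨⊤, Module.End.invtSubmodule.top_mem f, top_ne_bot⟩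
  refine ⟨S, hS, Submodule.nontrivial_iff_ne_bot.2 hS0, fun p hp ↦ or_iff_not_imp_left.2 fun h ↦ ?_⟩
  have hinj := Submodule.map_injective_of_injective S.injective_subtype
  have hp0 : p.map S.subtype ≠ ⊥ := fun h' ↦ h (hinj (h'.trans (Submodule.map_bot _).symm))
  have hpS := hmin _
    ⟨Module.End.invtSubmodule.map_subtype_mem_of_mem_invtSubmodule f hS hp, hp0⟩
  apply hinj
  rw [eq_of_le_of_not_lt (Submodule.map_subtype_le S p) hpS, Submodule.map_subtype_top]

end SimpleEnd

section CharPoly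

open Polynomial UniqueFactorizationMonoid

variable {K V V' : Type*} [Field K] [AddCommGroup V] [Module K V] [AddCommGroup V'] [Module K V']

theorem charPoly_eq_charpoly [Module.Finite K V] (f : Module.End K V) :
    charPoly f = f.charpoly :=
  dif_pos _

theorem charPoly_of_subsingleton [Subsingleton V] (f : Module.End K V) : charPoly f = 1 := by
  rw [charPoly_eq_charpoly]
  exact eq_one_of_monic_natDegree_zero f.charpoly_monic
    (by rw [LinearMap.charpoly_natDegree, Module.finrank_zero_of_subsingleton])

open Classical in
theorem rPairing_eq_sum_map (f g : K[X]) :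
    rPairing f g =
      ((normalizedFactors f).map fun μ ↦ (normalizedFactors g).count μ * μ.natDegree).sum := by
  simp only [Finset.sum_multiset_map_count, rPairing, mul_assoc, smul_eq_mul]

theorem rPairing_mul_left {f g h : K[X]} (hf : f ≠ 0) (hg : g ≠ 0) :
    rPairing (f * g) h = rPairing f h + rPairing g h := by
  classical
  simp only [rPairing_eq_sum_map, normalizedFactors_mul hf hg, Multiset.map_add, Multiset.sum_add]

theorem rPairing_mul_right {f g h : K[X]} (hg : g ≠ 0) (hh : h ≠ 0) :
    rPairing f (g * h) = rPairing f g + rPairing f h := by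
  classical
  simp only [rPairing_eq_sum_map, normalizedFactors_mul hg hh, Multiset.count_add, add_mul,
    Multiset.sum_map_add]

theorem rPairing_one_left (g : K[X]) : rPairing 1 g = 0 := by
  simp [rPairing_eq_sum_map]

theorem rPairing_one_right (f : K[X]) : rPairing f 1 = 0 := by
  simp [rPairing_eq_sum_map]

open Classical in
theorem rPairing_of_irreducible {f g : K[X]} (hf : Irreducible f) (hg : Irreducible g)
    (hf' : f.Monic) (hg' : g.Monic) : rPairing f g = if f = g then f.natDegree else 0 := by
  rw [rPairing_eq_sum_map, normalizedFactors_irreducible hf, normalizedFactors_irreducible hg,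
    hf'.normalize_eq_self, hg'.normalize_eq_self]
  simp [Multiset.count_singleton]

theorem finrank_ker_aeval_prodMap [Module.Finite K V] [Module.Finite K V']
    (f : Module.End K V) (f' : Module.End K V') (p : K[X]) :
    Module.finrank K (LinearMap.ker (aeval (f.prodMap f') p)) =
      Module.finrank K (LinearMap.ker (aeval f p)) +
        Module.finrank K (LinearMap.ker (aeval f' p)) := by
  have haeval : aeval (f.prodMap f') p = (aeval f p).prodMap (aeval f' p) := by
    have h := aeval_algHom_apply (LinearMap.prodMapAlgHom K V V') (f, f') p
    rwa [aeval_prod_apply] at h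
  have hker (p : Submodule K V) (p' : Submodule K V') :
      p.prod p' = LinearMap.range (p.subtype.prodMap p'.subtype) := by
    rw [LinearMap.range_prodMap, p.range_subtype, p'.range_subtype]
  rw [haeval, LinearMap.ker_prodMap, hker, LinearMap.finrank_range_of_inj, Module.finrank_prod]
  exact Prod.map_injective.2 ⟨Subtype.val_injective, Subtype.val_injective⟩

theorem finrank_ker_aeval_conj (f : Module.End K V) (e : V ≃ₗ[K] V') (p : K[X]) :
    Module.finrank K (LinearMap.ker (aeval (e.conj f) p)) =
      Module.finrank K (LinearMap.ker (aeval f p)) := by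
  have haeval : aeval (e.conj f) p = e.conj (aeval f p) :=
    aeval_algHom_apply (e.conjAlgEquiv K : Module.End K V →ₐ[K] Module.End K V') f p
  have hker : LinearMap.ker (e.conj (aeval f p)) =
      (LinearMap.ker (aeval f p)).map (e : V →ₗ[K] V') := by
    ext x
    rw [Submodule.mem_map_equiv, LinearMap.mem_ker, LinearMap.mem_ker,
      LinearEquiv.conj_apply_apply, e.map_eq_zero_iff]
  rw [haeval, hker, LinearEquiv.finrank_map_eq]

end CharPoly

section Semisimple

universe u

open Polynomial

variable {K : Type*} [Field K]

theorem isSemisimple_induction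
    {motive : ∀ (V : Type u) [AddCommGroup V] [Module K V], Module.End K V → Prop}
    (subsingleton : ∀ (V : Type u) [AddCommGroup V] [Module K V] (f : Module.End K V)
      [Subsingleton V], motive V f)
    (prod : ∀ (V V' : Type u) [AddCommGroup V] [Module K V] [AddCommGroup V'] [Module K V']
      [Module.Finite K V] [Module.Finite K V'] (f : Module.End K V) (f' : Module.End K V'),
      IsSimpleEnd f → motive V' f' → motive (V × V') (f.prodMap f'))
    (conj : ∀ (V V' : Type u) [AddCommGroup V] [Module K V] [AddCommGroup V'] [Module K V']
      [Module.Finite K V] (f : Module.End K V) (e : V ≃ₗ[K] V'), motive V f → motive V' (e.conj f))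
    {V : Type u} [AddCommGroup V] [Module K V] [Module.Finite K V] {f : Module.End K V}
    (hf : f.IsSemisimple) : motive V f := by
  induction hn : Module.finrank K V using Nat.strong_induction_on generalizing V with
  | _ n ih =>
    obtain _ | _ := subsingleton_or_nontrivial V
    · exact subsingleton V f
    obtain ⟨S, hS, hSf⟩ := exists_isSimpleEnd_restrict f
    obtain ⟨S', hS', hc⟩ := Module.End.isSemisimple_iff.1 hf S hS
    have hlt : Module.finrank K S' < n := by
      have := hSf.1
      have hpos : 0 < Module.finrank K S := Module.finrank_pos
      have hadd := Submodule.finrank_add_eq_of_isCompl hc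
      lia
    let e := Submodule.prodEquivOfIsCompl S S' hc
    have he : e.conj ((f.restrict hS).prodMap (f.restrict hS')) = f := by
      refine LinearMap.ext fun x ↦ ?_
      obtain ⟨x, rfl⟩ := e.surjective x
      rw [LinearEquiv.conj_apply_apply, LinearEquiv.symm_apply_apply]
      simp only [e, LinearMap.prodMap_apply, Submodule.coe_prodEquivOfIsCompl', map_add]
      rfl
    rw [← he]
    exact conj _ _ _ e (prod _ _ _ _ hSf (ih _ hlt (hf.restrict hS') rfl))

theorem finrank_ker_aeval_of_isSemisimple {V : Type u} [AddCommGroup V] [Module K V]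
    [Module.Finite K V] {f : Module.End K V} (hf : f.IsSemisimple) {μ : K[X]} (hμ : Irreducible μ)
    (hμ' : μ.Monic) :
    Module.finrank K (LinearMap.ker (aeval f μ)) = rPairing μ (charPoly f) := by
  refine isSemisimple_induction (motive := fun V _ _ f ↦
    Module.finrank K (LinearMap.ker (aeval f μ)) = rPairing μ (charPoly f))
    (fun V _ _ f _ ↦ ?_) (fun V V' _ _ _ _ _ _ f f' hf ih ↦ ?_) (fun V V' _ _ _ _ _ f e ih ↦ ?_) hf
  · rw [charPoly_of_subsingleton, rPairing_one_right, Module.finrank_zero_of_subsingleton]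
  · rw [charPoly_eq_charpoly] at ih ⊢
    rw [finrank_ker_aeval_prodMap, ih, hf.finrank_ker_aeval hμ hμ', LinearMap.charpoly_prodMap,
      rPairing_mul_right f.charpoly_monic.ne_zero f'.charpoly_monic.ne_zero,
      rPairing_of_irreducible hμ hf.irreducible_charpoly hμ' f.charpoly_monic]
  · have : Module.Finite K V' := .equiv e
    rw [charPoly_eq_charpoly] at ih ⊢
    rw [finrank_ker_aeval_conj, LinearEquiv.charpoly_conj, ih]

theorem finrank_intertwiners_of_isSemisimple {V : Type u} [AddCommGroup V] [Module K V]
    [Module.Finite K V] {V' : Type*} [AddCommGroup V'] [Module K V'] [Module.Finite K V']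
    {f : Module.End K V} {f' : Module.End K V'} (hf : f.IsSemisimple) (hf' : f'.IsSemisimple) :
    Module.finrank K (intertwiners f f') = rPairing (charPoly f) (charPoly f') := by
  refine isSemisimple_induction (motive := fun V _ _ f ↦
    Module.finrank K (intertwiners f f') = rPairing (charPoly f) (charPoly f'))
    (fun V _ _ f _ ↦ ?_) (fun V₁ V₂ _ _ _ _ _ _ f₁ f₂ hf₁ ih ↦ ?_)
    (fun V₁ V₂ _ _ _ _ _ f e ih ↦ ?_) hf
  · rw [charPoly_of_subsingleton, rPairing_one_left, Module.finrank_zero_of_subsingleton]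
  · rw [charPoly_eq_charpoly f₂] at ih
    rw [(intertwinersProdLeft f₁ f₂ f').finrank_eq, Module.finrank_prod, ih,
      hf₁.finrank_intertwiners, charPoly_eq_charpoly (f₁.prodMap f₂),
      finrank_ker_aeval_of_isSemisimple hf' hf₁.irreducible_charpoly f₁.charpoly_monic,
      LinearMap.charpoly_prodMap,
      rPairing_mul_left f₁.charpoly_monic.ne_zero f₂.charpoly_monic.ne_zero]
  · have : Module.Finite K V₂ := .equiv e
    have hcongr := (intertwinersCongr (f' := f') e (.refl K V') (f := f) (f₁ := e.conj f)
      (fun x ↦ by simp [LinearEquiv.conj_apply_apply]) fun _ ↦ rfl).finrank_eq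
    rw [charPoly_eq_charpoly] at ih ⊢
    rw [LinearEquiv.charpoly_conj, ← ih, hcongr]

end Semisimple

section Semilinear

open Module

variable {F L : Type*} [Field F] [Fintype F] [Field L] [Algebra F L] [FiniteDimensional F L]
  {K : Type*} [Field K]

theorem finrank_eq_mul_finrank_fixedSubmodule {P : Type*} [AddCommGroup P] [Module L P]
    [Module K P] [SMulCommClass K L P] [Module.Finite K P] {Φ : P →ₛₗ[frobL F L] P}
    (hΦ : ∀ (a : K) x, Φ (a • x) = a • Φ x) {W : Submodule K P}
    (hW : ∀ x, x ∈ W ↔ Φ^[finrank F L] x = x) :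
    finrank K W = finrank F L * finrank K (fixedSubmodule K Φ hΦ) := by
  have := SMulCommClass.symm K L P
  let b := finBasis F L
  let combination : (Fin (finrank F L) → fixedSubmodule K Φ hΦ) →ₗ[K] P :=
    ∑ i, DistribSMul.toLinearMap K P (b i) ∘ₗ (fixedSubmodule K Φ hΦ).subtype ∘ₗ LinearMap.proj i
  have combination_apply (x) : combination x = ∑ i, b i • (x i : P) := by
    simp [combination, LinearMap.sum_apply]
  have coordinate (x) (i) :
      orbitSum Φ (finrank F L) (b.traceDual i • combination x) = x i := by
    rw [combination_apply, Finset.smul_sum, orbitSum_sum]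
    simp only [smul_smul]
    have h (j) := orbitSum_smul_of_map_eq (AlgHom.id F L) (x j).2 (b.traceDual i * b j)
    simp only [AlgHom.id_apply, b.trace_traceDual_mul] at h
    simp [h]
  have injective : Function.Injective combination := fun x y hxy ↦ funext fun i ↦ Subtype.ext <| by
    rw [← coordinate, hxy, coordinate]
  have range_eq : LinearMap.range combination = W := by
    refine le_antisymm ?_ fun x hx ↦ ⟨fun i ↦ ⟨orbitSum Φ (finrank F L) (b.traceDual i • x),
      map_orbitSum_smul (AlgHom.id F L) ((hW x).1 hx) _⟩,
      (combination_apply _).trans (sum_smul_orbitSum_traceDual (AlgHom.id F L) b x)⟩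
    rintro _ ⟨x, rfl⟩
    rw [combination_apply]
    refine W.sum_mem fun i _ ↦ (hW _).2 ?_
    rw [← AlgHom.id_apply (R := F) (b i), iterate_finrank_smul, Function.iterate_fixed (x i).2]
  rw [← range_eq, LinearMap.finrank_range_of_inj injective, finrank_pi_fintype]
  simp

theorem eq_zero_of_sum_frobL_smul_eq_zero {M : Type*} [AddCommGroup M] [Module L M]
    {y : Fin (finrank F L) → M}
    (h : ∀ a : L, ∑ j : Fin (finrank F L), (frobL F L)^[j] a • y j = 0) : y = 0 := by
  let b := finBasis F L
  funext i
  calc y i = ∑ j, (if i = j then (1 : L) else 0) • y j := by simp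
    _ = ∑ m, (frobL F L)^[i] (b m) • ∑ j : Fin _, (frobL F L)^[j] (b.traceDual m) • y j := by
      simp only [← sum_frobL_mul_traceDual b, Finset.sum_smul, Finset.smul_sum, mul_smul]
      exact Finset.sum_comm
    _ = 0 := by simp only [h, smul_zero, Finset.sum_const_zero]

variable {V V' : Type*} [AddCommGroup V] [Module K V] [AddCommGroup V'] [Module K V'] [Module L V']
  {φ : Module.End K V} {φ' : Module.End K V'}

theorem finrank_intertwiners_pow [SMulCommClass K L V'] [Module.Finite K V]
    [Module.Finite K V'] (hφ : Function.Bijective φ)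
    (hφ' : ∀ (b : L) x, φ' (b • x) = frobL F L b • φ' x) :
    finrank K (intertwiners (φ ^ finrank F L) (φ' ^ finrank F L)) =
      finrank F L * finrank K (intertwiners φ φ') := by
  let φe := LinearEquiv.ofBijective φ hφ
  let Φ : (V →ₗ[K] V') →ₛₗ[frobL F L] (V →ₗ[K] V') :=
    { toFun := fun g ↦ φ' ∘ₗ g ∘ₗ φe.symm
      map_add' := fun g h ↦ by rw [LinearMap.add_comp, LinearMap.comp_add]
      map_smul' := fun b g ↦ LinearMap.ext fun x ↦ hφ' b _ }
  have iterate_apply (n : ℕ) (g : V →ₗ[K] V') (x : V) : Φ^[n] g ((φ ^ n) x) = (φ' ^ n) (g x) := by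
    induction n generalizing g x with
    | zero => rfl
    | succ n ih =>
      rw [Function.iterate_succ_apply, pow_succ, pow_succ]
      exact (ih (Φ g) (φ x)).trans
        (congrArg (fun y ↦ (φ' ^ n) (φ' (g y))) (φe.symm_apply_apply x))
  have iterate_eq_iff (n : ℕ) (g : V →ₗ[K] V') :
      g ∈ intertwiners (φ ^ n) (φ' ^ n) ↔ Φ^[n] g = g := by
    have surjective : Function.Surjective (φ ^ n) := by
      rw [Module.End.coe_pow]
      exact hφ.2.iterate n
    refine mem_intertwiners.trans (Iff.trans ?_ (LinearMap.ext_iff.trans surjective.forall).symm)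
    exact forall_congr' fun x ↦ by rw [iterate_apply, eq_comm]
  have hΦ (a : K) (g : V →ₗ[K] V') : Φ (a • g) = a • Φ g :=
    LinearMap.ext fun x ↦ map_smul φ' a _
  have fixed_eq : fixedSubmodule K Φ hΦ = intertwiners φ φ' :=
    Submodule.ext fun g ↦ by
      have h := iterate_eq_iff 1 g
      rw [pow_one, pow_one] at h
      exact h.symm
  rw [finrank_eq_mul_finrank_fixedSubmodule hΦ (iterate_eq_iff _), fixed_eq]

variable [Module L V]

omit [FiniteDimensional F L] in
theorem pow_smul_of_map_smul (hφ : ∀ (b : L) x, φ (b • x) = frobL F L b • φ x) (n : ℕ) (b : L)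
    (x : V) :
    (φ ^ n) (b • x) = (frobL F L)^[n] b • (φ ^ n) x := by
  induction n with
  | zero => rfl
  | succ n ih => rw [pow_succ' φ, Module.End.mul_apply, ih, hφ, Module.End.mul_apply,
      Function.iterate_succ_apply']

theorem mem_intertwiners_of_sum_mem (hφ : ∀ (b : L) x, φ (b • x) = frobL F L b • φ x)
    (hφ' : ∀ (b : L) x, φ' (b • x) = frobL F L b • φ' x) {G : Fin (finrank F L) → (V →ₗ[K] V')}
    (hG : ∀ (a : L) j x, G j (a • x) = (frobL F L)^[(j : ℕ)] a • G j x)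
    (hsum : ∑ j, G j ∈ intertwiners φ φ') (j : Fin (finrank F L)) :
    G j ∈ intertwiners φ φ' := by
  have := finite_of_finite F (M := L)
  refine mem_intertwiners.2 fun x ↦ sub_eq_zero.1 ?_
  refine congrFun (eq_zero_of_sum_frobL_smul_eq_zero (F := F) (L := L)
    (y := fun j ↦ G j (φ x) - φ' (G j x)) fun a ↦ ?_) j
  obtain ⟨a, rfl⟩ := Finite.surjective_of_injective (frobL F L).injective a
  have h := mem_intertwiners.1 hsum (a • x)
  simp only [LinearMap.sum_apply, map_sum, hφ, hG, hφ'] at h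
  simp only [← Function.iterate_succ_apply' (frobL F L), Function.iterate_succ_apply] at h
  simp only [smul_sub, Finset.sum_sub_distrib, h, sub_self]

variable [SMulCommClass K L V']

theorem exists_semilinear_components [Algebra F K] [SMulCommClass K L V]
    (hF : ∀ (a : F) (x : V), algebraMap F L a • x = algebraMap F K a • x)
    (hF' : ∀ (a : F) (x : V'), algebraMap F L a • x = algebraMap F K a • x) (g : V →ₗ[K] V') :
    ∃ G : Fin (finrank F L) → (V →ₗ[K] V'), g = ∑ j, G j ∧
      ∀ (a : L) j x, G j (a • x) = (frobL F L)^[(j : ℕ)] a • G j x := by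
  have := SMulCommClass.symm K L V
  let b := finBasis F L
  let G (j : Fin (finrank F L)) : V →ₗ[K] V' :=
    ∑ m, (frobL F L)^[j] (b m) • g ∘ₗ DistribSMul.toLinearMap K V (b.traceDual m)
  have G_apply (j x) : G j x = ∑ m, (frobL F L)^[(j : ℕ)] (b m) • g (b.traceDual m • x) := by
    simp [G, LinearMap.sum_apply]
  have decomposition (a : L) (x : V) :
      g (a • x) = ∑ j : Fin (finrank F L), (frobL F L)^[j] a • G j x := by
    calc g (a • x)
        = ∑ m, algebraMap F L (Algebra.trace F L (a * b m)) • g (b.traceDual m • x) := by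
          conv_lhs => rw [← b.traceDual.sum_repr a, Finset.sum_smul, map_sum]
          simp only [b.traceDual_repr_apply, Algebra.smul_def, mul_smul, hF, hF', map_smul,
            Algebra.traceForm_apply]
      _ = ∑ j : Fin (finrank F L), (frobL F L)^[j] a • G j x := by
          simp only [algebraMap_trace_eq_sum_frobL, Finset.sum_range, iterate_map_mul, G_apply,
            Finset.sum_smul, Finset.smul_sum, mul_smul]
          exact Finset.sum_comm
  refine ⟨G, LinearMap.ext fun x ↦ by simpa [LinearMap.sum_apply] using decomposition 1 x,
    fun a j x ↦ sub_eq_zero.1 ?_⟩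
  refine congrFun (eq_zero_of_sum_frobL_smul_eq_zero
    (y := fun j ↦ G j (a • x) - (frobL F L)^[(j : ℕ)] a • G j x) fun a' ↦ ?_) j
  simp only [smul_sub, Finset.sum_sub_distrib, smul_smul, ← iterate_map_mul, ← decomposition,
    sub_self]

variable (L) in
/-- The `K`-linear maps intertwining `φ` and `φ'` that are moreover `L`-linear. -/
def linearIntertwiners (φ : Module.End K V) (φ' : Module.End K V') : Submodule K (V →ₗ[K] V') where
  carrier := {g | g ∈ intertwiners φ φ' ∧ ∀ (b : L) x, g (b • x) = b • g x}
  add_mem' {g h} hg hh := ⟨add_mem hg.1 hh.1, fun b x ↦ by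
    rw [LinearMap.add_apply, LinearMap.add_apply, hg.2, hh.2, smul_add]⟩
  zero_mem' := ⟨zero_mem _, fun b _ ↦ (smul_zero b).symm⟩
  smul_mem' a g hg := ⟨Submodule.smul_mem _ a hg.1, fun b x ↦ by
    rw [LinearMap.smul_apply, LinearMap.smul_apply, hg.2, smul_comm]⟩

theorem exists_comp_pow_eq (hφ_bij : Function.Bijective φ)
    (hφ : ∀ (b : L) x, φ (b • x) = frobL F L b • φ x) {g : V →ₗ[K] V'}
    (hg : g ∈ intertwiners φ φ') {n : ℕ} (hgL : ∀ (a : L) x, g (a • x) = (frobL F L)^[n] a • g x) :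
    ∃ h ∈ linearIntertwiners L φ φ', h ∘ₗ φ ^ n = g := by
  have := finite_of_finite F (M := L)
  have bijective : Function.Bijective (φ ^ n) := by
    rw [Module.End.coe_pow]
    exact hφ_bij.iterate n
  let ψ := LinearEquiv.ofBijective (φ ^ n) bijective
  have comp_apply (x) : (g ∘ₗ ψ.symm) ((φ ^ n) x) = g x := congrArg g (ψ.symm_apply_apply x)
  refine ⟨g ∘ₗ ψ.symm, ⟨mem_intertwiners.2 <| bijective.2.forall.2 fun x ↦ ?_, fun b ↦ ?_⟩,
    LinearMap.ext comp_apply⟩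
  · rw [← Module.End.mul_apply, ← pow_succ', pow_succ, Module.End.mul_apply, comp_apply,
      comp_apply, mem_intertwiners.1 hg]
  · obtain ⟨b, rfl⟩ := (Finite.surjective_of_injective (frobL F L).injective).iterate n b
    refine bijective.2.forall.2 fun x ↦ ?_
    rw [← pow_smul_of_map_smul hφ, comp_apply, comp_apply, hgL]

theorem finrank_intertwiners_eq_mul_finrank_linearIntertwiners [Algebra F K]
    [SMulCommClass K L V] [Module.Finite K V] [Module.Finite K V']
    (hF : ∀ (a : F) (x : V), algebraMap F L a • x = algebraMap F K a • x)
    (hF' : ∀ (a : F) (x : V'), algebraMap F L a • x = algebraMap F K a • x)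
    (hφ : ∀ (b : L) x, φ (b • x) = frobL F L b • φ x)
    (hφ' : ∀ (b : L) x, φ' (b • x) = frobL F L b • φ' x) (hφ_bij : Function.Bijective φ) :
    finrank K (intertwiners φ φ') = finrank F L * finrank K (linearIntertwiners L φ φ') := by
  have bijective (n : ℕ) : Function.Bijective (φ ^ n) := by
    rw [Module.End.coe_pow]
    exact hφ_bij.iterate n
  let twist : (Fin (finrank F L) → linearIntertwiners L φ φ') →ₗ[K] (V →ₗ[K] V') :=
    ∑ j : Fin (finrank F L), LinearMap.lcomp K V' (φ ^ (j : ℕ)) ∘ₗ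
      (linearIntertwiners L φ φ').subtype ∘ₗ LinearMap.proj j
  have twist_apply (h x) : twist h x = ∑ j, (h j : V →ₗ[K] V') ((φ ^ (j : ℕ)) x) := by
    simp [twist, LinearMap.sum_apply]
  have injective : Function.Injective twist := by
    refine (injective_iff_map_eq_zero _).2 fun h hh ↦ funext fun j ↦ Subtype.ext <|
      LinearMap.ext <| (bijective j).2.forall.2 fun x ↦ ?_
    refine congrFun (eq_zero_of_sum_frobL_smul_eq_zero (F := F) (L := L)
      (y := fun j ↦ (h j : V →ₗ[K] V') ((φ ^ (j : ℕ)) x)) fun a ↦ ?_) j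
    simp only [← (h _).2.2, ← pow_smul_of_map_smul hφ, ← twist_apply, hh, LinearMap.zero_apply]
  have range_eq : LinearMap.range twist = intertwiners φ φ' := by
    refine le_antisymm ?_ fun g hg ↦ ?_
    · rintro _ ⟨h, rfl⟩
      refine mem_intertwiners.2 fun x ↦ ?_
      simp only [twist_apply, map_sum, ← mem_intertwiners.1 (h _).2.1, ← Module.End.mul_apply,
        ← pow_succ, ← pow_succ']
    obtain ⟨G, rfl, hG⟩ := exists_semilinear_components hF hF' g
    choose h hh hG using fun j ↦ exists_comp_pow_eq hφ_bij hφ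
      (mem_intertwiners_of_sum_mem hφ hφ' hG hg j) fun a ↦ hG a j
    refine ⟨fun j ↦ ⟨h j, hh j⟩, LinearMap.ext fun x ↦ ?_⟩
    simp [twist_apply, ← hG, LinearMap.sum_apply]
  rw [← range_eq, LinearMap.finrank_range_of_inj injective, finrank_pi_fintype]
  simp

end Semilinear

/-! ## Generic fibres and quasi-morphisms -/

section LatticeSheaf

variable {Fq Q : Type*} [Field Fq] [Field Q] [Algebra Fq Q] {C : PointedCurve Fq Q}
variable {L : Type*} [Field L] [Algebra Fq L] {F F' : LatticeSheaf.{w} C L}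

instance : SMulCommClass Q L F.V := SMulCommClass.symm _ _ _

instance (R : Subalgebra Fq Q) : IsScalarTower R (ext L R) F.V :=
  ⟨fun a b x ↦ by rw [Algebra.smul_def, mul_smul]; rfl⟩

theorem smul_L_def (b : L) (x : F.V) : b • x = (b ⊗ₜ[Fq] (1 : Q)) • x := rfl

theorem tmul_smul (b : L) (a : Q) (x : F.V) : (b ⊗ₜ[Fq] a) • x = b • a • x := by
  rw [smul_Q_def, smul_L_def, smul_smul, Algebra.TensorProduct.tmul_mul_tmul, mul_one, one_mul]

theorem algebraMap_smul_eq (a : Fq) (x : F.V) : algebraMap Fq L a • x = algebraMap Fq Q a • x := by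
  rw [smul_L_def, smul_Q_def, Algebra.algebraMap_eq_smul_one, Algebra.algebraMap_eq_smul_one,
    TensorProduct.smul_tmul]

theorem toExt_smul (R : Subalgebra Fq Q) (s : R) (x : F.V) : toExt L R s • x = (s : Q) • x := rfl

theorem map_smul_Q {E : Type*} [FunLike E F.V F'.V] [LinearMapClass E (L ⊗[Fq] Q) F.V F'.V]
    (f : E) (a : Q) (x : F.V) : f (a • x) = a • f x :=
  map_smul f _ x

theorem map_smul_L {E : Type*} [FunLike E F.V F'.V] [LinearMapClass E (L ⊗[Fq] Q) F.V F'.V]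
    (f : E) (b : L) (x : F.V) : f (b • x) = b • f x :=
  map_smul f (b ⊗ₜ[Fq] (1 : Q)) x

/-- A `Q_L`-linear map as a `Q`-linear map. -/
def toQLin (f : F.V →ₗ[L ⊗[Fq] Q] F'.V) : F.V →ₗ[Q] F'.V where
  toFun := f
  map_add' := map_add f
  map_smul' := map_smul_Q f

/-- A `Q`-linear map which is also `L`-linear, as a `Q_L`-linear map. -/
noncomputable def ofQLin (g : F.V →ₗ[Q] F'.V) (hg : ∀ (b : L) x, g (b • x) = b • g x) :
    F.V →ₗ[L ⊗[Fq] Q] F'.V where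
  toFun := g
  map_add' := map_add g
  map_smul' z x := by
    change g (z • x) = z • g x
    induction z using TensorProduct.induction_on with
    | zero => rw [zero_smul, zero_smul, map_zero]
    | add y z hy hz => rw [add_smul, add_smul, map_add, hy, hz]
    | tmul b a => rw [tmul_smul, tmul_smul, hg, map_smul]

theorem finite_Q_of_finite [Module.Finite Fq L] [Module.Finite (L ⊗[Fq] Q) F.V] :
    Module.Finite Q F.V := by
  let _ : Algebra Q (L ⊗[Fq] Q) := Algebra.TensorProduct.rightAlgebra
  have : IsScalarTower Q (L ⊗[Fq] Q) F.V := ⟨fun a b x ↦ by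
    rw [Algebra.smul_def, mul_smul]; rfl⟩
  have : Module.Finite Q (L ⊗[Fq] Q) := Module.Finite.equiv
    (Algebra.TensorProduct.commRight Fq Q L).toLinearEquiv
  exact Module.Finite.trans (L ⊗[Fq] Q) F.V

theorem bijective_of_injective_of_isLocallyFree [Module.Finite Fq L] {r : ℕ}
    (hF : F.IsLocallyFree r) (hF' : F'.IsLocallyFree r) {f : F.V →ₗ[Q] F'.V}
    (hf : Function.Injective f) : Function.Bijective f := by
  have := hF.free
  have := hF.finite
  have := hF'.free
  have := hF'.finite
  have : Module.Finite Q F.V := finite_Q_of_finite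
  have : Module.Finite Q F'.V := finite_Q_of_finite
  let ε : F.V ≃ₗ[L ⊗[Fq] Q] F'.V := LinearEquiv.ofFinrankEq _ _ (hF.rank.trans hF'.rank.symm)
  have hfinrank : Module.finrank Q F.V = Module.finrank Q F'.V :=
    (LinearEquiv.ofBijective (toQLin ε.toLinearMap) ε.bijective).finrank_eq
  exact ⟨hf, (LinearMap.injective_iff_surjective_of_finrank_eq_finrank hfinrank).1 hf⟩

section Denominators

variable {R : Subalgebra Fq Q} {S : Submonoid R}

theorem exists_mul_mem_ext (hS : ∀ a : Q, ∃ s ∈ S, (s : Q) * a ∈ R) (z : L ⊗[Fq] Q) :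
    ∃ s ∈ S, (1 ⊗ₜ[Fq] (s : Q)) * z ∈ ext L R := by
  induction z using TensorProduct.induction_on with
  | zero => exact ⟨1, S.one_mem, by rw [mul_zero]; exact zero_mem _⟩
  | tmul b a =>
    obtain ⟨s, hs, hsa⟩ := hS a
    exact ⟨s, hs, b ⊗ₜ ⟨s * a, hsa⟩, by simp⟩
  | add y z hy hz =>
    obtain ⟨s, hs, hy⟩ := hy
    obtain ⟨t, ht, hz⟩ := hz
    refine ⟨s * t, S.mul_mem hs ht, ?_⟩
    have h : (1 : L) ⊗ₜ[Fq] ((s * t : R) : Q) = 1 ⊗ₜ (s : Q) * 1 ⊗ₜ (t : Q) := by simp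
    rw [mul_add, h]
    refine add_mem ?_ ?_
    · rw [mul_comm (1 ⊗ₜ[Fq] (s : Q)), mul_assoc]
      exact mul_mem (one_tmul_mem_ext L R t) hy
    · rw [mul_assoc]
      exact mul_mem (one_tmul_mem_ext L R s) hz

variable {N : Submodule (ext L R) F.V} {N' : Submodule (ext L R) F'.V}

theorem exists_smul_mem (hS : ∀ a : Q, ∃ s ∈ S, (s : Q) * a ∈ R)
    (hN : Submodule.span (L ⊗[Fq] Q) (N : Set F.V) = ⊤) (y : F.V) : ∃ s ∈ S, s • y ∈ N := by
  have hy : y ∈ Submodule.span (L ⊗[Fq] Q) (N : Set F.V) := hN ▸ Submodule.mem_top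
  induction hy using Submodule.span_induction with
  | mem z hz => exact ⟨1, S.one_mem, by rwa [one_smul]⟩
  | zero => exact ⟨1, S.one_mem, by rw [smul_zero]; exact N.zero_mem⟩
  | add y z _ _ hy hz =>
    obtain ⟨s, hs, hy⟩ := hy
    obtain ⟨t, ht, hz⟩ := hz
    refine ⟨s * t, S.mul_mem hs ht, ?_⟩
    rw [smul_add, mul_smul s t z, mul_comm, mul_smul]
    exact N.add_mem (N.smul_of_tower_mem t hy) (N.smul_of_tower_mem s hz)
  | smul z y _ hy =>
    obtain ⟨s, hs, hy⟩ := hy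
    obtain ⟨t, ht, hz⟩ := exists_mul_mem_ext hS z
    refine ⟨t * s, S.mul_mem ht hs, ?_⟩
    have h : (t * s) • z • y = ((1 ⊗ₜ[Fq] (t : Q)) * z) • s • y := by
      rw [mul_smul, Subalgebra.smul_def s, Subalgebra.smul_def s, ← smul_comm z, mul_smul]
      rfl
    rw [h]
    exact N.smul_mem ⟨_, hz⟩ hy

theorem exists_forall_smul_mem (hS : ∀ a : Q, ∃ s ∈ S, (s : Q) * a ∈ R) (hN : N.FG)
    (hN' : Submodule.span (L ⊗[Fq] Q) (N' : Set F'.V) = ⊤) (f : F.V →ₗ[L ⊗[Fq] Q] F'.V) :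
    ∃ s ∈ S, ∀ x ∈ N, s • f x ∈ N' := by
  induction N, hN using Submodule.fg_induction with
  | singleton x =>
    obtain ⟨s, hs, hx⟩ := exists_smul_mem hS hN' (f x)
    refine ⟨s, hs, fun z hz ↦ ?_⟩
    obtain ⟨c, rfl⟩ := Submodule.mem_span_singleton.1 hz
    have h : s • f (c • x) = c • s • f x := by
      change (s : Q) • f ((c : L ⊗[Fq] Q) • x) = (c : L ⊗[Fq] Q) • (s : Q) • f x
      rw [map_smul, smul_comm (c : L ⊗[Fq] Q)]
    rw [h]
    exact N'.smul_mem c hx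
  | sup N₁ N₂ _ _ h₁ h₂ =>
    obtain ⟨s, hs, h₁⟩ := h₁
    obtain ⟨t, ht, h₂⟩ := h₂
    refine ⟨s * t, S.mul_mem hs ht, fun x hx ↦ ?_⟩
    obtain ⟨y, hy, z, hz, rfl⟩ := Submodule.mem_sup.1 hx
    rw [map_add, smul_add, mul_smul s t (f z), mul_comm, mul_smul]
    exact N'.add_mem (N'.smul_of_tower_mem t (h₁ y hy)) (N'.smul_of_tower_mem s (h₂ z hz))

end Denominators

variable {r r' : ℕ}

theorem exists_nonZeroDivisors_mul_mem (a : Q) : ∃ b ∈ nonZeroDivisors C.A, (b : Q) * a ∈ C.A := by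
  simpa only [mem_nonZeroDivisors_iff_ne_zero] using (exists_pole C a).1

theorem exists_smul_mem_aff (hF : F.IsLocallyFree r) (hF' : F'.IsLocallyFree r')
    (f : F.V →ₗ[L ⊗[Fq] Q] F'.V) : ∃ a : C.A, a ≠ 0 ∧ ∀ x ∈ F.aff, (a : Q) • f x ∈ F'.aff := by
  obtain ⟨a, ha, h⟩ := exists_forall_smul_mem exists_nonZeroDivisors_mul_mem
    (Module.Finite.iff_fg.1 hF.finite_aff) hF'.span_aff f
  exact ⟨a, nonZeroDivisors.ne_zero ha, h⟩

theorem exists_pow_smul_mem_inf (hF : F.IsLocallyFree r) (hF' : F'.IsLocallyFree r') {ϖ : C.O}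
    (hϖ : Irreducible ϖ) (f : F.V →ₗ[L ⊗[Fq] Q] F'.V) :
    ∃ n : ℕ, ∀ x ∈ F.inf, (ϖ : Q) ^ n • f x ∈ F'.inf := by
  have hS (a : Q) : ∃ s ∈ Submonoid.powers ϖ, (s : Q) * a ∈ C.O := by
    obtain ⟨n, hn⟩ := (exists_pole C a).2
    exact ⟨ϖ ^ n, ⟨n, rfl⟩, hn _ (Ideal.pow_mem_pow
      ((IsLocalRing.mem_maximalIdeal _).2 hϖ.not_isUnit) n)⟩
  obtain ⟨_, ⟨n, rfl⟩, h⟩ := exists_forall_smul_mem hS (Module.Finite.iff_fg.1 hF.finite_inf)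
    hF'.span_inf f
  exact ⟨n, h⟩

theorem mem_idealInf_pow_smul {ϖ : C.O} (hϖ : Irreducible ϖ) (k : ℕ) (x : F.V) :
    x ∈ (C.idealInf L) ^ k • F.inf ↔ ∃ y ∈ F.inf, (ϖ : Q) ^ k • y = x := by
  rw [PointedCurve.idealInf, hϖ.maximalIdeal_eq, Ideal.map_span, Set.image_singleton,
    Ideal.span_singleton_pow, Submodule.ideal_span_singleton_smul,
    Submodule.mem_smul_pointwise_iff_exists, ← map_pow]
  rfl

end LatticeSheaf

theorem exists_int_sequence {X : ℤ → Type*} (E : ∀ i, X i ≃ X (i + 1)) (x₀ : X 0) :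
    ∃ s : ∀ i, X i, s 0 = x₀ ∧ ∀ i, s (i + 1) = E i (s i) := by
  let forward (n : ℕ) : X (Int.ofNat n) := Nat.rec x₀ (fun n x ↦ E (Int.ofNat n) x) n
  let backward (n : ℕ) : X (Int.negSucc n) :=
    Nat.rec ((E (Int.negSucc 0)).symm x₀) (fun n x ↦ (E (Int.negSucc (n + 1))).symm x) n
  refine ⟨fun i ↦ match i with
    | Int.ofNat n => forward n
    | Int.negSucc n => backward n, rfl, fun i ↦ ?_⟩
  match i with
  | Int.ofNat n => rfl
  | Int.negSucc 0 => exact ((E (Int.negSucc 0)).apply_symm_apply x₀).symm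
  | Int.negSucc (n + 1) => exact ((E (Int.negSucc (n + 1))).apply_symm_apply (backward n)).symm

namespace AbelianTauSheaf

variable {Fq Q : Type*} [Field Fq] [Fintype Fq] [Field Q] [Algebra Fq Q] {C : PointedCurve Fq Q}
variable {L : Type*} [Field L] [Algebra Fq L] [Finite L] {c : Characteristic C L}
variable (F F' : AbelianTauSheaf.{w} C c)

section GenericFibre

theorem finite_Q (i : ℤ) : Module.Finite Q (F.F i).V := by
  have := (F.isLocallyFree i).finite
  have : Module.Finite Fq L := Module.Finite.of_finite
  exact finite_Q_of_finite

theorem bijective_Pi (i : ℤ) : Function.Bijective (F.Pi i) := by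
  have : Module.Finite Fq L := Module.Finite.of_finite
  exact bijective_of_injective_of_isLocallyFree (F.isLocallyFree i) (F.isLocallyFree (i + 1))
    (f := toQLin (F.Pi i)) (F.injective_Pi i)

/-- `Π_i` as an isomorphism of generic fibres. -/
noncomputable def PiEquiv (i : ℤ) : (F.F i).V ≃ₗ[L ⊗[Fq] Q] (F.F (i + 1)).V :=
  LinearEquiv.ofBijective (F.Pi i) (F.bijective_Pi i)

theorem forall_of_iff_Pi {P : ∀ i, (F.F i).V → Prop} (h0 : ∀ x, P 0 x)
    (h : ∀ i x, P i x ↔ P (i + 1) (F.Pi i x)) (i : ℤ) (x : (F.F i).V) : P i x := by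
  have hperiodic : Function.Periodic (fun i ↦ ∀ x, P i x) 1 := fun i ↦ propext <| by
    change (∀ x, P (i + 1) x) ↔ ∀ x, P i x
    rw [(F.bijective_Pi i).2.forall]
    exact forall_congr' fun x ↦ (h i x).symm
  have := hperiodic.int_mul_eq i
  rw [mul_one, eq_iff_iff] at this
  exact this.2 h0 x

theorem exists_trivialization :
    ∃ e : ∀ i, (F.F i).V ≃ₗ[L ⊗[Fq] Q] (F.F 0).V, e 0 = LinearEquiv.refl _ _ ∧
      ∀ i x, e (i + 1) (F.Pi i x) = e i x := by
  obtain ⟨e, he0, he⟩ := exists_int_sequence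
    (X := fun i ↦ (F.F i).V ≃ₗ[L ⊗[Fq] Q] (F.F 0).V) (fun i ↦
      { toFun := fun e ↦ (F.PiEquiv i).symm.trans e
        invFun := fun e ↦ (F.PiEquiv i).trans e
        left_inv := fun e ↦ by ext x; simp
        right_inv := fun e ↦ by ext x; simp }) (LinearEquiv.refl _ _)
  refine ⟨e, he0, fun i x ↦ ?_⟩
  rw [he]
  exact congrArg (e i) ((F.PiEquiv i).symm_apply_apply x)

/-- The identification of the generic fibres `V_i` and `V_0` by means of the maps `Π_j`. -/
noncomputable def trivialization (i : ℤ) : (F.F i).V ≃ₗ[L ⊗[Fq] Q] (F.F 0).V :=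
  F.exists_trivialization.choose i

theorem trivialization_zero : F.trivialization 0 = LinearEquiv.refl _ _ :=
  F.exists_trivialization.choose_spec.1

theorem trivialization_Pi (i : ℤ) (x : (F.F i).V) :
    F.trivialization (i + 1) (F.Pi i x) = F.trivialization i x :=
  F.exists_trivialization.choose_spec.2 i x

theorem trivialization_iterPi (i : ℤ) (n : ℕ) (x : (F.F i).V) :
    F.trivialization (i + n) (iterPi F.F F.Pi i n x) = F.trivialization i x := by
  have hcast {i j : ℤ} (h : i = j) (x : (F.F i).V) :
      F.trivialization j (castLin F.F h x) = F.trivialization i x := by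
    subst h
    rfl
  induction n with
  | zero => exact hcast _ x
  | succ n ih => exact (hcast _ _).trans ((F.trivialization_Pi _ _).trans ih)

/-- The map `φ = Π_0⁻¹ ∘ τ_0` on the generic fibre `V_0`. -/
noncomputable def phi : Module.End Q (F.F 0).V where
  toFun x := (F.PiEquiv 0).symm (F.tau 0 x)
  map_add' x y := by rw [map_add, map_add]
  map_smul' a x := by
    rw [smul_Q_def, LinearMap.map_smulₛₗ, sigma_tmul, map_one, map_smul]
    rfl

theorem Pi_phi (x : (F.F 0).V) : F.Pi 0 (F.phi x) = F.tau 0 x :=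
  (F.PiEquiv 0).apply_symm_apply _

theorem phi_smul_L (b : L) (x : (F.F 0).V) : F.phi (b • x) = frobL Fq L b • F.phi x := by
  apply F.injective_Pi 0
  rw [Pi_phi, map_smul_L (F.Pi 0), Pi_phi, smul_L_def,
    LinearMap.map_smulₛₗ, sigma_tmul, ← smul_L_def]

theorem phi_bijective : Function.Bijective F.phi := by
  have := F.finite_Q 0
  have h : Function.Injective F.phi := (F.PiEquiv 0).symm.injective.comp (F.injective_tau 0)
  exact ⟨h, LinearMap.injective_iff_surjective.1 h⟩

theorem trivialization_tau (i : ℤ) (x : (F.F i).V) :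
    F.trivialization (i + 1) (F.tau i x) = F.phi (F.trivialization i x) := by
  refine F.forall_of_iff_Pi (P := fun i x ↦
    F.trivialization (i + 1) (F.tau i x) = F.phi (F.trivialization i x)) (fun x ↦ ?_)
    (fun i x ↦ ?_) i x
  · rw [← Pi_phi, trivialization_Pi, trivialization_zero]
    rfl
  · simp only [trivialization_Pi, ← F.comm]

theorem Pi_mem_aff_iff (i : ℤ) (x : (F.F i).V) :
    F.Pi i x ∈ (F.F (i + 1)).aff ↔ x ∈ (F.F i).aff := by
  refine ⟨fun h ↦ ?_, fun h ↦ (F.mapsSections_Pi i).1 h⟩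
  obtain ⟨y, hy, hyx⟩ := F.surjOn_Pi i h
  rwa [← F.injective_Pi i hyx]

theorem trivialization_mem_aff_iff (i : ℤ) (x : (F.F i).V) :
    F.trivialization i x ∈ (F.F 0).aff ↔ x ∈ (F.F i).aff := by
  refine F.forall_of_iff_Pi (P := fun i x ↦
    F.trivialization i x ∈ (F.F 0).aff ↔ x ∈ (F.F i).aff) (fun x ↦ ?_) (fun i x ↦ ?_) i x
  · rw [trivialization_zero]
    rfl
  · simp only [trivialization_Pi, Pi_mem_aff_iff]

end GenericFibre

section InfinityLattice

/-- The `O_L`-lattice of germs of `F_i` along `∞`, transported to the common generic fibre `V_0`. -/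
noncomputable def infLattice (i : ℤ) : Submodule (C.OL L) (F.F 0).V :=
  (F.F i).inf.comap ((F.trivialization i).symm.toLinearMap.restrictScalars (C.OL L))

theorem mem_infLattice {i : ℤ} {x : (F.F 0).V} :
    x ∈ F.infLattice i ↔ (F.trivialization i).symm x ∈ (F.F i).inf :=
  Iff.rfl

theorem trivialization_mem_infLattice {i : ℤ} {x : (F.F i).V} :
    F.trivialization i x ∈ F.infLattice i ↔ x ∈ (F.F i).inf := by
  rw [mem_infLattice, LinearEquiv.symm_apply_apply]

variable {ϖ : C.O} (hϖ : Irreducible ϖ)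

/-- Near `∞`, the sheaf `F_{i + p}` is `F_i(K · ∞)` for all `i`. -/
def IsInfPeriod (ϖ : C.O) (p K : ℕ) : Prop :=
  ∀ (i : ℤ) x, x ∈ F.infLattice (i + p) ↔ (ϖ : Q) ^ K • x ∈ F.infLattice i

variable {F} in
theorem IsInfPeriod.mul {p K : ℕ} (h : F.IsInfPeriod ϖ p K) (m : ℕ) :
    F.IsInfPeriod ϖ (m * p) (m * K) := by
  intro i x
  induction m generalizing x with
  | zero => simp
  | succ m ih =>
    have hi : i + ((m + 1) * p : ℕ) = i + (m * p : ℕ) + p := by push_cast; ring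
    rw [hi, h, ih, smul_smul, ← pow_add, Nat.succ_mul]

include hϖ in
theorem exists_isInfPeriod :
    ∃ k l : ℕ, 0 < k ∧ 0 < l ∧ l * F.d = k * F.r ∧ F.IsInfPeriod ϖ l k := by
  obtain ⟨k, l, hk, hl, hkl, hper⟩ := F.periodic
  refine ⟨k, l, hk, hl, hkl, fun i x ↦ ?_⟩
  have hϖk : (ϖ : Q) ^ k ≠ 0 := pow_ne_zero _ (by simpa using hϖ.ne_zero)
  rw [mem_infLattice, mem_infLattice]
  have hmem (y : (F.F (i + l)).V) : y ∈ (F.F (i + l)).inf ↔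
      (ϖ : Q) ^ k • y ∈ (C.idealInf L) ^ k • (F.F (i + l)).inf := by
    rw [mem_idealInf_pow_smul hϖ]
    exact ⟨fun hy ↦ ⟨y, hy, rfl⟩, fun ⟨z, hz, hzy⟩ ↦ smul_right_injective _ hϖk hzy ▸ hz⟩
  have hiter (z : (F.F i).V) : iterPi F.F F.Pi i l z =
      (F.trivialization (i + l)).symm (F.trivialization i z) := by
    rw [LinearEquiv.eq_symm_apply, trivialization_iterPi]
  rw [hmem, ← (hper i).2, ← map_smul_Q]
  constructor
  · rintro ⟨z, hz, hzx⟩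
    rw [LinearMap.restrictScalars_apply, hiter, EmbeddingLike.apply_eq_iff_eq] at hzx
    rwa [← hzx, LinearEquiv.symm_apply_apply]
  · refine fun hx ↦ ⟨_, hx, ?_⟩
    rw [LinearMap.restrictScalars_apply, hiter, LinearEquiv.apply_symm_apply]

theorem weight_eq_div {k l : ℕ} (hl : 0 < l) (h : l * F.d = k * F.r) (hr : F.r ≠ 0) :
    F.weight = k / l := by
  rw [weight, if_neg hr, div_eq_div_iff (by exact_mod_cast hr) (by exact_mod_cast hl.ne'), mul_comm]
  exact_mod_cast h

variable {F F'}

include hϖ in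
theorem exists_common_isInfPeriod (hweight : F.weight = F'.weight) (hr : F.r ≠ 0) :
    ∃ p K : ℕ, 0 < p ∧ F.IsInfPeriod ϖ p K ∧ F'.IsInfPeriod ϖ p K := by
  obtain ⟨k, l, hk, hl, hkl, hper⟩ := F.exists_isInfPeriod hϖ
  obtain ⟨k', l', -, hl', hkl', hper'⟩ := F'.exists_isInfPeriod hϖ
  have hw := F.weight_eq_div hl hkl hr
  have hr' : F'.r ≠ 0 := by
    intro hr'
    rw [hweight, weight, if_pos hr'] at hw
    have : (0 : ℚ) < k / l := by positivity
    exact this.ne hw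
  have hK : l' * k = l * k' := by
    rw [hweight, F'.weight_eq_div hl' hkl' hr', div_eq_div_iff (by exact_mod_cast hl'.ne')
      (by exact_mod_cast hl.ne')] at hw
    have : k' * l = k * l' := by exact_mod_cast hw
    linarith
  refine ⟨l' * l, l' * k, by positivity, hper.mul l', ?_⟩
  rw [hK, mul_comm l']
  exact hper'.mul l

/-- Near `∞`, the map `g` of generic fibres defines a map `F_i → F'_i(n · ∞)`. -/
def HasPoleOrderLE (F F' : AbelianTauSheaf.{w} C c) (ϖ : C.O)
    (g : (F.F 0).V →ₗ[L ⊗[Fq] Q] (F'.F 0).V) (n : ℕ) (i : ℤ) : Prop :=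
  ∀ x ∈ F.infLattice i, (ϖ : Q) ^ n • g x ∈ F'.infLattice i

variable {g : (F.F 0).V →ₗ[L ⊗[Fq] Q] (F'.F 0).V} {n : ℕ} {i : ℤ}

theorem HasPoleOrderLE.mono {m : ℕ} (h : HasPoleOrderLE F F' ϖ g m i) (hmn : m ≤ n) :
    HasPoleOrderLE F F' ϖ g n i := by
  intro x hx
  obtain ⟨t, rfl⟩ := Nat.exists_eq_add_of_le' hmn
  rw [pow_add, mul_smul]
  exact (F'.infLattice i).smul_mem (toExt L C.O (ϖ ^ t)) (h x hx)

include hϖ in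
theorem exists_hasPoleOrderLE (g : (F.F 0).V →ₗ[L ⊗[Fq] Q] (F'.F 0).V) (i : ℤ) :
    ∃ n, HasPoleOrderLE F F' ϖ g n i := by
  obtain ⟨n, hn⟩ := exists_pow_smul_mem_inf (F.isLocallyFree i) (F'.isLocallyFree i) hϖ
    ((F'.trivialization i).symm.toLinearMap ∘ₗ g ∘ₗ (F.trivialization i).toLinearMap)
  refine ⟨n, fun x hx ↦ ?_⟩
  have := hn _ hx
  rw [mem_infLattice, map_smul_Q]
  simpa using this

include hϖ in
theorem periodic_hasPoleOrderLE {p K : ℕ} (h : F.IsInfPeriod ϖ p K) (h' : F'.IsInfPeriod ϖ p K) :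
    Function.Periodic (HasPoleOrderLE F F' ϖ g n) p := by
  have hϖK : (ϖ : Q) ^ K ≠ 0 := pow_ne_zero _ (by simpa using hϖ.ne_zero)
  refine fun i ↦ propext ⟨fun hg x hx ↦ ?_, fun hg x hx ↦ ?_⟩
  · have := hg (((ϖ : Q) ^ K)⁻¹ • x) (by rwa [h, smul_inv_smul₀ hϖK])
    rwa [h', map_smul_Q, smul_comm, smul_inv_smul₀ hϖK] at this
  · rw [h', smul_comm, ← map_smul_Q]
    exact hg _ ((h i x).1 hx)

theorem subsingleton_of_rank_eq_zero (hr : F.r = 0) (i : ℤ) : Subsingleton (F.F i).V := by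
  have h := F.isLocallyFree i
  have := h.free
  have := h.finite
  exact (Module.finrank_eq_zero_iff_of_free (L ⊗[Fq] Q) _).1 (h.rank.trans hr)

include hϖ in
/-- Equality of the weights gives both sheaves a common period with the same shift at `∞`, so that
only finitely many `i` have to be considered. -/
theorem exists_forall_hasPoleOrderLE (hweight : F.weight = F'.weight)
    (g : (F.F 0).V →ₗ[L ⊗[Fq] Q] (F'.F 0).V) : ∃ n, ∀ i, HasPoleOrderLE F F' ϖ g n i := by
  by_cases hr : F.r = 0
  · have := F.subsingleton_of_rank_eq_zero hr 0
    refine ⟨0, fun i x _ ↦ ?_⟩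
    rw [Subsingleton.elim x 0, map_zero, smul_zero]
    exact Submodule.zero_mem _
  obtain ⟨p, K, hp, hF, hF'⟩ := exists_common_isInfPeriod hϖ hweight hr
  choose N hN using exists_hasPoleOrderLE hϖ g
  refine ⟨(Finset.range p).sup fun j ↦ N j, fun i ↦ ?_⟩
  have hi : HasPoleOrderLE F F' ϖ g ((Finset.range p).sup fun j ↦ N j) (i % p) := by
    refine (hN _).mono ?_
    lift i % p to ℕ using Int.emod_nonneg i (by positivity) with j hj
    refine Finset.le_sup (f := fun j : ℕ ↦ N j) (Finset.mem_range.2 ?_)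
    have := Int.emod_lt_of_pos i (b := p) (by positivity)
    omega
  have hperiodic (n : ℕ) : Function.Periodic (HasPoleOrderLE F F' ϖ g n) p :=
    periodic_hasPoleOrderLE hϖ hF hF'
  have hsub := (hperiodic ((Finset.range p).sup fun j ↦ N j)).sub_int_mul_eq (x := i) (i / p)
  rwa [Int.emod_def, mul_comm, ← Int.cast_id (n := i / p), hsub] at hi

end InfinityLattice

section QuasiMorphisms

variable {F F'}

theorem trivialization_of_mem_QHom {f : ∀ i, (F.F i).V →ₗ[L ⊗[Fq] Q] (F'.F i).V}
    (hf : f ∈ QHom F F') (i : ℤ) (x : (F.F i).V) :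
    F'.trivialization i (f i x) = f 0 (F.trivialization i x) := by
  obtain ⟨D, -, hPi, -⟩ := hf
  refine F.forall_of_iff_Pi (P := fun i x ↦
    F'.trivialization i (f i x) = f 0 (F.trivialization i x)) (fun x ↦ ?_) (fun i x ↦ ?_) i x
  · rw [trivialization_zero, trivialization_zero]
    rfl
  · simp only [hPi, trivialization_Pi]

theorem toQLin_mem_linearIntertwiners {f : ∀ i, (F.F i).V →ₗ[L ⊗[Fq] Q] (F'.F i).V}
    (hf : f ∈ QHom F F') : toQLin (f 0) ∈ linearIntertwiners L F.phi F'.phi := by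
  obtain ⟨D, -, hPi, htau⟩ := hf
  refine ⟨mem_intertwiners.2 fun x ↦ F'.injective_Pi 0 ?_, map_smul_L (f 0)⟩
  rw [Pi_phi]
  change F'.Pi 0 (f 0 (F.phi x)) = F'.tau 0 (f 0 x)
  rw [← hPi, Pi_phi, htau]

variable (F F') in
/-- The family of maps `F_i → F'_i` of generic fibres which all correspond to `g`. -/
noncomputable def transport (g : (F.F 0).V →ₗ[L ⊗[Fq] Q] (F'.F 0).V) (i : ℤ) :
    (F.F i).V →ₗ[L ⊗[Fq] Q] (F'.F i).V :=
  (F'.trivialization i).symm.toLinearMap ∘ₗ g ∘ₗ (F.trivialization i).toLinearMap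

theorem trivialization_transport (g : (F.F 0).V →ₗ[L ⊗[Fq] Q] (F'.F 0).V) (i : ℤ)
    (x : (F.F i).V) :
    F'.trivialization i (transport F F' g i x) = g (F.trivialization i x) :=
  (F'.trivialization i).apply_symm_apply _

theorem exists_forall_mapsSections_transport (hweight : F.weight = F'.weight)
    (g : (F.F 0).V →ₗ[L ⊗[Fq] Q] (F'.F 0).V) : ∃ D : EffectiveDivisor C, ∀ i,
      MapsSections (F.F i) ((F'.F i).twist D) (transport F F' g i) := by
  obtain ⟨ϖ, hϖ⟩ := IsDiscreteValuationRing.exists_irreducible C.O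
  obtain ⟨n, hn⟩ := exists_forall_hasPoleOrderLE hϖ hweight g
  obtain ⟨a, ha0, ha⟩ := exists_smul_mem_aff (F.isLocallyFree 0) (F'.isLocallyFree 0) g
  refine ⟨⟨Ideal.span {a}, fun h ↦ ha0 (Ideal.span_singleton_eq_bot.1 h), n⟩,
    fun i ↦ ⟨fun x hx y (hy : y ∈ Ideal.span {a}) ↦ ?_,
      fun x hx y (hy : y ∈ IsLocalRing.maximalIdeal C.O ^ n) ↦ ?_⟩⟩
  · obtain ⟨b, rfl⟩ := Ideal.mem_span_singleton'.1 hy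
    rw [map_mul, mul_smul]
    refine (F'.F i).aff.smul_mem _ ?_
    rw [← trivialization_mem_aff_iff, toExt_smul, map_smul_Q, trivialization_transport]
    exact ha _ ((F.trivialization_mem_aff_iff i x).2 hx)
  · rw [hϖ.maximalIdeal_eq, Ideal.span_singleton_pow] at hy
    obtain ⟨b, rfl⟩ := Ideal.mem_span_singleton'.1 hy
    rw [map_mul, mul_smul]
    refine (F'.F i).inf.smul_mem _ ?_
    rw [← trivialization_mem_infLattice, toExt_smul, map_smul_Q, trivialization_transport]
    exact hn i _ (F.trivialization_mem_infLattice.2 hx)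

theorem transport_mem_QHom (hweight : F.weight = F'.weight)
    {g : (F.F 0).V →ₗ[L ⊗[Fq] Q] (F'.F 0).V} (hg : ∀ x, g (F.phi x) = F'.phi (g x)) :
    transport F F' g ∈ QHom F F' := by
  obtain ⟨D, hD⟩ := exists_forall_mapsSections_transport hweight g
  refine ⟨D, hD, fun i x ↦ ?_, fun i x ↦ ?_⟩ <;> apply (F'.trivialization (i + 1)).injective
  · simp only [trivialization_transport, trivialization_Pi]
  · simp only [trivialization_transport, trivialization_tau, hg]

variable (F F') in
/-- The restriction of quasi-morphisms to the generic fibre `V_0`. -/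
def toLinearIntertwiners : QHom F F' →ₗ[Q] linearIntertwiners L F.phi F'.phi where
  toFun f := ⟨toQLin (f.1 0), toQLin_mem_linearIntertwiners f.2⟩
  map_add' _ _ := rfl
  map_smul' _ _ := rfl

theorem toLinearIntertwiners_bijective (hweight : F.weight = F'.weight) :
    Function.Bijective (toLinearIntertwiners F F') := by
  have happly (f : QHom F F') (x) : (toLinearIntertwiners F F' f).1 x = f.1 0 x := rfl
  constructor
  · intro f f' hff'
    refine Subtype.ext (funext fun i ↦ LinearMap.ext fun x ↦ (F'.trivialization i).injective ?_)
    rw [trivialization_of_mem_QHom f.2, trivialization_of_mem_QHom f'.2, ← happly, hff', happly]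
  · intro g
    refine ⟨⟨transport F F' (ofQLin g.1 g.2.2),
      transport_mem_QHom hweight (mem_intertwiners.1 g.2.1)⟩,
      Subtype.ext (LinearMap.ext fun x ↦ ?_)⟩
    change (F'.trivialization 0).symm (g.1 (F.trivialization 0 x)) = g.1 x
    rw [trivialization_zero, trivialization_zero]
    rfl

theorem rank_QHom (hweight : F.weight = F'.weight) :
    Module.rank Q (QHom F F') = Module.finrank Q (linearIntertwiners L F.phi F'.phi) := by
  have := F.finite_Q 0
  have := F'.finite_Q 0
  rw [(LinearEquiv.ofBijective _ (toLinearIntertwiners_bijective hweight)).rank_eq,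
    Module.finrank_eq_rank]

end QuasiMorphisms

end AbelianTauSheaf

/-! ## The finite levels of the Tate module -/

section SpanningSemilinearMaps

open Module

variable {k k' P P' : Type*} [Field k] [Field k'] [AddCommGroup P] [AddCommGroup P'] [Module k P]
  [Module k' P'] {σ : k →+* k'} (f : P →ₛₗ[σ] P')

theorem span_image_basis_eq_top (hf : Submodule.span k' (Set.range f) = ⊤) {ι : Type*}
    [Finite ι] (b : Basis ι k P) : Submodule.span k' (Set.range (f ∘ b)) = ⊤ := by
  have := Fintype.ofFinite ι
  refine top_unique (hf.ge.trans (Submodule.span_le.2 ?_))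
  rintro _ ⟨x, rfl⟩
  rw [SetLike.mem_coe, ← b.sum_repr x, map_sum]
  simp only [map_smulₛₗ]
  exact sum_mem fun i _ ↦ Submodule.smul_mem _ _ (Submodule.subset_span ⟨i, rfl⟩)

variable [FiniteDimensional k P]

theorem finiteDimensional_of_span_range_eq_top (hf : Submodule.span k' (Set.range f) = ⊤) :
    FiniteDimensional k' P' :=
  .of_fg_top (span_image_basis_eq_top f hf (finBasis k P) ▸
    Submodule.fg_span (Set.finite_range _))

theorem finrank_le_of_span_range_eq_top (hf : Submodule.span k' (Set.range f) = ⊤) :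
    finrank k' P' ≤ finrank k P := by
  rw [← finrank_top, ← span_image_basis_eq_top f hf (finBasis k P)]
  exact (finrank_range_le_card _).trans_eq (Fintype.card_fin _)

theorem injective_of_span_range_eq_top (hf : Submodule.span k' (Set.range f) = ⊤)
    (hfinrank : finrank k P = finrank k' P') : Function.Injective f := by
  have hli := linearIndependent_of_top_le_span_of_card_eq_finrank
    (span_image_basis_eq_top f hf (finBasis k P)).ge ((Fintype.card_fin _).trans hfinrank)
  refine (injective_iff_map_eq_zero f).2 fun x hx ↦ ?_
  rw [← (finBasis k P).sum_repr x] at hx ⊢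
  simp only [map_sum, map_smulₛₗ] at hx
  have hcoord := Fintype.linearIndependent_iff.1 hli _ hx
  simp only [map_eq_zero] at hcoord
  simp only [hcoord, zero_smul, Finset.sum_const_zero]

theorem injective_of_span_range_eq_top_of_surjective {σ : k →+* k} (φ : P →ₛₗ[σ] P) {X : Type*}
    {j : X → P} (hj : Submodule.span k (Set.range j) = ⊤) {τ : X → X} (hτ : Function.Surjective τ)
    (hφj : ∀ x, φ (j x) = j (τ x)) : Function.Injective φ := by
  refine injective_of_span_range_eq_top φ (top_unique (hj.ge.trans (Submodule.span_mono ?_))) rfl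
  rintro _ ⟨y, rfl⟩
  obtain ⟨x, rfl⟩ := hτ y
  exact ⟨j x, hφj x⟩

end SpanningSemilinearMaps

section FiniteLevel

open Module

variable {A X P F L k : Type*} [CommRing A] [AddCommGroup X] [Module A X] [AddCommGroup P]
  [Module A P] [Field F] [Fintype F] [Field L] [Fintype L] [Algebra F L] [Field k] [Algebra F k]
  [Algebra L k] [Module L X] [Module k P] [IsSepClosed k] [Algebra.IsAlgebraic L k] [Finite X]
  [FiniteDimensional k P] {j : X →ₗ[A] P} {ψ : P →ₛₗ[frobL L k] P}

/-- Galois descent for the extension `j` of scalars from `L` to `k`; surjectivity holds because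
`ψ` has at most as many fixed points as `X` has elements. -/
theorem exists_equiv_fixedSubmodule
    (hψ : ∀ (a : A) x, ψ (a • x) = a • ψ x) (hj : ∀ (b : L) x, j (b • x) = algebraMap L k b • j x)
    (hj_span : Submodule.span k (Set.range j) = ⊤) (hj_inj : Function.Injective j)
    (hψj : ∀ x, ψ (j x) = j x) :
    ∃ E : X ≃ₗ[A] fixedSubmodule A ψ hψ, ∀ x, (E x : P) = j x := by
  have : FiniteDimensional L X := .of_finite
  let jL : X →ₛₗ[algebraMap L k] P := { j with map_smul' := hj }
  have card_fix : Nat.card (fixedSubmodule A ψ hψ) = Fintype.card L ^ finrank k P :=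
    natCard_setOf_map_eq
      (injective_of_span_range_eq_top_of_surjective ψ hj_span Function.surjective_id hψj)
  have : Finite (fixedSubmodule A ψ hψ) := Nat.finite_of_card_ne_zero (card_fix.trans_ne (by simp))
  let E : X →ₗ[A] fixedSubmodule A ψ hψ := j.codRestrict _ hψj
  have hE : Function.Injective E := fun x y hxy ↦ hj_inj (congrArg Subtype.val hxy)
  refine ⟨.ofBijective E ((Nat.bijective_iff_injective_and_card E).2
    ⟨hE, (Nat.card_le_card_of_injective E hE).antisymm ?_⟩), fun _ ↦ rfl⟩
  rw [card_fix, Module.natCard_eq_pow_finrank (K := L) (V := X), Nat.card_eq_fintype_card]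
  exact Nat.pow_le_pow_right Fintype.card_pos (finrank_le_of_span_range_eq_top jL hj_span)

variable [SMulCommClass A k P] [Algebra.IsAlgebraic F k] {φ : P →ₛₗ[frobL F k] P}

theorem exists_equiv_pi_fixedSubmodule (hφ : ∀ (a : A) x, φ (a • x) = a • φ x)
    (hψ : ∀ (a : A) x, ψ (a • x) = a • ψ x) (hj : ∀ (b : L) x, j (b • x) = algebraMap L k b • j x)
    (hj_span : Submodule.span k (Set.range j) = ⊤) (hj_inj : Function.Injective j)
    (hφ_inj : Function.Injective φ) (hψj : ∀ x, ψ (j x) = j x) :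
    ∃ f : X ≃ₗ[A] (Fin (finrank F L) → fixedSubmodule A φ hφ), ∀ (π : X → X) (g : P →ₗ[k] P),
      (∀ y, φ (g y) = g (φ y)) → (∀ y, ψ (g y) = g (ψ y)) → (∀ x, j (π x) = g (j x)) →
      ∀ x i, (f (π x) i : P) = g (f x i) := by
  obtain ⟨E, hE⟩ := exists_equiv_fixedSubmodule hψ hj hj_span hj_inj hψj
  obtain ⟨f, hf⟩ := exists_fixedSubmodule_equiv_pi hφ hψ hφ_inj
    (injective_of_span_range_eq_top_of_surjective ψ hj_span Function.surjective_id hψj)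
  exact ⟨E.trans f, fun π g hφg hψg hπ x i ↦
    hf g hφg hψg (E x) (E (π x)) (by rw [hE, hE, hπ]) i⟩

end FiniteLevel

section QuotientAction

variable {A N N' k k' : Type*} [CommRing A] [AddCommGroup N] [Module A N] [AddCommGroup N']
  [Module A N'] [Field k] [Module k N] [SMulCommClass A k N] [Field k'] [Module k' N']
  [SMulCommClass A k' N'] (J : Ideal A)

/-- The action on `N / J N` induced by an action on `N` of a field `k` that is not assumed to be
an `A`-algebra. -/
@[reducible] noncomputable def quotientModule : Module k (N ⧸ (J • ⊤ : Submodule A N)) :=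
  have : SMulCommClass k A N := .symm _ _ _
  let _ : SMul k (N ⧸ (J • ⊤ : Submodule A N)) :=
    ⟨fun b ↦ (DistribSMul.toLinearMap A N b).reduceModIdeal J⟩
  (Submodule.mkQ_surjective _).module k (Submodule.mkQ (J • ⊤ : Submodule A N)).toAddMonoidHom
    fun _ _ ↦ rfl

attribute [local instance] quotientModule

theorem smulCommClass_quotient : SMulCommClass A k (N ⧸ (J • ⊤ : Submodule A N)) where
  smul_comm a b x := by
    obtain ⟨x, rfl⟩ := Submodule.mkQ_surjective _ x
    exact congrArg (Submodule.mkQ _) (smul_comm a b x)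

variable {σ : k →+* k'} (f : N →ₗ[A] N') (hf : ∀ (b : k) x, f (b • x) = σ b • f x)

/-- The semilinear map `N / J N → N' / J N'` induced by an `A`-linear and `σ`-semilinear `f`. -/
noncomputable def quotientMap :
    (N ⧸ (J • ⊤ : Submodule A N)) →ₛₗ[σ] N' ⧸ (J • ⊤ : Submodule A N') where
  toFun := f.reduceModIdeal J
  map_add' := map_add _
  map_smul' b x := by
    obtain ⟨x, rfl⟩ := Submodule.mkQ_surjective _ x
    exact congrArg (Submodule.mkQ _) (hf b x)

end QuotientAction

theorem finite_linearMap {A M W : Type*} [CommRing A] [AddCommGroup M] [Module A M]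
    [AddCommGroup W] [Module A W] [Module.Finite A M] [Finite W] : Finite (M →ₗ[A] W) := by
  obtain ⟨n, s, hs⟩ := Module.Finite.exists_fin (R := A) (M := M)
  exact .of_injective (fun (f : M →ₗ[A] W) i ↦ f (s i)) fun _ _ hfg ↦
    LinearMap.ext_on_range hs (congrFun hfg)

section Tower

variable {A M N ι : Type*} [CommRing A] [AddCommGroup M] [Module A M] [AddCommGroup N]
  [Module A N] {I : Ideal A} {T : ∀ n, Submodule A (N ⧸ (I ^ n • ⊤ : Submodule A N))}
  (hT : ∀ {m n} (h : m ≤ n), (T n).map (AdicCompletion.transitionMap I N h) = T m)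

variable (ι) in
/-- The transition map from level `n` to level `m` of a tower of submodules
`T n ⊆ N / I ^ n N`, applied to families indexed by `ι`. -/
noncomputable def levelTransition {m n : ℕ} (h : m ≤ n) : (ι → T n) →ₗ[A] (ι → T m) :=
  ((AdicCompletion.transitionMap I N h).restrict fun _ hx ↦ (hT h).le ⟨_, hx, rfl⟩).compLeft ι

theorem coe_levelTransition {m n : ℕ} (h : m ≤ n) (y : ι → T n) (i : ι) :
    (levelTransition ι hT h y i : N ⧸ (I ^ m • ⊤ : Submodule A N)) =
      AdicCompletion.transitionMap I N h (y i) :=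
  rfl

theorem levelTransition_refl {n : ℕ} (y : ι → T n) : levelTransition ι hT le_rfl y = y :=
  funext fun i ↦ Subtype.ext <| by
    obtain ⟨x, hx⟩ := Submodule.mkQ_surjective _ (y i : N ⧸ (I ^ n • ⊤ : Submodule A N))
    rw [coe_levelTransition, ← hx]
    rfl

theorem levelTransition_levelTransition {l m n : ℕ} (h : l ≤ m) (h' : m ≤ n) (y : ι → T n) :
    levelTransition ι hT h (levelTransition ι hT h' y) = levelTransition ι hT (h.trans h') y :=
  funext fun i ↦ Subtype.ext <| by
    obtain ⟨x, hx⟩ := Submodule.mkQ_surjective _ (y i : N ⧸ (I ^ n • ⊤ : Submodule A N))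
    rw [coe_levelTransition, coe_levelTransition, coe_levelTransition, ← hx]
    rfl

theorem levelTransition_surjective {m n : ℕ} (h : m ≤ n) :
    Function.Surjective (levelTransition ι hT h) := by
  intro y
  choose x hx hxy using fun i ↦ (hT h).ge (y i).2
  exact ⟨fun i ↦ ⟨x i, hx i⟩, funext fun i ↦ Subtype.ext (hxy i)⟩

variable (π : M →ₗ[A] M) (ϖ : N →ₗ[A] N)

variable (ι I T) in
/-- The surjections from `M` onto the families of elements of `T n` that intertwine `π` with the
endomorphism induced by `ϖ`. -/
def levelSurjections (n : ℕ) : Set (M →ₗ[A] (ι → T n)) :=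
  {f | Function.Surjective f ∧
    ∀ x i, (f (π x) i : N ⧸ (I ^ n • ⊤ : Submodule A N)) = ϖ.reduceModIdeal (I ^ n) (f x i)}

variable {π ϖ}

theorem levelTransition_comp_mem {m n : ℕ} (h : m ≤ n) {f : M →ₗ[A] (ι → T n)}
    (hf : f ∈ levelSurjections ι I T π ϖ n) :
    levelTransition ι hT h ∘ₗ f ∈ levelSurjections ι I T π ϖ m := by
  refine ⟨(levelTransition_surjective hT h).comp hf.1, fun x i ↦ ?_⟩
  rw [LinearMap.comp_apply, LinearMap.comp_apply, coe_levelTransition, coe_levelTransition,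
    hf.2 x i]
  exact LinearMap.congr_fun (AdicCompletion.transitionMap_comp_reduceModIdeal I ϖ h) _

include hT in
/-- A compactness argument: isomorphisms chosen separately at each level can be chosen compatibly
because there are only finitely many at each level. -/
theorem exists_compatible_levelSurjections [Module.Finite A M] [∀ n, Finite (ι → T n)]
    (hne : ∀ n, (levelSurjections ι I T π ϖ n).Nonempty) :
    ∃ f : ∀ n, M →ₗ[A] (ι → T n), (∀ n, f n ∈ levelSurjections ι I T π ϖ n) ∧
      ∀ {m n} (h : m ≤ n), levelTransition ι hT h ∘ₗ f n = f m := by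
  have (n : ℕ) : Nonempty (levelSurjections ι I T π ϖ n) := (hne n).to_subtype
  have (n : ℕ) : Finite (M →ₗ[A] (ι → T n)) := finite_linearMap
  obtain ⟨f, hf⟩ := exists_seq_forall_proj_of_forall_finite
    (α := fun n ↦ levelSurjections ι I T π ϖ n)
    (fun h f ↦ ⟨_, levelTransition_comp_mem hT h f.2⟩)
    (fun _ f ↦ Subtype.ext <| LinearMap.ext fun x ↦ levelTransition_refl hT (f.1 x))
    (fun _ _ _ h h' f ↦ Subtype.ext <| LinearMap.ext fun x ↦
      levelTransition_levelTransition hT h h' (f.1 x))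
    (fun _ _ ↦ Set.toFinite _)
  exact ⟨fun n ↦ f n, fun n ↦ (f n).2, fun h ↦ congrArg Subtype.val (hf h)⟩

section Limit

variable {Tlim : Submodule (AdicCompletion I A) (AdicCompletion I N)}
  (hTlim : ∀ y, y ∈ Tlim ↔ ∀ n, y.val n ∈ T n)
  (g : ∀ n, (M ⧸ (I ^ n • ⊤ : Submodule A M)) →ₗ[A] (ι → T n))
  (hg : ∀ {m n} (h : m ≤ n) x,
    levelTransition ι hT h (g n x) = g m (AdicCompletion.transitionMap I M h x))

/-- The limit of a compatible family of linear maps from the quotients `M / I ^ n M` to powers of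
the submodules `T n ⊆ N / I ^ n N` with limit `Tlim`. -/
def limitMap : AdicCompletion I M →ₗ[AdicCompletion I A] (ι → Tlim) where
  toFun x i := ⟨⟨fun n ↦ g n (x.val n) i, fun {m n} h ↦ by
    rw [← coe_levelTransition hT, hg, x.2 h]⟩, (hTlim _).2 fun n ↦ (g n (x.val n) i).2⟩
  map_add' x y := funext fun i ↦ Subtype.ext <| AdicCompletion.ext fun n ↦
    congrArg (fun z ↦ (z i : N ⧸ (I ^ n • ⊤ : Submodule A N))) (map_add (g n) _ _)
  map_smul' a x := funext fun i ↦ Subtype.ext <| AdicCompletion.ext fun n ↦ by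
    obtain ⟨b, hb⟩ := Ideal.Quotient.mk_surjective (a.val n)
    change (g n (a.val n • x.val n) i : N ⧸ (I ^ n • ⊤ : Submodule A N)) =
      a.val n • (g n (x.val n) i : N ⧸ (I ^ n • ⊤ : Submodule A N))
    rw [← hb, ← Ideal.Quotient.algebraMap_eq, algebraMap_smul, algebraMap_smul, map_smul]
    rfl

theorem limitMap_val (x : AdicCompletion I M) (i : ι) (n : ℕ) :
    (limitMap hT hTlim g hg x i : AdicCompletion I N).val n = g n (x.val n) i :=
  rfl

theorem limitMap_bijective (hg_bij : ∀ n, Function.Bijective (g n)) :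
    Function.Bijective (limitMap hT hTlim g hg) := by
  refine ⟨fun x y hxy ↦ AdicCompletion.ext fun n ↦ (hg_bij n).1 <| funext fun i ↦
    Subtype.ext <| by rw [← limitMap_val hT hTlim g hg, hxy, limitMap_val], fun y ↦ ?_⟩
  choose x hx using fun n ↦ (hg_bij n).2 fun i ↦ ⟨_, (hTlim _).1 (y i).2 n⟩
  refine ⟨⟨x, fun {m n} h ↦ (hg_bij m).1 ?_⟩, funext fun i ↦ Subtype.ext <|
    AdicCompletion.ext fun n ↦ congrArg Subtype.val (congrFun (hx n) i)⟩
  rw [← hg h, hx, hx]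
  exact funext fun i ↦ Subtype.ext ((y i : AdicCompletion I N).2 h)

end Limit

theorem smul_top_le_ker {J : Ideal A} {T : Submodule A (N ⧸ (J • ⊤ : Submodule A N))}
    (f : M →ₗ[A] (ι → T)) : (J • ⊤ : Submodule A M) ≤ LinearMap.ker f :=
  Submodule.smul_le.2 fun a ha x _ ↦ funext fun i ↦ Subtype.ext <| by
    rw [map_smul]
    exact Module.isTorsionBySet_quotient_ideal_smul N J (x := f x i) (a := ⟨a, ha⟩)

include hT in
theorem exists_adicCompletion_equiv [Module.Finite A M]
    [∀ n, Finite (M ⧸ (I ^ n • ⊤ : Submodule A M))]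
    {Tlim : Submodule (AdicCompletion I A) (AdicCompletion I N)}
    (hTlim : ∀ y, y ∈ Tlim ↔ ∀ n, y.val n ∈ T n)
    (hlevel : ∀ n, ∃ f : (M ⧸ (I ^ n • ⊤ : Submodule A M)) ≃ₗ[A] (ι → T n),
      ∀ x i, (f (π.reduceModIdeal (I ^ n) x) i : N ⧸ (I ^ n • ⊤ : Submodule A N)) =
        ϖ.reduceModIdeal (I ^ n) (f x i)) :
    ∃ Θ : AdicCompletion I M ≃ₗ[AdicCompletion I A] (ι → Tlim), ∀ x i,
      (Θ (AdicCompletion.map I π x) i : AdicCompletion I N) = AdicCompletion.map I ϖ (Θ x i) := by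
  choose e he using hlevel
  have (n : ℕ) : Finite (ι → T n) := .of_equiv _ (e n).toEquiv
  obtain ⟨f, hf, hf_compat⟩ := exists_compatible_levelSurjections (π := π) (ϖ := ϖ) hT fun n ↦
    ⟨(e n).toLinearMap ∘ₗ Submodule.mkQ _, (e n).surjective.comp (Submodule.mkQ_surjective _),
      fun x ↦ he n (Submodule.mkQ _ x)⟩
  let g (n : ℕ) : (M ⧸ (I ^ n • ⊤ : Submodule A M)) →ₗ[A] (ι → T n) :=
    (I ^ n • ⊤ : Submodule A M).liftQ (f n) (smul_top_le_ker (f n))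
  have hg {m n : ℕ} (h : m ≤ n) (x : M ⧸ (I ^ n • ⊤ : Submodule A M)) :
      levelTransition ι hT h (g n x) = g m (AdicCompletion.transitionMap I M h x) := by
    obtain ⟨x, rfl⟩ := Submodule.mkQ_surjective _ x
    exact LinearMap.congr_fun (hf_compat h) x
  have hg_bij (n : ℕ) : Function.Bijective (g n) := by
    refine (Nat.bijective_iff_surjective_and_card (g n)).2 ⟨?_, Nat.card_congr (e n).toEquiv⟩
    exact fun y ↦ ((hf n).1 y).imp' (Submodule.mkQ _) fun _ ↦ id
  refine ⟨.ofBijective (limitMap hT hTlim g hg) (limitMap_bijective hT hTlim g hg hg_bij),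
    fun x i ↦ AdicCompletion.ext fun n ↦ ?_⟩
  obtain ⟨y, hy⟩ := Submodule.mkQ_surjective _ (x.val n)
  change (g n (π.reduceModIdeal (I ^ n) (x.val n)) i : N ⧸ (I ^ n • ⊤ : Submodule A N)) =
    ϖ.reduceModIdeal (I ^ n) (g n (x.val n) i)
  rw [← hy]
  exact (hf n).2 y i

end Tower

section FixedLevels

open Module

attribute [local instance] quotientModule smulCommClass_quotient

variable {A M N F L k : Type*} [CommRing A] [AddCommGroup M] [Module A M] [AddCommGroup N]
  [Module A N] [Field k] [Module k N] [SMulCommClass A k N]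

theorem mkQ_induction {J : Ideal A} {p : (N ⧸ (J • ⊤ : Submodule A N)) → Prop}
    (h : ∀ x, p (Submodule.mkQ _ x)) (x : N ⧸ (J • ⊤ : Submodule A N)) : p x :=
  (Submodule.mkQ_surjective _).forall.2 h x

theorem mkQ_smul (J : Ideal A) (b : k) (x : N) :
    Submodule.mkQ (J • ⊤ : Submodule A N) (b • x) = b • Submodule.mkQ (J • ⊤) x :=
  rfl

theorem transitionMap_mkQ {I : Ideal A} {m n : ℕ} (h : m ≤ n) (x : N) :
    AdicCompletion.transitionMap I N h (Submodule.mkQ (I ^ n • ⊤) x) = Submodule.mkQ _ x :=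
  Submodule.mapQ_apply _ _ _ x

theorem transitionMap_surjective (I : Ideal A) {m n : ℕ} (h : m ≤ n) :
    Function.Surjective (AdicCompletion.transitionMap I N h) := by
  intro y
  induction y using mkQ_induction with
  | h y => exact ⟨Submodule.mkQ (I ^ n • ⊤) y, transitionMap_mkQ h y⟩

theorem span_range_reduceModIdeal (J : Ideal A) {j : M →ₗ[A] N}
    (hj : Submodule.span k (Set.range j) = ⊤) :
    Submodule.span k (Set.range (j.reduceModIdeal J)) = ⊤ := by
  refine Submodule.eq_top_iff'.2 (mkQ_induction fun y ↦ ?_)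
  induction hj.ge (Submodule.mem_top (x := y)) using Submodule.span_induction with
  | zero => exact zero_mem _
  | mem _ hx =>
    obtain ⟨x, rfl⟩ := hx
    exact Submodule.subset_span ⟨Submodule.mkQ _ x, rfl⟩
  | add _ _ _ _ hx hy => exact add_mem hx hy
  | smul b _ _ hx => exact Submodule.smul_mem _ b hx

variable [Field F] [Fintype F] [Algebra F k] (I : Ideal A) {φ : N →ₗ[A] N}
  (hφ : ∀ (b : k) x, φ (b • x) = frobL F k b • φ x)

/-- The fixed points of `φ` on `N / I ^ n N`, the `n`-th level of the Tate module of `(N, φ)`. -/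
noncomputable def fixedLevel (n : ℕ) : Submodule A (N ⧸ (I ^ n • ⊤ : Submodule A N)) :=
  fixedSubmodule A (quotientMap (I ^ n) φ hφ) fun a x ↦
    ((φ.reduceModIdeal (I ^ n)).restrictScalars A).map_smul a x

theorem mem_eqLocus_map_iff (y : AdicCompletion I N) :
    y ∈ LinearMap.eqLocus (AdicCompletion.map I φ) .id ↔ ∀ n, y.val n ∈ fixedLevel I hφ n :=
  ⟨fun hy n ↦ congrArg (fun z : AdicCompletion I N ↦ z.val n) hy, fun hy ↦ AdicCompletion.ext hy⟩

variable {τ : M →ₗ[A] M} {j : M →ₗ[A] N} (hj_span : Submodule.span k (Set.range j) = ⊤)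
  (hφj : ∀ x, φ (j x) = j (τ x))

include hj_span hφj in
theorem injective_quotientMap {J : Ideal A} (hτ : Function.Surjective (τ.reduceModIdeal J))
    [FiniteDimensional k (N ⧸ (J • ⊤ : Submodule A N))] :
    Function.Injective (quotientMap J φ hφ) :=
  injective_of_span_range_eq_top_of_surjective _ (span_range_reduceModIdeal J hj_span) hτ
    (mkQ_induction fun x ↦ congrArg (Submodule.mkQ _) (hφj x))

theorem quotientMap_mkQ (J : Ideal A) (x : N) :
    quotientMap J φ hφ (Submodule.mkQ _ x) = Submodule.mkQ _ (φ x) :=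
  rfl

theorem transitionMap_smul {m n : ℕ} (h : m ≤ n) (b : k) (x : N ⧸ (I ^ n • ⊤ : Submodule A N)) :
    AdicCompletion.transitionMap I N h (b • x) = b • AdicCompletion.transitionMap I N h x := by
  induction x using mkQ_induction with
  | h x => rw [← mkQ_smul, transitionMap_mkQ, transitionMap_mkQ, mkQ_smul]

theorem transitionMap_quotientMap {m n : ℕ} (h : m ≤ n) (x : N ⧸ (I ^ n • ⊤ : Submodule A N)) :
    AdicCompletion.transitionMap I N h (quotientMap (I ^ n) φ hφ x) =
      quotientMap (I ^ m) φ hφ (AdicCompletion.transitionMap I N h x) := by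
  induction x using mkQ_induction with
  | h x => rw [quotientMap_mkQ, transitionMap_mkQ, transitionMap_mkQ, quotientMap_mkQ]

theorem map_transitionMap_fixedLevel [IsSepClosed k] [Algebra.IsAlgebraic F k] {m n : ℕ}
    [FiniteDimensional k (N ⧸ (I ^ n • ⊤ : Submodule A N))]
    (hφ_inj : Function.Injective (quotientMap (I ^ n) φ hφ)) (h : m ≤ n) :
    (fixedLevel I hφ n).map (AdicCompletion.transitionMap I N h) = fixedLevel I hφ m := by
  let f : (N ⧸ (I ^ n • ⊤ : Submodule A N)) →ₗ[k] N ⧸ (I ^ m • ⊤ : Submodule A N) :=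
    { toFun := AdicCompletion.transitionMap I N h
      map_add' := map_add _
      map_smul' := transitionMap_smul I h }
  have hf : Function.Surjective f := transitionMap_surjective I h
  have hfφ (x) : f (quotientMap (I ^ n) φ hφ x) = quotientMap (I ^ m) φ hφ (f x) :=
    transitionMap_quotientMap I hφ h x
  refine le_antisymm ?_ fun y hy ↦
    exists_map_eq_of_surjective (mem_periodicPts_of_injective hφ_inj) hf hfφ hy
  rintro _ ⟨x, hx, rfl⟩
  have hx : quotientMap (I ^ n) φ hφ x = x := hx
  change quotientMap (I ^ m) φ hφ (f x) = f x
  rw [← hfφ, hx]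

variable [Field L] [Algebra F L] [Algebra L k] [Module L M] [SMulCommClass A L M]
  (hj : ∀ (b : L) x, j (b • x) = algebraMap L k b • j x)

include hj hj_span in
theorem finiteDimensional_quotient (J : Ideal A) [Finite (M ⧸ (J • ⊤ : Submodule A M))] :
    FiniteDimensional k (N ⧸ (J • ⊤ : Submodule A N)) :=
  have : FiniteDimensional L (M ⧸ (J • ⊤ : Submodule A M)) := .of_finite
  finiteDimensional_of_span_range_eq_top (quotientMap J j hj) (span_range_reduceModIdeal J hj_span)

theorem injective_reduceModIdeal (J : Ideal A) {ρ : N →ₗ[A] M} (hρ : ∀ x, ρ (j x) = x) :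
    Function.Injective (j.reduceModIdeal J) :=
  Function.LeftInverse.injective (g := ρ.reduceModIdeal J)
    (mkQ_induction fun x ↦ congrArg (Submodule.mkQ _) (hρ x))

variable [Fintype L] {ρ : N →ₗ[A] M} (hρ : ∀ x, ρ (j x) = x) {ψ : N →ₗ[A] N}
  (hψ : ∀ (b : k) x, ψ (b • x) = frobL L k b • ψ x) (hψj : ∀ x, ψ (j x) = j x)
  {π : M →ₗ[A] M} {ϖ : N →ₗ[A] N} (hϖ : ∀ (b : k) x, ϖ (b • x) = b • ϖ x)
  (hφϖ : φ ∘ₗ ϖ = ϖ ∘ₗ φ) (hψϖ : ψ ∘ₗ ϖ = ϖ ∘ₗ ψ) (hϖj : ∀ x, ϖ (j x) = j (π x))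

variable [IsSepClosed k] [Algebra.IsAlgebraic L k] [Algebra.IsAlgebraic F k]

include hj_span hj hρ hψ hψj hϖ hφϖ hψϖ hϖj in
theorem exists_quotient_equiv_fixedLevel (n : ℕ) [Finite (M ⧸ (I ^ n • ⊤ : Submodule A M))]
    [FiniteDimensional k (N ⧸ (I ^ n • ⊤ : Submodule A N))]
    (hφ_inj : Function.Injective (quotientMap (I ^ n) φ hφ)) :
    ∃ f : (M ⧸ (I ^ n • ⊤ : Submodule A M)) ≃ₗ[A] (Fin (finrank F L) → fixedLevel I hφ n),
      ∀ x i, (f (π.reduceModIdeal (I ^ n) x) i : N ⧸ (I ^ n • ⊤ : Submodule A N)) =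
        ϖ.reduceModIdeal (I ^ n) (f x i) := by
  obtain ⟨f, hf⟩ := exists_equiv_pi_fixedSubmodule
    (j := (j.reduceModIdeal (I ^ n)).restrictScalars A) (φ := quotientMap (I ^ n) φ hφ)
    (ψ := quotientMap (I ^ n) ψ hψ)
    (((φ.reduceModIdeal (I ^ n)).restrictScalars A).map_smul)
    (((ψ.reduceModIdeal (I ^ n)).restrictScalars A).map_smul)
    (quotientMap (I ^ n) j hj).map_smulₛₗ (span_range_reduceModIdeal _ hj_span)
    (injective_reduceModIdeal _ hρ) hφ_inj
    (mkQ_induction fun x ↦ congrArg (Submodule.mkQ _) (hψj x))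
  exact ⟨f, hf _ (quotientMap (σ := .id k) (I ^ n) ϖ hϖ)
    (mkQ_induction fun x ↦ congrArg (Submodule.mkQ _) (LinearMap.congr_fun hφϖ x))
    (mkQ_induction fun x ↦ congrArg (Submodule.mkQ _) (LinearMap.congr_fun hψϖ x))
    (mkQ_induction fun x ↦ congrArg (Submodule.mkQ _) (hϖj x).symm)⟩

include hj_span hφj hj hρ hφ hψ hψj hϖ hφϖ hψϖ hϖj in
theorem exists_adicCompletion_equiv_eqLocus [Module.Finite A M]
    [∀ n, Finite (M ⧸ (I ^ n • ⊤ : Submodule A M))]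
    (hτ : ∀ n, Function.Surjective (τ.reduceModIdeal (I ^ n))) :
    ∃ Θ : AdicCompletion I M ≃ₗ[AdicCompletion I A]
        (Fin (finrank F L) → LinearMap.eqLocus (AdicCompletion.map I φ) .id),
      ∀ x i, (Θ (AdicCompletion.map I π x) i : AdicCompletion I N) =
        AdicCompletion.map I ϖ (Θ x i) := by
  have (n : ℕ) := finiteDimensional_quotient hj_span hj (I ^ n)
  have hφ_inj (n : ℕ) := injective_quotientMap hφ hj_span hφj (hτ n)
  exact exists_adicCompletion_equiv (fun {m n} ↦ map_transitionMap_fixedLevel I hφ (hφ_inj n))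
    (mem_eqLocus_map_iff I hφ) fun n ↦ exists_quotient_equiv_fixedLevel I hφ hj_span hj hρ hψ hψj
      hϖ hφϖ hψϖ hϖj n (hφ_inj n)

end FixedLevels

/-! ## The Tate module of an abelian `τ`-sheaf -/

theorem surjective_reduceModIdeal {A N N' : Type*} [CommRing A] [AddCommGroup N] [Module A N]
    [AddCommGroup N'] [Module A N'] {J : Ideal A} {s : A} (hs : IsUnit (Ideal.Quotient.mk J s))
    {f : N →ₗ[A] N'} (hf : ∀ y, ∃ x, f x = s • y) : Function.Surjective (f.reduceModIdeal J) := by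
  intro y
  obtain ⟨y, rfl⟩ := Submodule.mkQ_surjective _ y
  obtain ⟨x, hx⟩ := hf y
  obtain ⟨u, hu⟩ := hs.exists_left_inv
  refine ⟨u • Submodule.mkQ _ x, ?_⟩
  calc f.reduceModIdeal J (u • Submodule.mkQ _ x)
      = u • Submodule.mkQ _ (f x) := map_smul _ u _
    _ = u • Ideal.Quotient.mk J s • Submodule.mkQ _ y := by rw [hx]; rfl
    _ = Submodule.mkQ _ y := by rw [smul_smul, hu, one_smul]

section Sections

open IsDedekindDomain

variable {Fq Q : Type*} [Field Fq] [Field Q] [Algebra Fq Q] {C : PointedCurve Fq Q}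
variable {L : Type*} [Field L] [Algebra Fq L]

theorem ext_induction {R : Subalgebra Fq Q} {p : ext L R → Prop}
    (mul : ∀ (b : L) (a : R), p (algebraMap L (ext L R) b * toExt L R a))
    (add : ∀ x y, p x → p y → p (x + y)) (z : ext L R) : p z := by
  obtain ⟨_, t, rfl⟩ := z
  induction t using TensorProduct.induction_on with
  | zero =>
    convert mul 0 0
    exact Subtype.ext (by simp only [map_zero, zero_mul]; rfl)
  | tmul b a =>
    convert mul b a
    exact Subtype.ext (show b ⊗ₜ (a : Q) = (b ⊗ₜ[Fq] (1 : Q)) * ((1 : L) ⊗ₜ[Fq] (a : Q)) by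
      rw [Algebra.TensorProduct.tmul_mul_tmul, mul_one, one_mul])
  | add x y hx hy =>
    convert add _ _ hx hy
    exact Subtype.ext (map_add _ x y)

instance finite_AL [Finite L] : Module.Finite C.A (C.AL L) := by
  refine ⟨Submodule.fg_def.2 ⟨Set.range (algebraMap L (C.AL L)), Set.finite_range _,
    Submodule.eq_top_iff'.2 fun z ↦ ?_⟩⟩
  induction z using ext_induction with
  | add x y hx hy => exact add_mem hx hy
  | mul b a =>
    rw [mul_comm]
    exact Submodule.smul_mem _ a (Submodule.subset_span ⟨b, rfl⟩)

theorem exists_one_sub_mem_graphAff [Finite L] {c : Characteristic C L} {v : HeightOneSpectrum C.A}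
    (hv : ¬ c.IsPoint v) : ∃ b ∈ v.asIdeal, toExt L C.A (1 - b) ∈ c.graphAff := by
  cases c with
  | infinity => exact ⟨0, zero_mem _, Submodule.mem_top⟩
  | affine cstar =>
    have := Fintype.ofFinite L
    obtain ⟨a, ha, ha_ne⟩ := SetLike.not_le_iff_exists.1 fun h : v.asIdeal ≤ RingHom.ker cstar ↦
      hv (v.isMaximal.eq_of_le (RingHom.ker_ne_top _) h)
    refine ⟨a ^ (Fintype.card L - 1), Ideal.pow_mem_of_mem _ ha _
      (Nat.sub_pos_of_lt Fintype.one_lt_card), ?_⟩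
    have hcstar : cstar (a ^ (Fintype.card L - 1)) = 1 := by
      rw [map_pow, FiniteField.pow_card_sub_one_eq_one _ ha_ne]
    have hgraph : toExt L C.A (a ^ (Fintype.card L - 1)) -
        algebraMap L (C.AL L) (cstar (a ^ (Fintype.card L - 1))) ∈
        (Characteristic.affine cstar).graphAff := Ideal.subset_span ⟨_, rfl⟩
    rwa [hcstar, map_one, ← neg_mem_iff, neg_sub, ← map_one (toExt L C.A), ← map_sub] at hgraph

theorem finite_quotient_asIdeal [Finite Fq] (v : HeightOneSpectrum C.A) :
    Finite (C.A ⧸ v.asIdeal) := by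
  have := v.isMaximal
  let := Ideal.Quotient.field v.asIdeal
  have : Algebra.FiniteType Fq (C.A ⧸ v.asIdeal) :=
    .of_surjective (Ideal.Quotient.mkₐ Fq v.asIdeal) (Ideal.Quotient.mkₐ_surjective Fq v.asIdeal)
  have : Module.Finite Fq (C.A ⧸ v.asIdeal) := finite_of_finite_type_of_isJacobsonRing _ _
  exact Module.finite_of_finite Fq

variable [Fintype Fq] [Finite L]

theorem exists_sigma_eq {R : Subalgebra Fq Q} (z : ext L R) :
    ∃ z' : ext L R, sigma Fq Q L z' = z := by
  induction z using ext_induction with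
  | mul b a =>
    obtain ⟨b, rfl⟩ : ∃ b', frobL Fq L b' = b :=
      Finite.surjective_of_injective (frobL Fq L).injective b
    exact ⟨algebraMap L (ext L R) b * toExt L R a, by
      simp [toExt]⟩
  | add x y hx hy =>
    obtain ⟨x', hx⟩ := hx
    obtain ⟨y', hy⟩ := hy
    exact ⟨x' + y', by rw [Subalgebra.coe_add, map_add, hx, hy, Subalgebra.coe_add]⟩

namespace AbelianTauSheaf

variable {c : Characteristic C L} (F : AbelianTauSheaf.{w} C c)

theorem finite_M : Module.Finite C.A F.M :=
  have := (F.isLocallyFree 0).finite_aff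
  .trans (C.AL L) _

theorem finite_quotient_M (v : HeightOneSpectrum C.A) (n : ℕ) :
    Finite (F.M ⧸ (v.asIdeal ^ n • ⊤ : Submodule C.A F.M)) := by
  have := F.finite_M
  have := finite_quotient_asIdeal v
  have := Ideal.finite_quotient_pow (IsNoetherian.noetherian v.asIdeal) n
  have : Module.Finite (C.A ⧸ v.asIdeal ^ n) (F.M ⧸ (v.asIdeal ^ n • ⊤ : Submodule C.A F.M)) :=
    .of_restrictScalars_finite C.A _ _
  exact Module.finite_of_finite (C.A ⧸ v.asIdeal ^ n)

theorem affPi_tauM (m : F.M) : F.affPi (F.tauM m) = F.affTau m :=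
  (LinearEquiv.ofBijective F.affPi F.affPi_bijective).apply_symm_apply _

theorem mem_image_tau_of_mem_span {y : (F.F (0 + 1)).V}
    (hy : y ∈ Submodule.span (C.AL L) (F.tau 0 '' (F.F 0).aff)) : y ∈ F.tau 0 '' (F.F 0).aff := by
  induction hy using Submodule.span_induction with
  | zero => exact ⟨0, zero_mem _, map_zero _⟩
  | mem _ hy => exact hy
  | add _ _ _ _ hx hy =>
    obtain ⟨x, hx, rfl⟩ := hx
    obtain ⟨y, hy, rfl⟩ := hy
    exact ⟨x + y, add_mem hx hy, map_add _ _ _⟩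
  | smul z _ _ hx =>
    obtain ⟨x, hx, rfl⟩ := hx
    obtain ⟨z', hz'⟩ := exists_sigma_eq z
    refine ⟨z' • x, Submodule.smul_mem _ _ hx, ?_⟩
    exact ((F.tau 0).map_smulₛₗ (z' : L ⊗[Fq] Q) x).trans (congrArg (· • F.tau 0 x) hz')

theorem exists_tauM_eq {a : C.A} (ha : toExt L C.A a ∈ c.graphAff) (m : F.M) :
    ∃ x, F.tauM x = a ^ F.d • m := by
  have hgraph : toExt L C.A (a ^ F.d) ∈ c.graphAff ^ F.d :=
    map_pow (toExt L C.A) a F.d ▸ Ideal.pow_mem_pow ha _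
  obtain ⟨x, hx, hxm⟩ := F.mem_image_tau_of_mem_span
    (F.annihilates_aff 0 (Submodule.smul_mem_smul hgraph (F.affPi m).2))
  refine ⟨⟨x, hx⟩, F.affPi_bijective.1 (Subtype.ext ?_)⟩
  rw [affPi_tauM]
  exact hxm.trans ((F.Pi 0).map_smul (toExt L C.A (a ^ F.d) : L ⊗[Fq] Q) m).symm

theorem surjective_reduceModIdeal_tauM {v : HeightOneSpectrum C.A} (hv : ¬ c.IsPoint v) (n : ℕ) :
    Function.Surjective (F.tauM.reduceModIdeal (v.asIdeal ^ n)) := by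
  obtain ⟨b, hb, hgraph⟩ := exists_one_sub_mem_graphAff hv
  have hb_pow : Ideal.Quotient.mk (v.asIdeal ^ n) b ^ n = 0 :=
    map_pow (Ideal.Quotient.mk (v.asIdeal ^ n)) b n ▸
      Ideal.Quotient.eq_zero_iff_mem.2 (Ideal.pow_mem_pow hb n)
  refine surjective_reduceModIdeal ?_ (F.exists_tauM_eq hgraph)
  rw [map_pow, map_sub, map_one]
  exact (IsNilpotent.isUnit_one_sub ⟨n, hb_pow⟩).pow _

end AbelianTauSheaf

end Sections

section SeparableExtension

open IsDedekindDomain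

variable {Fq Q : Type*} [Field Fq] [Fintype Fq] [Field Q] [Algebra Fq Q] {C : PointedCurve Fq Q}
variable {L : Type*} [Field L] [Algebra Fq L] [Finite L] {c : Characteristic C L}

namespace AbelianTauSheaf

variable (F : AbelianTauSheaf.{w} C c)

instance : SMulCommClass C.A L F.M := .symm _ _ _

/-- The action of `L^sep` on `M ⊗_L L^sep` through the second factor. -/
noncomputable instance : Module (SeparableClosure L) F.Msep :=
  (TensorProduct.comm L F.M (SeparableClosure L)).toAddEquiv.module _

theorem smul_sep_tmulSep (b b' : SeparableClosure L) (m : F.M) :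
    b • F.tmulSep m b' = F.tmulSep m (b * b') :=
  rfl

instance : SMulCommClass C.A (SeparableClosure L) F.Msep where
  smul_comm a b x := by
    induction x using Msep.induction with
    | zero => simp only [smul_zero]
    | add x y hx hy => simp only [smul_add, hx, hy]
    | tmul m b' => rw [smul_tmulSep, smul_sep_tmulSep, smul_sep_tmulSep, smul_tmulSep]

/-- The inclusion `M → M ⊗_L L^sep`. -/
noncomputable def toMsep : F.M →ₗ[C.A] F.Msep where
  toFun m := F.tmulSep m 1
  map_add' m m' := TensorProduct.add_tmul m m' 1
  map_smul' a m := (F.smul_tmulSep a m 1).symm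

theorem tmulSep_eq_smul_toMsep (m : F.M) (b : SeparableClosure L) :
    F.tmulSep m b = b • F.toMsep m :=
  ((F.smul_sep_tmulSep b 1 m).trans (by rw [mul_one])).symm

theorem toMsep_smul (b : L) (m : F.M) :
    F.toMsep (b • m) = algebraMap L (SeparableClosure L) b • F.toMsep m := by
  rw [← tmulSep_eq_smul_toMsep, Algebra.algebraMap_eq_smul_one]
  exact TensorProduct.smul_tmul b m 1

theorem span_range_toMsep :
    Submodule.span (SeparableClosure L) (Set.range F.toMsep) = ⊤ :=
  Submodule.eq_top_iff'.2 fun x ↦ by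
    induction x using Msep.induction with
    | zero => exact zero_mem _
    | add x y hx hy => exact add_mem hx hy
    | tmul m b =>
      rw [tmulSep_eq_smul_toMsep]
      exact Submodule.smul_mem _ _ (Submodule.subset_span ⟨m, rfl⟩)

theorem exists_leftInverse_toMsep : ∃ ρ : F.Msep →ₗ[C.A] F.M, ρ ∘ₗ F.toMsep = .id := by
  obtain ⟨l, hl⟩ := (Algebra.linearMap L (SeparableClosure L)).exists_leftInverse_of_injective
    (LinearMap.ker_eq_bot.2 (algebraMap L (SeparableClosure L)).injective)
  have hl_one : l 1 = 1 := by simpa using LinearMap.congr_fun hl 1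
  let ρ : F.Msep →+ F.M := (TensorProduct.rid L F.M ∘ₗ l.lTensor F.M : _ →ₗ[L] F.M).toAddMonoidHom
  have hρ (m : F.M) (b : SeparableClosure L) : ρ (F.tmulSep m b) = l b • m := rfl
  refine ⟨{ ρ with map_smul' := fun a x ↦ ?_ },
    LinearMap.ext fun m ↦ (hρ m 1).trans (by rw [hl_one, one_smul]; rfl)⟩
  change ρ (a • x) = a • ρ x
  induction x using Msep.induction with
  | zero => rw [smul_zero, map_zero, smul_zero]
  | add x y hx hy => rw [smul_add, map_add, map_add, hx, hy, smul_add]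
  | tmul m b => rw [smul_tmulSep, hρ, hρ, smul_comm]

variable {F}

theorem mapSep_smul {φ : L →+* L} {f : F.M →ₗ[C.A] F.M} (hf : ∀ (b : L) x, f (b • x) = φ b • f x)
    {g : SeparableClosure L →ₛₗ[φ] SeparableClosure L} {b b' : SeparableClosure L}
    (hg : ∀ x, g (b * x) = b' * g x) (x : F.Msep) :
    F.mapSep f hf g (b • x) = b' • F.mapSep f hf g x := by
  induction x using Msep.induction with
  | zero => rw [smul_zero, map_zero, smul_zero]
  | add x y hx hy => rw [smul_add, map_add, map_add, hx, hy, smul_add]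
  | tmul m x => rw [smul_sep_tmulSep, mapSep_tmulSep, mapSep_tmulSep, smul_sep_tmulSep, hg]

variable (F)

theorem tauSep_smul (b : SeparableClosure L) (x : F.Msep) :
    F.tauSep (b • x) = frobL Fq (SeparableClosure L) b • F.tauSep x :=
  mapSep_smul F.tauM_smul (map_mul (FiniteField.frobeniusAlgHom Fq _) b) x

theorem tauSep_toMsep (m : F.M) : F.tauSep (F.toMsep m) = F.toMsep (F.tauM m) :=
  congrArg (F.tmulSep (F.tauM m)) (map_one (FiniteField.frobeniusAlgHom Fq (SeparableClosure L)))

theorem frobSep_smul (b : SeparableClosure L) (x : F.Msep) :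
    F.frobSep (b • x) = b • F.frobSep x :=
  mapSep_smul (φ := .id L) F.frobM_smul (fun _ ↦ rfl) x

theorem frobSep_toMsep (m : F.M) : F.frobSep (F.toMsep m) = F.toMsep (F.frobM m) :=
  rfl

section FrobeniusOfL

variable [Fintype L]

/-- The `s`-Frobenius of `L^sep`, acting on the second factor of `M ⊗_L L^sep`; its fixed points
are the elements of `M`. -/
noncomputable def sepFrob : F.Msep →ₗ[C.A] F.Msep :=
  F.mapSep (φ := .id L) .id (fun _ _ ↦ rfl)
    (FiniteField.frobeniusAlgHom L (SeparableClosure L)).toLinearMap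

theorem sepFrob_smul (b : SeparableClosure L) (x : F.Msep) :
    F.sepFrob (b • x) = frobL L (SeparableClosure L) b • F.sepFrob x :=
  mapSep_smul (φ := .id L) (fun _ _ ↦ rfl) (map_mul (FiniteField.frobeniusAlgHom L _) b) x

theorem sepFrob_toMsep (m : F.M) : F.sepFrob (F.toMsep m) = F.toMsep m :=
  congrArg (F.tmulSep m) (map_one (FiniteField.frobeniusAlgHom L (SeparableClosure L)))

theorem sepFrob_comp_frobSep : F.sepFrob ∘ₗ F.frobSep = F.frobSep ∘ₗ F.sepFrob :=
  LinearMap.ext fun x ↦ by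
    rw [LinearMap.comp_apply, LinearMap.comp_apply]
    induction x using Msep.induction with
    | zero => simp only [map_zero]
    | add x y hx hy => simp only [map_add, hx, hy]
    | tmul m b => rfl

end FrobeniusOfL

end AbelianTauSheaf

end SeparableExtension

section TateModule

open IsDedekindDomain

variable {Fq Q : Type*} [Field Fq] [Fintype Fq] [Field Q] [Algebra Fq Q] {C : PointedCurve Fq Q}
variable {L : Type*} [Field L] [Algebra Fq L] [Finite L] {c : Characteristic C L}

namespace AbelianTauSheaf

theorem exists_completion_equiv_tateModule (F : AbelianTauSheaf.{w} C c)
    {v : HeightOneSpectrum C.A} (hv : ¬ c.IsPoint v) :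
    ∃ Θ : AdicCompletion v.asIdeal F.M ≃ₗ[Av v] (Fin (Module.finrank Fq L) → F.tateModule v),
      ∀ x i, Θ (AdicCompletion.map v.asIdeal F.frobM x) i = F.tateFrob v (Θ x i) := by
  have := Fintype.ofFinite L
  have : Module.Finite Fq L := .of_finite
  have : Algebra.IsAlgebraic Fq (SeparableClosure L) := .trans Fq L _
  have := F.finite_M
  have := F.finite_quotient_M v
  obtain ⟨ρ, hρ⟩ := F.exists_leftInverse_toMsep
  obtain ⟨Θ, hΘ⟩ := exists_adicCompletion_equiv_eqLocus v.asIdeal F.tauSep_smul F.span_range_toMsep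
    F.tauSep_toMsep F.toMsep_smul (LinearMap.congr_fun hρ) F.sepFrob_smul F.sepFrob_toMsep
    F.frobSep_smul F.tauSep_comp_frobSep F.sepFrob_comp_frobSep F.frobSep_toMsep
    (F.surjective_reduceModIdeal_tauM hv)
  exact ⟨Θ, fun x i ↦ Subtype.ext (hΘ x i)⟩

end AbelianTauSheaf

end TateModule

/-! ## Comparison with the generic fibre -/

section BaseChange

variable {A M : Type*} [CommRing A] [AddCommGroup M] [Module A M]

theorem exists_baseChange_equiv_of_equiv {B Y : Type*} [CommRing B] [Algebra A B]
    [AddCommGroup Y] [Module B Y] (K : Type*) [CommRing K] [Algebra A K] [Algebra B K]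
    [IsScalarTower A B K] (E : B ⊗[A] M ≃ₗ[B] Y) {f : M →ₗ[A] M} {g : Y →ₗ[B] Y}
    (h : ∀ x, E (f.baseChange B x) = g (E x)) :
    ∃ G : K ⊗[A] M ≃ₗ[K] K ⊗[B] Y, ∀ x, G (f.baseChange K x) = g.baseChange K (G x) := by
  refine ⟨(TensorProduct.AlgebraTensorModule.cancelBaseChange A B K K M).symm ≪≫ₗ
    E.baseChange B K _ _, fun x ↦ ?_⟩
  induction x using TensorProduct.induction_on with
  | zero => simp only [map_zero]
  | add x y hx hy => simp only [map_add, hx, hy]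
  | tmul a x => exact congrArg (a ⊗ₜ[B] ·) (h (1 ⊗ₜ x))

-- Mathlib's version for finite modules over a Noetherian ring needs `M` in the universe of `A`.
theorem bijective_ofTensorProduct [IsNoetherianRing A] (I : Ideal A) [Module.Finite A M] :
    Function.Bijective (AdicCompletion.ofTensorProduct I M) := by
  obtain ⟨n, p, hp⟩ := Module.Finite.exists_fin' A M
  let e : M ≃ₗ[A] (Fin n → A) ⧸ LinearMap.ker p := (p.quotKerEquivOfSurjective hp).symm
  have h := (AdicCompletion.ofTensorProduct_bijective_of_finite_of_isNoetherian I
    ((Fin n → A) ⧸ LinearMap.ker p)).comp (e.baseChange A (AdicCompletion I A) _ _).bijective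
  have hcomm : ⇑(AdicCompletion.congr I e) ∘ AdicCompletion.ofTensorProduct I M =
      AdicCompletion.ofTensorProduct I _ ∘ e.baseChange A (AdicCompletion I A) _ _ :=
    funext (LinearMap.congr_fun (AdicCompletion.ofTensorProduct_naturality I e.toLinearMap))
  exact ((AdicCompletion.congr I e).bijective.of_comp_iff' _).1 (hcomm ▸ h)

theorem exists_baseChange_adicCompletion_equiv [IsNoetherianRing A] (I : Ideal A)
    [Module.Finite A M] {Q V : Type*} [CommRing Q] [Algebra A Q] [AddCommGroup V] [Module Q V]
    [Module A V] [IsScalarTower A Q V] {i : M →ₗ[A] V} (hi : IsBaseChange Q i) (K : Type*)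
    [CommRing K] [Algebra (AdicCompletion I A) K] [Algebra A K] [Algebra Q K]
    [IsScalarTower A (AdicCompletion I A) K] [IsScalarTower A Q K] {f : M →ₗ[A] M} {g : V →ₗ[Q] V}
    (h : ∀ m, i (f m) = g (i m)) :
    ∃ E : K ⊗[Q] V ≃ₗ[K] K ⊗[AdicCompletion I A] AdicCompletion I M,
      ∀ x, E (g.baseChange K x) = (AdicCompletion.map I f).baseChange K (E x) := by
  have hi_comm (x) : hi.equiv (f.baseChange Q x) = g (hi.equiv x) := by
    induction x using TensorProduct.induction_on with
    | zero => simp only [map_zero]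
    | add x y hx hy => simp only [map_add, hx, hy]
    | tmul a x => rw [LinearMap.baseChange_tmul, hi.equiv_tmul, hi.equiv_tmul, h, map_smul]
  obtain ⟨G, hG⟩ := exists_baseChange_equiv_of_equiv K hi.equiv hi_comm
  obtain ⟨G', hG'⟩ := exists_baseChange_equiv_of_equiv K
    (LinearEquiv.ofBijective _ (bijective_ofTensorProduct (M := M) I)) (f := f)
    (g := AdicCompletion.map I f)
    fun x ↦ (LinearMap.congr_fun (AdicCompletion.ofTensorProduct_naturality I f) x).symm
  refine ⟨G.symm ≪≫ₗ G', fun x ↦ ?_⟩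
  obtain ⟨x, rfl⟩ := G.surjective x
  rw [← hG, LinearEquiv.trans_apply, LinearEquiv.trans_apply, G.symm_apply_apply,
    G.symm_apply_apply, hG']

theorem exists_baseChange_equiv_pi (K : Type*) [CommRing K] [Algebra A K] {X : Type*}
    [AddCommGroup X] [Module A X] {n : ℕ} (Θ : M ≃ₗ[A] (Fin n → X)) {f : M →ₗ[A] M}
    {g : X →ₗ[A] X} (h : ∀ x i, Θ (f x) i = g (Θ x i)) :
    ∃ H : K ⊗[A] M ≃ₗ[K] (Fin n → K ⊗[A] X),
      ∀ x, H (f.baseChange K x) = piEnd n (g.baseChange K) (H x) := by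
  refine ⟨Θ.baseChange A K _ _ ≪≫ₗ TensorProduct.piRight A K K _, fun x ↦ ?_⟩
  induction x using TensorProduct.induction_on with
  | zero => simp only [map_zero]
  | add x y hx hy => simp only [map_add, hx, hy]
  | tmul a x => exact funext fun i ↦ congrArg (a ⊗ₜ[A] ·) (h x i)

end BaseChange

section RationalTateModule

open IsDedekindDomain

variable {Fq Q : Type*} [Field Fq] [Field Q] [Algebra Fq Q] {C : PointedCurve Fq Q}

theorem exists_algebra_Qv (v : HeightOneSpectrum C.A) :
    ∃ _ : Algebra Q (Qv v), ∀ a : C.A,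
      algebraMap Q (Qv v) a = algebraMap (Av v) (Qv v) (algebraMap C.A (Av v) a) := by
  have := IsHausdorff.of_isDomain v.asIdeal v.isPrime.ne_top
  have hinj : Function.Injective ((algebraMap (Av v) (Qv v)).comp (algebraMap C.A (Av v))) :=
    (IsFractionRing.injective (Av v) (Qv v)).comp (AdicCompletion.of_injective v.asIdeal C.A)
  exact ⟨(IsFractionRing.lift hinj).toAlgebra, IsFractionRing.lift_algebraMap hinj⟩

variable [Fintype Fq] {L : Type*} [Field L] [Algebra Fq L] [Finite L] {c : Characteristic C L}

namespace AbelianTauSheaf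

variable (F : AbelianTauSheaf.{w} C c)

theorem phi_coe (m : F.M) : F.phi (m : (F.F 0).V) = F.tauM m := by
  apply F.injective_Pi 0
  rw [Pi_phi]
  exact congrArg Subtype.val (F.affPi_tauM m).symm

theorem phi_pow_coe (n : ℕ) (m : F.M) : (F.phi ^ n) (m : (F.F 0).V) = ((F.tauM ^ n) m : F.M) := by
  induction n with
  | zero => rfl
  | succ n ih => rw [pow_succ', pow_succ', Module.End.mul_apply, Module.End.mul_apply, ih, phi_coe]

theorem isBaseChange_aff :
    IsBaseChange Q ((F.F 0).aff.subtype.restrictScalars C.A : F.M →ₗ[C.A] (F.F 0).V) := by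
  rw [← isLocalizedModule_iff_isBaseChange (nonZeroDivisors C.A) Q]
  have hs_ne (s : nonZeroDivisors C.A) : ((s : C.A) : Q) ≠ 0 := by simp
  refine ⟨fun s ↦ ?_, fun y ↦ ?_, fun h ↦ ⟨1, congrArg _ (Subtype.ext h)⟩⟩
  · rw [Module.End.isUnit_iff]
    exact MulAction.bijective (Units.mk0 ((s : C.A) : Q) (hs_ne s))
  · obtain ⟨s, hs, hsy⟩ :=
      exists_smul_mem exists_nonZeroDivisors_mul_mem (F.isLocallyFree 0).span_aff y
    exact ⟨(⟨s • y, hsy⟩, ⟨s, hs⟩), rfl⟩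

variable {v : HeightOneSpectrum C.A} (hv : ¬ c.IsPoint v)

include hv

theorem exists_equiv_rationalTateModule [Algebra Q (Qv v)]
    (halg : ∀ a : C.A,
      algebraMap Q (Qv v) a = algebraMap (Av v) (Qv v) (algebraMap C.A (Av v) a)) :
    ∃ G : Qv v ⊗[Q] (F.F 0).V ≃ₗ[Qv v] (Fin (Module.finrank Fq L) → F.rationalTateModule v),
      ∀ x, G ((F.phi ^ Module.finrank Fq L).baseChange (Qv v) x) =
        piEnd (Module.finrank Fq L) (F.piv v) (G x) := by
  have := F.finite_M
  have : IsScalarTower C.A (Av v) (Qv v) := .of_algebraMap_eq halg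
  obtain ⟨Θ, hΘ⟩ := F.exists_completion_equiv_tateModule hv
  obtain ⟨E, hE⟩ := exists_baseChange_adicCompletion_equiv v.asIdeal F.isBaseChange_aff (Qv v)
    (f := F.frobM) fun m ↦ (F.phi_pow_coe _ m).symm
  obtain ⟨H, hH⟩ := exists_baseChange_equiv_pi (Qv v) Θ hΘ
  exact ⟨E ≪≫ₗ H, fun x ↦ (congrArg H (hE x)).trans (hH (E x))⟩

theorem finite_rationalTateModule : Module.Finite (Qv v) (F.rationalTateModule v) := by
  have := F.finite_Q 0
  have : Module.Finite Fq L := .of_finite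
  obtain ⟨_, halg⟩ := exists_algebra_Qv v
  obtain ⟨G, -⟩ := F.exists_equiv_rationalTateModule hv halg
  have := Module.Finite.equiv G
  exact Module.Finite.of_pi (fun _ ↦ F.rationalTateModule v)
    (⟨0, Module.finrank_pos⟩ : Fin (Module.finrank Fq L))

theorem finrank_intertwiners_piv (F' : AbelianTauSheaf.{w} C c) :
    Module.finrank (Qv v) (intertwiners (F.piv v) (F'.piv v)) =
      Module.finrank Q (linearIntertwiners L F.phi F'.phi) := by
  have := Fintype.ofFinite L
  have : Module.Finite Fq L := .of_finite
  have := F.finite_Q 0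
  have := F'.finite_Q 0
  let e := Module.finrank Fq L
  obtain ⟨_, halg⟩ := exists_algebra_Qv v
  obtain ⟨G, hG⟩ := F.exists_equiv_rationalTateModule hv halg
  obtain ⟨G', hG'⟩ := F'.exists_equiv_rationalTateModule hv halg
  have := F.finite_rationalTateModule hv
  have := F'.finite_rationalTateModule hv
  have he : 0 < e := Module.finrank_pos
  refine Nat.eq_of_mul_eq_mul_left he (Nat.eq_of_mul_eq_mul_left he ?_)
  calc e * (e * Module.finrank (Qv v) (intertwiners (F.piv v) (F'.piv v)))
    _ = Module.finrank (Qv v) (intertwiners (piEnd e (F.piv v)) (piEnd e (F'.piv v))) :=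
      (finrank_intertwiners_piEnd e _ _).symm
    _ = Module.finrank (Qv v)
          (intertwiners ((F.phi ^ e).baseChange (Qv v)) ((F'.phi ^ e).baseChange (Qv v))) :=
      (intertwinersCongr G G' hG hG').finrank_eq.symm
    _ = Module.finrank Q (intertwiners (F.phi ^ e) (F'.phi ^ e)) :=
      finrank_intertwiners_baseChange (Qv v) _ _
    _ = e * Module.finrank Q (intertwiners F.phi F'.phi) :=
      finrank_intertwiners_pow F.phi_bijective F'.phi_smul_L
    _ = e * (e * Module.finrank Q (linearIntertwiners L F.phi F'.phi)) :=
      congrArg (e * ·) (finrank_intertwiners_eq_mul_finrank_linearIntertwiners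
        algebraMap_smul_eq algebraMap_smul_eq F.phi_smul_L F'.phi_smul_L F.phi_bijective)

end AbelianTauSheaf

end RationalTateModule

end TauSheaf

theorem mainTheorem6 {Fq Q L : Type*} [Field Fq] [Fintype Fq] [Field Q] [Algebra Fq Q]
    [Field L] [Algebra Fq L] [Finite L]
    (C : TauSheaf.PointedCurve Fq Q) (c : TauSheaf.Characteristic C L)
    (F F' : TauSheaf.AbelianTauSheaf C c) (hweight : F.weight = F'.weight)
    (v : IsDedekindDomain.HeightOneSpectrum C.A) (hv : ¬ c.IsPoint v)
    (hss : (F.piv v).IsSemisimple) (hss' : (F'.piv v).IsSemisimple) :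
    Module.rank Q (TauSheaf.AbelianTauSheaf.QHom F F') =
      (TauSheaf.rPairing (TauSheaf.charPoly (F.piv v)) (TauSheaf.charPoly (F'.piv v)) : ℕ) := by
  rw [TauSheaf.AbelianTauSheaf.rank_QHom hweight]
  have := F.finite_rationalTateModule hv
  have := F'.finite_rationalTateModule hv
  rw [← TauSheaf.finrank_intertwiners_of_isSemisimple hss hss', F.finrank_intertwiners_piv hv F']
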